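/- Let $p$ be a prime, let $\chi:\mathbb F_p\to\mathbb Z_p$ be the Teichmüller (multiplicative) section of the reduction map, and let $\Lambda=\mathbb Z[\chi(\mathbb F_p),\tfrac1{p(p-1)}]\cap\mathbb Z_p$. In $\Lambda[z]/(z^p-1)$ put $y_i=\sum_{m\in\mathbb F_p^\times}\chi(m)^{-i}(1-z^m)$, and let $w_1=1,w_2,\dots,w_{p-1}\in\Lambda^\times$ and $w_p=p\,w_{p-1}$ be the Tate–Oort constants, defined by $y_1^i=w_iy_i$ for $1\le i\le p$. Let $S$ be a $\Lambda$-scheme, $L$ an invertible sheaf on $S$, and let $a\in\Gamma(S,L^{\otimes(p-1)})$ and $b\in\Gamma(S,L^{\otimes(1-p)})$ satisfy $a\otimes b=w_p1_{\mathcal O_S}$. Let $G=G^L_{a,b}$ be the associated Tate–Oort group scheme, which is finite locally free of rank $p$ over $S$: for an $S$-scheme $T$, $G(T)$ is the set of sections $x$ of $L_T$ with $x^{\otimes p}=x\otimes a$, with the group law $$x*x'=x+x'+\frac{1}{1-p}\sum_{i=1}^{p-1}b\otimes\frac{x^{\otimes i}}{w_i}\otimes\frac{x'^{\otimes(p-i)}}{w_{p-i}}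 .$$ Sections $x_1,\dots,x_N$ of a finite locally free $S$-scheme $Z$ of rank $N$ are a *full set of sections* if for every $\operatorname{Spec}R\to S$ and every $f\in\Gamma(Z_R,\mathcal O_{Z_R})$ the norm of $f$ is $\prod_if(x_i)$. A homomorphism $\gamma:(\mathbb Z/p)_S\to G$ of $S$-group schemes is a *generator* if the sections $\gamma(i)$, $i\in\mathbb Z/p$, are a full set of sections of $G$. A homomorphism $\kappa:G\to\mu_{p,S}$ is a *cogenerator* if its Cartier dual $(\mathbb Z/p)_S\to G^\vee$ is a generator. 1. Let $\gamma:(\mathbb Z/p)_S\to G$ be a homomorphism of $S$-group schemes given by a section $u\in\Gamma(S,L)$ with $u^{\otimes p}=u\otimes a$ (that is, $\gamma(1)=u$ in $G(S)$). Then $\gamma$ is a generator if and only if $u^{\otimes(p-1)}=a$. 2. Let $\kappa:G\to\mu_{p,S}$ be a homomorphism of $S$-group schemes given by a section $v\in\Gamma(S,L^{-1})$ with $v^{\otimes p}=v\otimes b$ (that is, the function $\sum_{m\in\mathbb F_p^\times}\chi(m)^{-1}(1-z^m)$ on $\mu_{p,S}=\operatorname{Spec}\mathcal O_S[z]/(z^p-1)$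 pulls back under $\kappa$ to the function $v$ on $G$, where $L^{-1}\subset\mathcal O_G$ by $v(x)=v\otimes x$). Then $\kappa$ is a cogenerator if and only if $v^{\otimes(p-1)}=b$. -/

import Mathlib

open CategoryTheory Limits AlgebraicGeometry TensorProduct

universe u

set_option linter.unusedSectionVars false

namespace TateOort

noncomputable section

/-! ### The ring `Λ` and the constants `w_i` -/

/-- The Teichmüller section `χ : 𝔽_p → ℤ_p`: the unique multiplicative section of the reduction
map `ℤ_p → 𝔽_p`. -/
def chi (p : ℕ) [Fact p.Prime] (m : ZMod p) : ℤ_[p] :=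
  WittVector.equiv p (WittVector.teichmuller p m)

theorem chi_mul (p : ℕ) [Fact p.Prime] (m n : ZMod p) : chi p (m * n) = chi p m * chi p n := by
  simp [chi]

theorem toZMod_chi (p : ℕ) [Fact p.Prime] (m : ZMod p) : PadicInt.toZMod (chi p m) = m := by
  have key : ∀ x : ℤ_[p], WittVector.constantCoeff ((WittVector.equiv p).symm x)
      = PadicInt.toZMod x := by
    intro x
    have hx : x - (x.zmodRepr : ℤ_[p]) ∈ IsLocalRing.maximalIdeal ℤ_[p] :=
      PadicInt.sub_zmodRepr_mem x
    rw [PadicInt.maximalIdeal_eq_span_p, Ideal.mem_span_singleton] at hx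
    obtain ⟨y, hy⟩ := hx
    have e : x = (x.zmodRepr : ℤ_[p]) + p * y := by rw [← hy]; ring
    rw [e]
    simp only [map_add, map_mul, map_natCast, CharP.cast_eq_zero, zero_mul, add_zero]
  have h := key (chi p m)
  rw [← h, chi, RingEquiv.symm_apply_apply]
  simp [WittVector.constantCoeff]

/-- `Λ = ℤ[χ(𝔽_p), 1/(p(p-1))] ∩ ℤ_p`, a subring of `ℚ_p`. -/
def Lambda (p : ℕ) [Fact p.Prime] : Subring ℚ_[p] :=
  Subring.closure (insert (1 / ((p : ℚ_[p]) * ((p : ℚ_[p]) - 1)))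
    (Set.range fun m : ZMod p => (chi p m : ℚ_[p]))) ⊓ PadicInt.subring p

/-- `χ` with values in `Λ`. -/
def chiL (p : ℕ) [Fact p.Prime] (m : ZMod p) : Lambda p :=
  ⟨(chi p m : ℚ_[p]), Subring.subset_closure (Or.inr ⟨m, rfl⟩), (chi p m).2⟩

/-- For an element `z` of a `Λ`-algebra `A` with `z ^ p = 1`, the element
`y(z) = (p - 1) e₁(1 - z) = ∑_{m ∈ 𝔽_p^×} χ(m)⁻¹ (1 - z ^ m)`.
(The term `m = 0` of the sum below is zero.) -/
def eigenY (p : ℕ) [Fact p.Prime] {A : Type*} [CommRing A] (str : Lambda p →+* A) (z : A) : A :=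
  ∑ m : ZMod p, str (chiL p m⁻¹) * (1 - z ^ m.val)

/-- The constants `w_1 = 1, w_2, …, w_{p-1}, w_p = p w_{p-1}` of Tate and Oort. In the group algebra
`Λ[ℤ/p] = Λ[z]/(z ^ p - 1)`, which is the algebra of `μ_p`, put
`y_i = (p - 1) e_i(1 - z) = ∑_{m ∈ 𝔽_p^×} χ(m)^{-i} (1 - z ^ m)`; then `w_i` is defined by
`y_1 ^ i = w_i y_i` for `1 ≤ i ≤ p`. The coefficient of `z` in `y_i` being `-1`, `w_i` is minus the
coefficient of `z` in `y_1 ^ i`. (The value at `0` is not used.) -/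
def w (p : ℕ) [Fact p.Prime] (i : ℕ) : Lambda p :=
  -(eigenY p (algebraMap (Lambda p) (MonoidAlgebra (Lambda p) (Multiplicative (ZMod p))))
      (MonoidAlgebra.single (Multiplicative.ofAdd 1) 1) ^ i).coeff (Multiplicative.ofAdd 1)

/-- The coefficient `1 / ((1 - p) w_i w_{p-i})` of the group law, for `1 ≤ i ≤ p - 1`; the elements
`1 - p`, `w_i` and `w_{p-i}` are units of `Λ`. -/
def lawCoeff (p : ℕ) [Fact p.Prime] (i : ℕ) : Lambda p :=
  Ring.inverse ((1 - (p : Lambda p)) * w p i * w p (p - i))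

/-! ### The constant group scheme `ℤ/p` and the group scheme `μ_p` -/

/-- The algebra of functions `ℤ/p → R`, that is, the algebra of the constant group scheme `ℤ/p` over
`R`. It is a type synonym because its comultiplication below, dual to the addition of `ℤ/p`,
is not the componentwise one. -/
def FunAlg (R : Type u) (p : ℕ) : Type u := ZMod p → R

namespace FunAlg
variable (R : Type u) [CommRing R] (p : ℕ)

instance : CommRing (FunAlg R p) := inferInstanceAs (CommRing (ZMod p → R))
instance : Algebra R (FunAlg R p) := inferInstanceAs (Algebra R (ZMod p → R))

/-- The indicator function of `i`. -/
def delta (i : ZMod p) : FunAlg R p := (Pi.single i 1 : ZMod p → R)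

theorem delta_apply (i j : ZMod p) : delta R p i j = if j = i then 1 else 0 := by
  simp [delta, Pi.single_apply]

variable [NeZero p]

theorem sum_smul_delta (f : FunAlg R p) : ∑ i : ZMod p, f i • delta R p i = f := by
  funext j
  change (∑ i : ZMod p, f i • (Pi.single i 1 : ZMod p → R)) j = f j
  rw [Finset.sum_apply, Finset.sum_eq_single j] <;> simp +contextual [eq_comm]

theorem delta_mul (i j : ZMod p) :
    delta R p i * delta R p j = if i = j then delta R p i else 0 := by
  funext k
  change (Pi.single i 1 : ZMod p → R) k * (Pi.single j 1 : ZMod p → R) k =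
    (if i = j then delta R p i else 0 : FunAlg R p) k
  split_ifs with h
  · subst h
    change _ = (Pi.single i 1 : ZMod p → R) k
    by_cases hk : k = i <;> simp [hk]
  · change _ = (0 : R)
    simp only [Pi.single_apply]
    grind

variable {R p} in
theorem hom_ext {M : Type*} [AddCommMonoid M] [Module R M] {f g : FunAlg R p →ₗ[R] M}
    (h : ∀ i, f (delta R p i) = g (delta R p i)) : f = g := by
  ext x
  rw [← sum_smul_delta R p x]
  simp [h]

/-- The comultiplication `f ↦ ((i, j) ↦ f (i + j))`. -/
def comulLin : FunAlg R p →ₗ[R] FunAlg R p ⊗[R] FunAlg R p where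
  toFun f := ∑ i : ZMod p, ∑ j : ZMod p, f (i + j) • (delta R p i ⊗ₜ[R] delta R p j)
  map_add' f g := by
    simp only [← Finset.sum_add_distrib, ← add_smul]; rfl
  map_smul' r f := by
    simp only [Finset.smul_sum, smul_smul]; rfl

/-- The counit `f ↦ f 0`. -/
def counitLin : FunAlg R p →ₗ[R] R where
  toFun f := f 0
  map_add' _ _ := rfl
  map_smul' _ _ := rfl

/-- The antipode `f ↦ (i ↦ f (-i))`. -/
def antipodeLin : FunAlg R p →ₗ[R] FunAlg R p where
  toFun f := fun i => f (-i)
  map_add' _ _ := rfl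
  map_smul' _ _ := rfl

theorem comulLin_delta (k : ZMod p) : comulLin R p (delta R p k) =
    ∑ i : ZMod p, delta R p i ⊗ₜ[R] delta R p (k - i) := by
  simp only [comulLin, LinearMap.coe_mk, AddHom.coe_mk, delta_apply]
  refine Finset.sum_congr rfl fun i _ => ?_
  rw [Finset.sum_eq_single (k - i)]
  · simp
  · intro j _ hj
    rw [if_neg, zero_smul]
    intro h; apply hj; rw [← h]; ring
  · simp

theorem sum_delta : ∑ i : ZMod p, delta R p i = 1 := by
  have := sum_smul_delta R p 1
  simpa [show ∀ i : ZMod p, (1 : FunAlg R p) i = 1 from fun _ => rfl] using this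

theorem counitLin_delta (k : ZMod p) : counitLin R p (delta R p k) = if k = 0 then 1 else 0 := by
  change delta R p k 0 = _
  rw [delta_apply]; grind

theorem antipodeLin_delta (k : ZMod p) : antipodeLin R p (delta R p k) = delta R p (-k) := by
  funext j
  change delta R p k (-j) = delta R p (-k) j
  rw [delta_apply, delta_apply]; grind

instance instCoalgebra : Coalgebra R (FunAlg R p) where
  comul := comulLin R p
  counit := counitLin R p
  coassoc := by
    refine hom_ext fun k => ?_
    simp only [LinearMap.comp_apply, comulLin_delta, map_sum, LinearMap.rTensor_tmul,
      LinearMap.lTensor_tmul, TensorProduct.sum_tmul, TensorProduct.tmul_sum,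
      LinearEquiv.coe_coe, TensorProduct.assoc_tmul]
    rw [Finset.sum_comm]
    refine Finset.sum_congr rfl fun i _ => ?_
    refine Fintype.sum_equiv (Equiv.subRight i) _ _ fun j => ?_
    simp
  rTensor_counit_comp_comul := by
    refine hom_ext fun k => ?_
    simp only [LinearMap.comp_apply, comulLin_delta, map_sum, LinearMap.rTensor_tmul,
      counitLin_delta, TensorProduct.mk_apply]
    rw [Finset.sum_eq_single 0] <;> simp +contextual
  lTensor_counit_comp_comul := by
    refine hom_ext fun k => ?_
    simp only [LinearMap.comp_apply, comulLin_delta, map_sum, LinearMap.lTensor_tmul,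
      counitLin_delta, LinearMap.flip_apply, TensorProduct.mk_apply]
    rw [Finset.sum_eq_single k]
    · simp
    · intro j _ hj
      rw [if_neg (by grind)]; simp
    · simp

theorem comul_delta (k : ZMod p) : Coalgebra.comul (R := R) (delta R p k) =
    ∑ i : ZMod p, delta R p i ⊗ₜ[R] delta R p (k - i) := comulLin_delta R p k

theorem counit_delta (k : ZMod p) : Coalgebra.counit (R := R) (delta R p k) =
    if k = 0 then 1 else 0 := counitLin_delta R p k

instance instBialgebra : Bialgebra R (FunAlg R p) :=
  Bialgebra.mk' R (FunAlg R p) rfl (fun {_ _} => rfl)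
    (by
      change ∑ i : ZMod p, ∑ j : ZMod p, (1 : R) • (delta R p i ⊗ₜ[R] delta R p j) = 1
      simp only [one_smul, ← TensorProduct.tmul_sum, ← TensorProduct.sum_tmul, sum_delta]
      rfl)
    (fun {a b} => by
      rw [← sum_smul_delta R p a, ← sum_smul_delta R p b]
      simp only [Finset.sum_mul_sum, map_sum, map_smul, smul_mul_smul_comm]
      refine Finset.sum_congr rfl fun i _ => Finset.sum_congr rfl fun j _ => ?_
      congr 1
      rw [delta_mul, comul_delta, comul_delta, Finset.sum_mul_sum]
      simp only [Algebra.TensorProduct.tmul_mul_tmul, delta_mul]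
      split_ifs with h
      · subst h
        rw [comul_delta]
        refine Finset.sum_congr rfl fun k _ => ?_
        rw [Finset.sum_eq_single k]
        · simp
        · intro l _ hl
          simp [Ne.symm hl]
        · simp
      · rw [map_zero]
        symm
        refine Finset.sum_eq_zero fun k _ => Finset.sum_eq_zero fun l _ => ?_
        by_cases hkl : k = l
        · subst hkl
          rw [if_neg (show ¬ i - k = j - k from fun hh => h (sub_left_injective hh)),
            TensorProduct.tmul_zero]
        · simp [hkl])

instance instHopfAlgebra : HopfAlgebra R (FunAlg R p) where
  antipode := antipodeLin R p
  mul_antipode_rTensor_comul := by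
    refine hom_ext fun k => ?_
    simp only [LinearMap.comp_apply, comul_delta, map_sum, LinearMap.rTensor_tmul,
      antipodeLin_delta, LinearMap.mul'_apply, delta_mul]
    rw [counit_delta, Algebra.linearMap_apply]
    split_ifs with h
    · subst h
      rw [map_one, ← sum_delta R p]
      exact Fintype.sum_equiv (Equiv.neg _) _ _ (fun i => by simp)
    · rw [map_zero]
      refine Finset.sum_eq_zero fun i _ => if_neg ?_
      grind
  mul_antipode_lTensor_comul := by
    refine hom_ext fun k => ?_
    simp only [LinearMap.comp_apply, comul_delta, map_sum, LinearMap.lTensor_tmul,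
      antipodeLin_delta, LinearMap.mul'_apply, delta_mul]
    rw [counit_delta, Algebra.linearMap_apply]
    split_ifs with h
    · subst h
      rw [map_one, ← sum_delta R p]
      exact Finset.sum_congr rfl (fun i _ => by simp)
    · rw [map_zero]
      refine Finset.sum_eq_zero fun i _ => if_neg ?_
      grind
/-- Evaluation of functions at `i`. -/
def ev (i : ZMod p) : FunAlg R p →+* R := Pi.evalRingHom (fun _ : ZMod p => R) i

end FunAlg

/-- The base change to `S` of the affine scheme `Spec A` over `Spec ℤ`. (For universe reasons `ℤ` is
written `ULift ℤ`.) -/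
def baseChange (S : Scheme.{u}) (A : Type u) [CommRing A] [Algebra (ULift.{u} ℤ) A] : Over S :=
  Over.mk (pullback.snd (Spec.map (CommRingCat.ofHom (algebraMap (ULift.{u} ℤ) A)))
    (specULiftZIsTerminal.from S))

/-- The group scheme over `S` obtained by base change from the `ℤ`-group scheme `Spec A`, for a
Hopf algebra `A`. -/
instance (S : Scheme.{u}) (A : Type u) [CommRing A] [HopfAlgebra (ULift.{u} ℤ) A] :
    GrpObj (baseChange S A) :=
  letI : GrpObj (Over.mk (Spec.map (CommRingCat.ofHom (algebraMap (ULift.{u} ℤ) A)))) :=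
    instGrpObjSpecAsOverSpec (R := CommRingCat.of (ULift.{u} ℤ)) (A := CommRingCat.of A)
  Over.grpObjMkPullbackSnd

/-- The constant group scheme `(ℤ/p)_S`. -/
abbrev constGroup (S : Scheme.{u}) (p : ℕ) [Fact p.Prime] : Over S :=
  baseChange S (FunAlg (ULift.{u} ℤ) p)

/-- The section `i` of `(ℤ/p)_S`. -/
def constSection (S : Scheme.{u}) (p : ℕ) [Fact p.Prime] (i : ZMod p) :
    Over.mk (𝟙 S) ⟶ constGroup S p :=
  Over.homMk (pullback.lift
    (specULiftZIsTerminal.from S ≫ Spec.map (CommRingCat.ofHom (FunAlg.ev (ULift.{u} ℤ) p i)))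
    (𝟙 S) (specULiftZIsTerminal.hom_ext _ _)) (pullback.lift_snd _ _ _)

/-- The group scheme `μ_{p,S}`, with `μ_p = Spec ℤ[ℤ/p] = Spec ℤ[z]/(z ^ p - 1)` and `z`
group-like. -/
abbrev muGroup (S : Scheme.{u}) (p : ℕ) [Fact p.Prime] : Over S :=
  baseChange S (MonoidAlgebra (ULift.{u} ℤ) (Multiplicative (ZMod p)))

/-- The tautological function `z` on `μ_{p,S}`. -/
def muCoord (S : Scheme.{u}) (p : ℕ) [Fact p.Prime] : Γ((muGroup S p).left, ⊤) :=
  (pullback.fst (Spec.map (CommRingCat.ofHom (algebraMap (ULift.{u} ℤ)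
      (MonoidAlgebra (ULift.{u} ℤ) (Multiplicative (ZMod p))))))
    (specULiftZIsTerminal.from S)).appTop
    ((Scheme.ΓSpecIso (CommRingCat.of
      (MonoidAlgebra (ULift.{u} ℤ) (Multiplicative (ZMod p))))).inv
        (MonoidAlgebra.single (Multiplicative.ofAdd 1) 1))

/-! ### Invertible sheaves and sections of their tensor powers -/

section InvertibleSheaf

variable {S : Scheme.{u}}

/-- Restriction of a section of a sheaf of modules to a smaller open subset. -/
abbrev resM (L : S.Modules) {U V : S.Opens} (h : V ≤ U) (t : Γ(L, U)) : Γ(L, V) :=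
  L.presheaf.map (homOfLE h).op t

/-- Restriction of a function to a smaller open subset. -/
abbrev res {X : Scheme.{u}} {U V : X.Opens} (h : V ≤ U) (g : Γ(X, U)) : Γ(X, V) :=
  X.presheaf.map (homOfLE h).op g

/-- A section `t` of `L` over `U` is a frame if `g ↦ g t` is an isomorphism `𝒪_U ≅ L|_U`. -/
def IsFrame (L : S.Modules) {U : S.Opens} (t : Γ(L, U)) : Prop :=
  ∀ (V : S.Opens) (h : V ≤ U), Function.Bijective fun g : Γ(S, V) => g • resM L h t

/-- `L` is an invertible sheaf: it has a frame in a neighbourhood of every point. -/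
def IsInvertibleSheaf (L : S.Modules) : Prop :=
  ∀ x : S, ∃ U : S.Opens, x ∈ U ∧ ∃ t : Γ(L, U), IsFrame L t

variable {L : S.Modules}

theorem IsFrame.res {U V : S.Opens} {t : Γ(L, U)} (ht : IsFrame L t) (h : V ≤ U) :
    IsFrame L (resM L h t) := by
  intro W hW
  have e : resM L hW (resM L h t) = resM L (hW.trans h) t := by
    simp only [resM, ← ConcreteCategory.comp_apply, ← Functor.map_comp]
    rfl
  rw [e]
  exact ht W (hW.trans h)

theorem IsFrame.smul {U : S.Opens} {t : Γ(L, U)} (ht : IsFrame L t) (g : Γ(S, U)ˣ) :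
    IsFrame L ((g : Γ(S, U)) • t) := by
  intro V h
  have hu : IsUnit (TateOort.res h (g : Γ(S, U))) := g.isUnit.map (S.presheaf.map (homOfLE h).op).hom
  have e : (fun x : Γ(S, V) => x • resM L h ((g : Γ(S, U)) • t)) =
      (fun x : Γ(S, V) => x • resM L h t) ∘ fun x => x * TateOort.res h (g : Γ(S, U)) := by
    funext x
    simp only [resM, Function.comp_apply, Scheme.Modules.map_smul, smul_smul]
  rw [e]
  refine (ht V h).comp ?_
  obtain ⟨r, hr⟩ := hu
  rw [← hr]
  exact (Units.mulRight r).bijective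

/-- A global section of `L^{⊗ n}`, for an invertible sheaf `L` and an integer `n`, given by its
coordinates: for every local frame `t` of `L` over `U` it is `coeff U t • t^{⊗ n}` over `U`, with
`coeff U t ∈ 𝒪(U)`; these coordinates are compatible with restriction and are multiplied by
`g^{-n}` when `t` is replaced by `g t`. -/
structure TensorSection (L : S.Modules) (n : ℤ) where
  coeff : ∀ (U : S.Opens) (t : Γ(L, U)), IsFrame L t → Γ(S, U)
  coeff_res : ∀ {U V : S.Opens} (h : V ≤ U) (t : Γ(L, U)) (ht : IsFrame L t),
    coeff V (resM L h t) (ht.res h) = res h (coeff U t ht)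
  coeff_smul : ∀ (U : S.Opens) (t : Γ(L, U)) (ht : IsFrame L t) (g : Γ(S, U)ˣ),
    coeff U ((g : Γ(S, U)) • t) (ht.smul g) = ((g ^ (-n) : Γ(S, U)ˣ) : Γ(S, U)) * coeff U t ht

namespace TensorSection

/-- A section of `L` as a section of `L^{⊗ 1}`: its coordinate `c` is defined by `u|_U = c t`. -/
def ofSection (u : Γ(L, ⊤)) : TensorSection L 1 where
  coeff U t ht := (Equiv.ofBijective _ (ht U le_rfl)).symm (resM L le_top u)
  coeff_res {U V} h t ht := by
    rw [Equiv.symm_apply_eq]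
    have e := Equiv.apply_symm_apply (Equiv.ofBijective _ (ht U le_rfl)) (resM L le_top u)
    have e' := congrArg (resM L h) e
    simp only [Equiv.ofBijective_apply, resM, Scheme.Modules.map_smul,
      ← ConcreteCategory.comp_apply, ← Functor.map_comp] at e' ⊢
    exact e'.symm
  coeff_smul U t ht g := by
    rw [Equiv.symm_apply_eq]
    have e := Equiv.apply_symm_apply (Equiv.ofBijective _ (ht U le_rfl)) (resM L le_top u)
    refine e.symm.trans ?_
    generalize (Equiv.ofBijective _ (ht U le_rfl)).symm (resM L le_top u) = c
    have e1 : S.presheaf.map (homOfLE (le_refl U)).op (g : Γ(S, U)) = (g : Γ(S, U)) := by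
      rw [show (homOfLE (le_refl U)).op = 𝟙 _ from rfl, S.presheaf.map_id]
      rfl
    simp only [Equiv.ofBijective_apply, resM, Scheme.Modules.map_smul, smul_smul]
    rw [e1, zpow_neg_one, mul_right_comm, Units.inv_mul, one_mul]

/-- The section `c` of `L^{⊗ 0} = 𝒪_S`. -/
def const (L : S.Modules) (c : Γ(S, ⊤)) : TensorSection L 0 where
  coeff U _ _ := res le_top c
  coeff_res h t ht := by
    simp only [res, ← ConcreteCategory.comp_apply, ← Functor.map_comp]
    rfl
  coeff_smul U t ht g := by simp

/-- The tensor product of a section of `L^{⊗ m}` and a section of `L^{⊗ n}`. -/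
def tmul {m n : ℤ} (x : TensorSection L m) (y : TensorSection L n) : TensorSection L (m + n) where
  coeff U t ht := x.coeff U t ht * y.coeff U t ht
  coeff_res h t ht := by rw [x.coeff_res h t ht, y.coeff_res h t ht]; exact (map_mul _ _ _).symm
  coeff_smul U t ht g := by
    rw [x.coeff_smul U t ht, y.coeff_smul U t ht, neg_add, zpow_add, Units.val_mul]
    ring

/-- The tensor power `x^{⊗ k}` of a section of `L^{⊗ n}`. -/
def pow {n : ℤ} (x : TensorSection L n) (k : ℕ) : TensorSection L (n * k) where
  coeff U t ht := x.coeff U t ht ^ k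
  coeff_res h t ht := by rw [x.coeff_res h t ht]; exact (map_pow _ _ _).symm
  coeff_smul U t ht g := by
    rw [x.coeff_smul U t ht, mul_pow, ← Units.val_pow_eq_pow_val, ← zpow_natCast, ← zpow_mul, neg_mul]

/-- Equality of a section of `L^{⊗ m}` and a section of `L^{⊗ n}`, to be used when `m = n` holds but
not by definition: equality of all coordinates. -/
def Same {m n : ℤ} (x : TensorSection L m) (y : TensorSection L n) : Prop :=
  ∀ (U : S.Opens) (t : Γ(L, U)) (ht : IsFrame L t), x.coeff U t ht = y.coeff U t ht

end TensorSection

end InvertibleSheaf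

/-! ### The group scheme `G^L_{a,b}` -/

/-- The value at a `T`-valued point `g` of `G` of a function on the part of `G` over `U ⊆ S`. -/
def eval {S : Scheme.{u}} {G T : Over S} (g : T ⟶ G) (U : S.Opens) :
    Γ(G.left, G.hom ⁻¹ᵁ U) →+* Γ(T.left, T.hom ⁻¹ᵁ U) :=
  (g.left.appLE (G.hom ⁻¹ᵁ U) (T.hom ⁻¹ᵁ U)
    (by rw [← Scheme.Hom.comp_preimage, Over.w])).hom

/-- The pullback to `T` of a function on `U ⊆ S`. -/
abbrev pull {S : Scheme.{u}} (T : Over S) (U : S.Opens) : Γ(S, U) →+* Γ(T.left, T.hom ⁻¹ᵁ U) :=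
  (T.hom.app U).hom

open scoped MonObj in
/-- Let `S` be a scheme over `Λ`, with structure map `str : Λ → Γ(S, 𝒪_S)`, let `L` be an invertible
sheaf on `S`, and let `a` and `b` be sections of `L^{⊗ (p-1)}` and `L^{⊗ (1-p)}` with
`a ⊗ b = w_p`. An element of `IsoTateOort str a b G` is an isomorphism of the `S`-group scheme `G`,
affine over `S`, with the Tate-Oort group scheme `G^L_{a,b}`, that is, with the relative spectrum of
`Sym(L^{-1}) / ((a - 1) ⊗ L^{⊗ -p}) = 𝒪_S ⊕ L^{⊗ -1} ⊕ ⋯ ⊕ L^{⊗ -(p-1)}` endowed with the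
comultiplication
`x ↦ x ⊗ 1 + 1 ⊗ x + b / (1 - p) ∑_{i=1}^{p-1} (x ^ i / w_i) ⊗ (x ^ (p-i) / w_{p-i})`.
It is given by the inclusion of `L^{-1}` in `𝒪_G`: for a frame `t` of `L` over `U`,
`coord U t` is the image of the dual frame of `L^{-1}`. In these terms the points of `G` over an
`S`-scheme `T` are the sections `x` of `L_T` with `x^{⊗ p} = x ⊗ a`. -/
structure IsoTateOort {p : ℕ} [Fact p.Prime] {S : Scheme.{u}} (str : Lambda p →+* Γ(S, ⊤))
    {L : S.Modules} (a : TensorSection L (p - 1)) (b : TensorSection L (1 - p))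
    (G : Over S) [GrpObj G] where
  coord : ∀ (U : S.Opens) (t : Γ(L, U)), IsFrame L t → Γ(G.left, G.hom ⁻¹ᵁ U)
  coord_res : ∀ {U V : S.Opens} (h : V ≤ U) (t : Γ(L, U)) (ht : IsFrame L t),
    coord V (resM L h t) (ht.res h) = res (G.hom.preimage_mono h) (coord U t ht)
  coord_smul : ∀ (U : S.Opens) (t : Γ(L, U)) (ht : IsFrame L t) (g : Γ(S, U)ˣ),
    coord U ((g : Γ(S, U)) • t) (ht.smul g) =
      pull G U ((g⁻¹ : Γ(S, U)ˣ) : Γ(S, U)) * coord U t ht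
  /-- The relation `x ^ p = a x`. -/
  coord_pow : ∀ (U : S.Opens) (t : Γ(L, U)) (ht : IsFrame L t),
    coord U t ht ^ p = pull G U (a.coeff U t ht) * coord U t ht
  /-- Over an affine open `U` the functions on `G` are free over `𝒪(U)` on `1, x, …, x ^ (p-1)`. -/
  basis : ∀ (U : S.Opens) (t : Γ(L, U)) (ht : IsFrame L t), IsAffineOpen U →
    ∀ f : Γ(G.left, G.hom ⁻¹ᵁ U), ∃! c : Fin p → Γ(S, U),
      f = ∑ i : Fin p, pull G U (c i) * coord U t ht ^ (i : ℕ)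
  /-- The group law. -/
  coord_mul : ∀ (T : Over S) (g h : T ⟶ G) (U : S.Opens) (t : Γ(L, U)) (ht : IsFrame L t),
    eval (g * h) U (coord U t ht) =
      eval g U (coord U t ht) + eval h U (coord U t ht) +
        pull T U (b.coeff U t ht) * ∑ i ∈ Finset.Ico 1 p, pull T U (res le_top (str (lawCoeff p i))) *
          eval g U (coord U t ht) ^ i * eval h U (coord U t ht) ^ (p - i)

section Homs

variable {p : ℕ} [Fact p.Prime] {S : Scheme.{u}} {str : Lambda p →+* Γ(S, ⊤)} {L : S.Modules}
  {a : TensorSection L (p - 1)} {b : TensorSection L (1 - p)} {G : Over S} [GrpObj G]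

/-- The homomorphism `γ : (ℤ/p)_S → G = G^L_{a,b}` is given by the section `u` of `L`: the section
`γ(1)` of `G` is the one with coordinate `u`. -/
def GivenBySection (e : IsoTateOort str a b G) (γ : constGroup S p ⟶ G) (u : Γ(L, ⊤)) : Prop :=
  ∀ (U : S.Opens) (t : Γ(L, U)) (ht : IsFrame L t),
    eval (constSection S p 1 ≫ γ) U (e.coord U t ht) =
      pull (Over.mk (𝟙 S)) U ((TensorSection.ofSection u).coeff U t ht)

/-- The function `κ^*(z)` on `G`, for `κ : G → μ_{p,S}`. -/
def muPull (κ : G ⟶ muGroup S p) : Γ(G.left, ⊤) := κ.left.appTop (muCoord S p)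

/-- The homomorphism `κ : G = G^L_{a,b} → μ_{p,S}` is given by the section `v` of `L^{-1}`: the
coordinate `y = (p - 1) e_1(1 - z)` of `μ_{p,S} = G^{𝒪_S}_{w_p,1}` is pulled back to the function `v`
of `L^{-1} ⊆ 𝒪_G`. -/
def GivenByCosection (e : IsoTateOort str a b G) (κ : G ⟶ muGroup S p)
    (v : TensorSection L (-1)) : Prop :=
  ∀ (U : S.Opens) (t : Γ(L, U)) (ht : IsFrame L t),
    res le_top (eigenY p (G.hom.appTop.hom.comp str) (muPull κ)) =
      pull G U (v.coeff U t ht) * e.coord U t ht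

end Homs

/-! ### Full sets of sections, generators, cogenerators -/

/-- `n` is the determinant of the endomorphism `l` of the `R`-module `M`, locally free of finite
rank: at each prime `q` of `R`, where `M_q` is free, it is the determinant of `l_q`. -/
def IsDet (R : Type*) {M : Type*} [CommRing R] [AddCommGroup M] [Module R M]
    (l : M →ₗ[R] M) (n : R) : Prop :=
  ∀ (q : Ideal R) [q.IsPrime], algebraMap R (Localization.AtPrime q) n =
    LinearMap.det (l.baseChange (Localization.AtPrime q))

section Functions

variable {S : Scheme.{u}}

/-- The `R`-algebra of functions on `Z_R = Z ×_S Spec R`, for `f : Spec R → S`. -/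
abbrev Fn (Z : Over S) {R : CommRingCat.{u}} (f : Spec R ⟶ S) : Type u := Γ(pullback Z.hom f, ⊤)

instance (Z : Over S) {R : CommRingCat.{u}} (f : Spec R ⟶ S) : Algebra R (Fn Z f) :=
  RingHom.toAlgebra
    (((pullback.snd Z.hom f).appTop.hom.comp (Scheme.ΓSpecIso R).inv.hom :
      R →+* Γ(pullback Z.hom f, ⊤)))

/-- The value of a function on `Z_R` at a section `x` of `Z` over `S`. -/
def evalSection {Z : Over S} (x : Over.mk (𝟙 S) ⟶ Z) {R : CommRingCat.{u}} (f : Spec R ⟶ S) :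
    Fn Z f →+* R :=
  (Scheme.ΓSpecIso R).hom.hom.comp
    (pullback.lift (f ≫ x.left) (𝟙 (Spec R)) (by simp)).appTop.hom

/-- The value in `B` of the functions on `Z_R` at a `B`-valued point of `Z`, for an `R`-algebra
`B`. -/
def evalPoint {Z : Over S} {R : CommRingCat.{u}} {f : Spec R ⟶ S} (B : Type u) [CommRing B]
    [Algebra R B]
    (g : Over.mk (Spec.map (CommRingCat.ofHom (algebraMap R B)) ≫ f) ⟶ Z) : Fn Z f →ₐ[R] B where
  toRingHom := ((Scheme.ΓSpecIso (CommRingCat.of B)).hom.hom.comp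
    (pullback.lift g.left (Spec.map (CommRingCat.ofHom (algebraMap R B)))
      (Over.w g)).appTop.hom : Γ(pullback Z.hom f, ⊤) →+* B)
  commutes' r := by
    have h : (Scheme.ΓSpecIso R).inv ≫ (pullback.snd Z.hom f).appTop ≫
        (pullback.lift g.left (Spec.map (CommRingCat.ofHom (algebraMap R B))) (Over.w g)).appTop ≫
          (Scheme.ΓSpecIso (CommRingCat.of B)).hom = CommRingCat.ofHom (algebraMap R B) := by
      rw [← Scheme.Hom.comp_appTop_assoc, pullback.lift_snd, ← Scheme.ΓSpecIso_inv_naturality_assoc,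
        Iso.inv_hom_id, Category.comp_id]
    exact congr($h r)

/-- The `B`-valued point of `Z`, for an `R`-algebra `B`, at which the functions on the affine scheme
`Z_R` take the values given by `θ`. -/
def pointOf {Z : Over S} [IsAffineHom Z.hom] {R : CommRingCat.{u}} {f : Spec R ⟶ S} {B : Type u}
    [CommRing B] [Algebra R B] (θ : Fn Z f →ₐ[R] B) :
    Over.mk (Spec.map (CommRingCat.ofHom (algebraMap R B)) ≫ f) ⟶ Z :=
  haveI : IsAffine (pullback Z.hom f) := isAffine_of_isAffineHom (pullback.snd Z.hom f)
  Over.homMk (Spec.map ((CommRingCat.ofHom (θ : Fn Z f →+* B) : Γ(pullback Z.hom f, ⊤) ⟶ CommRingCat.of B)) ≫ (pullback Z.hom f).isoSpec.inv ≫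
    pullback.fst Z.hom f) (by
      have h : CommRingCat.ofHom (algebraMap R B) = (Scheme.ΓSpecIso R).inv ≫
          (pullback.snd Z.hom f).appTop ≫ (CommRingCat.ofHom (θ : Fn Z f →+* B) : Γ(pullback Z.hom f, ⊤) ⟶ CommRingCat.of B) := by
        ext r
        exact (θ.commutes r).symm
      simp only [Over.mk_hom, Category.assoc]
      rw [pullback.condition, ← Scheme.isoSpec_inv_naturality_assoc, h, Spec.map_comp,
        Spec.map_comp, Category.assoc, Category.assoc, Scheme.isoSpec_Spec_inv])

theorem evalPoint_pointOf {Z : Over S} [IsAffineHom Z.hom] {R : CommRingCat.{u}} {f : Spec R ⟶ S}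
    {B : Type u} [CommRing B] [Algebra R B] (θ : Fn Z f →ₐ[R] B) :
    evalPoint B (pointOf θ) = θ := by
  have : IsAffine (pullback Z.hom f) := isAffine_of_isAffineHom (pullback.snd Z.hom f)
  have e : pullback.lift (pointOf θ).left (Spec.map (CommRingCat.ofHom (algebraMap R B)))
      (Over.w (pointOf θ)) = Spec.map ((CommRingCat.ofHom (θ : Fn Z f →+* B) : Γ(pullback Z.hom f, ⊤) ⟶ CommRingCat.of B)) ≫
        (pullback Z.hom f).isoSpec.inv := by
    apply pullback.hom_ext
    · rw [pullback.lift_fst, Category.assoc]; rfl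
    · rw [pullback.lift_snd, Category.assoc, ← Scheme.isoSpec_inv_naturality, Scheme.isoSpec_Spec_inv,
        ← Spec.map_comp, ← Spec.map_comp]
      congr 1
      ext r
      exact (θ.commutes r).symm
  have h : (pullback.lift (pointOf θ).left (Spec.map (CommRingCat.ofHom (algebraMap R B)))
      (Over.w (pointOf θ))).appTop ≫ (Scheme.ΓSpecIso (CommRingCat.of B)).hom =
        (CommRingCat.ofHom (θ : Fn Z f →+* B) : Γ(pullback Z.hom f, ⊤) ⟶ CommRingCat.of B) := by
    rw [e, Scheme.Hom.comp_appTop, Category.assoc, Scheme.ΓSpecIso_naturality,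
      ← Scheme.toSpecΓ_appTop, ← Scheme.Hom.comp_appTop_assoc, Scheme.toSpecΓ_isoSpec_inv]
    simp
  ext x
  exact congr($h x)

/-- Let `Z` be finite locally free over `S`. The family `x` of sections of `Z`, as many as the rank
of `Z`, is a full set of sections: for every `Spec R → S` and every function `h` on
`Z_R = Z ×_S Spec R`, the norm of `h`, that is, the determinant of the multiplication by `h`, is the
product of the `h(x_i)`. -/
def IsFullSetOfSections {Z : Over S} {ι : Type*} [Fintype ι] (x : ι → (Over.mk (𝟙 S) ⟶ Z)) : Prop :=
  ∀ (R : CommRingCat.{u}) (f : Spec R ⟶ S) (h : Fn Z f),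
    IsDet R (LinearMap.mulLeft R h) (∏ i, evalSection (x i) f h)

/-- A homomorphism `γ : (ℤ/p)_S → G` to a finite locally free group scheme of order `p` is a
generator if the sections `γ(i)`, `i ∈ ℤ/p`, are a full set of sections of `G`. -/
def IsGenerator {p : ℕ} [Fact p.Prime] {G : Over S} (γ : constGroup S p ⟶ G) : Prop :=
  IsFullSetOfSections fun i : ZMod p => constSection S p i ≫ γ

open scoped MonObj in
/-- The comultiplication `A → A ⊗ A` of the algebra `A` of functions on `G_R = G ×_S Spec R`, for a
group scheme `G` affine over `S`: a function `h` is sent to the value of `h` at the product of the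
two tautological `A ⊗ A`-valued points of `G`. -/
def comul (G : Over S) [GrpObj G] [IsAffineHom G.hom] {R : CommRingCat.{u}} (f : Spec R ⟶ S) :
    Fn G f →ₐ[R] Fn G f ⊗[R] Fn G f :=
  evalPoint (Fn G f ⊗[R] Fn G f)
    (pointOf (Algebra.TensorProduct.includeLeft : Fn G f →ₐ[R] Fn G f ⊗[R] Fn G f) *
      pointOf (Algebra.TensorProduct.includeRight : Fn G f →ₐ[R] Fn G f ⊗[R] Fn G f))

/-- For `G` finite locally free over `S`, the functions on the Cartier dual `(G_R)^∨ = (G^∨)_R` are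
the linear forms on the algebra `A` of functions on `G_R`, with the multiplication
`φ * ψ = (φ ⊗ ψ) ∘ comultiplication`. This is the multiplication by `φ`. -/
def dualMulLeft (G : Over S) [GrpObj G] [IsAffineHom G.hom] {R : CommRingCat.{u}} (f : Spec R ⟶ S)
    (φ : Module.Dual R (Fn G f)) : Module.Dual R (Fn G f) →ₗ[R] Module.Dual R (Fn G f) where
  toFun ψ := LinearMap.mul' R R ∘ₗ TensorProduct.map φ ψ ∘ₗ (comul G f).toLinearMap
  map_add' ψ ψ' := by
    rw [TensorProduct.map_add_right, LinearMap.add_comp, LinearMap.comp_add]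
  map_smul' r ψ := by
    rw [TensorProduct.map_smul_right, LinearMap.smul_comp, LinearMap.comp_smul, RingHom.id_apply]

/-- A homomorphism `κ : G → μ_{p,S}` from a finite locally free group scheme of order `p` is a
cogenerator if its Cartier dual `κ^∨ : (ℤ/p)_S → G^∨` is a generator. An element `i ∈ ℤ/p` is the
character `z ^ i` of `μ_p`, so the section `κ^∨(i)` of `G^∨` is the character `κ^*(z) ^ i` of `G`,
and a function `φ` on `(G^∨)_R` takes at this section the value `φ(κ^*(z) ^ i)`. Thus the
condition that the `κ^∨(i)` are a full set of sections of `G^∨` is: for every `Spec R → S` and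
every function `φ` on `(G^∨)_R`, the norm of `φ` is the product of the `φ(κ^*(z) ^ i)`. -/
def IsCogenerator {p : ℕ} [Fact p.Prime] {G : Over S} [GrpObj G] [IsAffineHom G.hom]
    (κ : G ⟶ muGroup S p) : Prop :=
  ∀ (R : CommRingCat.{u}) (f : Spec R ⟶ S) (φ : Module.Dual R (Fn G f)),
    IsDet R (dualMulLeft G f φ)
      (∏ i : ZMod p, φ ((pullback.fst G.hom f).appTop (muPull κ) ^ i.val))

end Functions

end

end TateOort

/-! The question is local on `S`. Where `L` has a frame over an affine open, and for Spec R mapping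
into that open, `a`, `b`, `u`, `v` become elements of R with ab = w_p, and the functions on G_R form
A = R[x]/(x^p - a x), free on 1, x, …, x^(p-1).

First part. Since b u^p = ab u = w_p u, multiples of the point u are computed as in μ_p, where
y(z^k) = χ(k) y(z). Hence γ(i) has coordinate χ(i) u (`eq_chiL_mul_of_groupLaw`), and γ is a
generator exactly when the norm of every f in A is the product of the f(χ(m) u). Now ∏ (X - χ(m) u)
= X^p - u^(p-1) X. If a = u^(p-1), the norm on A is therefore the product of the values at the
roots: a Vandermonde argument proves this over a universal domain, and it specialises
(`det_structMatrix`). Conversely, the single function 1 - x suffices: its norm is 1 - a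
(`det_structMatrix_oneSubCoord`), while the product of its values is 1 - u^(p-1)
(`prod_one_sub_chiL_mul`).

Second part. The dual algebra has the same shape with b in place of a: in the basis dual to 1 and
the x^i / ((1-p) w_i), i ≥ 1, its structure constants are those of R[X]/(X^p - b X)
(`convMul_dualBasis`), and at the character κ^*(z)^m the i-th dual basis vector takes the value
(χ(m) v)^i (`dualBasis_pow`). The linear algebra of the first part is stated for a bilinear product
with given structure constants, so it applies again.

The structure of the dual rests on a formula for the comultiplication of x^j
(`inverse_dualConst_smul_groupLaw_pow`). Homogeneity leaves only the monomials x^r ⊗ x^s with r + s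
= j, and b x^r ⊗ x^s with r + s = j + p - 1, with coefficients in Λ (`groupLaw_pow_mem_span`). These
coefficients are read off in μ_p, where a = w_p, b = 1 and z is group-like, by orthogonality of the
powers of χ. Dividing by w_i is legitimate by `isUnit_w`.

To globalise, necessity is tested on the affine opens of `S` themselves, and sufficiency prime by
prime, since determinants, functions and their duals commute with localisation. -/

namespace TateOort

/-! ### Sums of powers of the Teichmüller character, and units of Λ. -/

section Teichmuller

variable (p : ℕ) [hp : Fact p.Prime]

theorem chi_zero : chi p 0 = 0 := by simp [chi]

theorem chi_one : chi p 1 = 1 := by simp [chi]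

theorem chiL_zero : chiL p 0 = 0 := Subtype.ext (by simp [chiL, chi_zero])

theorem chiL_one : chiL p 1 = 1 := Subtype.ext (by simp [chiL, chi_one])

theorem chiL_mul (m n : ZMod p) : chiL p (m * n) = chiL p m * chiL p n :=
  Subtype.ext (by simp [chiL, chi_mul])

/-- The reduction map `Λ → 𝔽_p`. -/
noncomputable def reduction : Lambda p →+* ZMod p :=
  (PadicInt.toZMod (p := p)).comp (Subring.inclusion (inf_le_right :
    Lambda p ≤ PadicInt.subring p))

theorem reduction_chiL (m : ZMod p) : reduction p (chiL p m) = m :=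
  toZMod_chi p m

/-- The Teichmüller section as a homomorphism of monoids. -/
noncomputable def chiHom : ZMod p →* Lambda p where
  toFun := chiL p
  map_one' := chiL_one p
  map_mul' := chiL_mul p

theorem chiL_pow (m : ZMod p) (k : ℕ) : chiL p (m ^ k) = chiL p m ^ k :=
  map_pow (chiHom p) m k

theorem chiL_inv_mul {m : ZMod p} (hm : m ≠ 0) : chiL p m⁻¹ * chiL p m = 1 := by
  rw [← chiL_mul, inv_mul_cancel₀ hm, chiL_one]

theorem chiL_injective : Function.Injective (chiL p) :=
  Function.LeftInverse.injective (reduction_chiL p)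

theorem chiL_pow_card_sub_one {m : ZMod p} (hm : m ≠ 0) : chiL p m ^ (p - 1) = 1 := by
  rw [← chiL_pow, ZMod.pow_card_sub_one_eq_one hm, chiL_one]

theorem sum_chiL_pow_of_dvd {k : ℕ} (hk : k ≠ 0) (h : p - 1 ∣ k) :
    ∑ m : ZMod p, chiL p m ^ k = (p : Lambda p) - 1 := by
  obtain ⟨q, rfl⟩ := h
  have : ∀ m : ZMod p, chiL p m ^ ((p - 1) * q) = 1 - if m = 0 then 1 else 0 := by
    intro m
    split_ifs with hm
    · rw [hm, chiL_zero, zero_pow hk, sub_self]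
    · rw [pow_mul, chiL_pow_card_sub_one p hm, one_pow, sub_zero]
  simp [this, ZMod.card]

/-- Multiplication by a generator g of the units permutes the terms, so the sum is fixed under
multiplication by χ(g)^k ≠ 1, and Λ is a domain. -/
theorem sum_chiL_pow_of_not_dvd {k : ℕ} (h : ¬ p - 1 ∣ k) :
    ∑ m : ZMod p, chiL p m ^ k = 0 := by
  obtain ⟨g, hg⟩ := IsCyclic.exists_generator (α := (ZMod p)ˣ)
  have hg1 : (g : ZMod p) ^ k ≠ 1 := by
    intro hgk
    apply h
    have h1 : g ^ k = 1 := Units.ext (by simpa using hgk)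
    have h2 := orderOf_dvd_of_pow_eq_one h1
    rwa [orderOf_eq_card_of_forall_mem_zpowers hg, Nat.card_eq_fintype_card,
      ZMod.card_units_eq_totient, Nat.totient_prime hp.out] at h2
  have hne : chiL p ((g : ZMod p) ^ k) - 1 ≠ 0 := by
    rw [sub_ne_zero, ← chiL_one]
    exact fun e => hg1 (chiL_injective p e)
  have key : chiL p ((g : ZMod p) ^ k) * ∑ m : ZMod p, chiL p m ^ k =
      ∑ m : ZMod p, chiL p m ^ k := by
    rw [Finset.mul_sum]
    refine Fintype.sum_equiv (Units.mulLeft g) _ _ fun m => ?_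
    rw [Units.mulLeft_apply, chiL_mul, mul_pow, chiL_pow]
  have : (chiL p ((g : ZMod p) ^ k) - 1) * ∑ m : ZMod p, chiL p m ^ k = 0 := by
    rw [sub_mul, key, one_mul, sub_self]
  exact (mul_eq_zero.mp this).resolve_left hne

/-- The exponent is -1 modulo p - 1. The smaller choice p - 2 would be 0 for p = 2 and fail at m =
0. -/
theorem chiL_inv (m : ZMod p) : chiL p m⁻¹ = chiL p m ^ (2 * p - 3) := by
  have h2 := hp.out.two_le
  by_cases hm : m = 0
  · rw [hm, inv_zero, chiL_zero, zero_pow (by omega)]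
  · have h1 : chiL p m ^ (2 * p - 3) * chiL p m = 1 := by
      rw [← pow_succ, show 2 * p - 3 + 1 = (p - 1) * 2 by omega, pow_mul,
        chiL_pow_card_sub_one p hm, one_pow]
    calc chiL p m⁻¹ = chiL p m⁻¹ * (chiL p m ^ (2 * p - 3) * chiL p m) := by rw [h1, mul_one]
      _ = chiL p m ^ (2 * p - 3) * (chiL p m⁻¹ * chiL p m) := by ring
      _ = _ := by rw [chiL_inv_mul p hm, mul_one]

/-- Orthogonality of the powers of the Teichmüller character. -/
theorem sum_chiL_inv_pow_mul {i r : ℕ} (hi : i ≠ 0) :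
    ∑ m : ZMod p, chiL p m⁻¹ ^ i * chiL p m ^ r =
      if i ≡ r [MOD p - 1] then (p : Lambda p) - 1 else 0 := by
  have h2 := hp.out.two_le
  have e : ∀ m : ZMod p, chiL p m⁻¹ ^ i * chiL p m ^ r = chiL p m ^ ((2 * p - 3) * i + r) := by
    intro m
    rw [chiL_inv, ← pow_mul, ← pow_add]
  have hd : i ≡ r [MOD p - 1] ↔ p - 1 ∣ (2 * p - 3) * i + r := by
    obtain ⟨n, rfl⟩ : ∃ n, p = n + 2 := ⟨p - 2, by omega⟩
    rw [Nat.modEq_iff_dvd, ← Int.natCast_dvd_natCast]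
    have : (((2 * (n + 2) - 3) * i + r : ℕ) : ℤ) = ((n + 2 - 1 : ℕ) : ℤ) * (2 * i) + (r - i) := by
      rw [show 2 * (n + 2) - 3 = 2 * n + 1 by omega, show n + 2 - 1 = n + 1 by omega]
      push_cast; ring
    rw [this, dvd_add_right (dvd_mul_right _ _)]
  simp only [e]
  split_ifs with h
  · exact sum_chiL_pow_of_dvd p (by
      have : 0 < (2 * p - 3) * i := Nat.mul_pos (by omega) (Nat.pos_of_ne_zero hi)
      omega) (hd.mp h)
  · exact sum_chiL_pow_of_not_dvd p (fun h' => h (hd.mpr h'))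

/-- The inverse is p · 1/(p(p-1)), which has p-adic norm 1; both conditions defining Λ hold. -/
theorem isUnit_prime_sub_one : IsUnit ((p : Lambda p) - 1) := by
  have hp0 : (p : ℚ_[p]) ≠ 0 := by exact_mod_cast hp.out.ne_zero
  have hp1 : (p : ℚ_[p]) - 1 ≠ 0 := by
    rw [sub_ne_zero]; exact_mod_cast hp.out.one_lt.ne'
  have hn : ‖(p : ℚ_[p]) - 1‖ = 1 := by
    have hlt := Padic.norm_p_lt_one (p := p)
    have hne : ‖(p : ℚ_[p])‖ ≠ ‖(-1 : ℚ_[p])‖ := by rw [norm_neg, norm_one]; exact hlt.ne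
    rw [sub_eq_add_neg, Padic.add_eq_max_of_ne hne, norm_neg, norm_one, max_eq_right hlt.le]
  refine IsUnit.of_mul_eq_one (⟨((p : ℚ_[p]) - 1)⁻¹, ?_, ?_⟩ : Lambda p) (Subtype.ext ?_)
  · have : ((p : ℚ_[p]) - 1)⁻¹ = p * (1 / ((p : ℚ_[p]) * ((p : ℚ_[p]) - 1))) := by
      field_simp
    rw [this]
    exact Subring.mul_mem _ (natCast_mem _ p) (Subring.subset_closure (Or.inl rfl))
  · change ‖_‖ ≤ 1
    rw [norm_inv, hn, inv_one]
  · exact mul_inv_cancel₀ hp1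

/-- An element of `Λ` not divisible by `p` is a unit, if it divides a power of `p` in
`ℤ[χ(𝔽_p), 1 / (p (p - 1))]`. -/
theorem isUnit_of_mul_eq_pow {x y : Lambda p} {k : ℕ} (hx : reduction p x ≠ 0)
    (h : x * y = (p : Lambda p) ^ k) : IsUnit x := by
  have hp0 : (p : ℚ_[p]) ≠ 0 := by exact_mod_cast hp.out.ne_zero
  have hp1 : (p : ℚ_[p]) - 1 ≠ 0 := by
    rw [sub_ne_zero]; exact_mod_cast hp.out.one_lt.ne'
  let x' : ℤ_[p] := ⟨(x : ℚ_[p]), x.2.2⟩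
  have hu : IsUnit x' := by
    by_contra hn
    apply hx
    have : x' ∈ RingHom.ker (PadicInt.toZMod (p := p)) := by
      rw [PadicInt.ker_toZMod]; exact hn
    exact this
  have hn : ‖(x : ℚ_[p])‖ = 1 := PadicInt.isUnit_iff.mp hu
  have hx0 : (x : ℚ_[p]) ≠ 0 := by
    intro h0; rw [h0] at hn; simp at hn
  have hpinv : ((p : ℚ_[p]))⁻¹ ∈ Subring.closure (insert (1 / ((p : ℚ_[p]) * ((p : ℚ_[p]) - 1)))
      (Set.range fun m : ZMod p => (chi p m : ℚ_[p]))) := by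
    have : ((p : ℚ_[p]))⁻¹ = (p - 1) * (1 / ((p : ℚ_[p]) * ((p : ℚ_[p]) - 1))) := by
      field_simp
    rw [this]
    exact Subring.mul_mem _ (Subring.sub_mem _ (natCast_mem _ p) (one_mem _))
      (Subring.subset_closure (Or.inl rfl))
  have hxy : (x : ℚ_[p]) * y = (p : ℚ_[p]) ^ k := by
    have := congrArg (Subtype.val) h
    simpa using this
  refine IsUnit.of_mul_eq_one (⟨(x : ℚ_[p])⁻¹, ?_, ?_⟩ : Lambda p) (Subtype.ext ?_)
  · have : (x : ℚ_[p])⁻¹ = y * ((p : ℚ_[p])⁻¹) ^ k := by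
      rw [inv_pow, ← hxy]
      have : (y : ℚ_[p]) ≠ 0 := by
        intro h0; rw [h0, mul_zero] at hxy
        exact pow_ne_zero k hp0 hxy.symm
      field_simp
    rw [this]
    exact Subring.mul_mem _ y.2.1 (Subring.pow_mem _ hpinv k)
  · change ‖_‖ ≤ 1
    rw [norm_inv, hn, inv_one]
  · exact mul_inv_cancel₀ hx0

end Teichmuller

/-! ### The eigenvectors y_i(z) for the automorphisms z ↦ z^k. -/

section Eigenvectors

variable (p : ℕ) [hp : Fact p.Prime]

/-- The element `y_i(z) = ∑_{m ∈ 𝔽_p^×} χ(m)^{-i} (1 - z ^ m)`, for `i ≥ 1`. -/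
noncomputable def eigen {A : Type*} [CommRing A] (str : Lambda p →+* A) (i : ℕ) (z : A) : A :=
  ∑ m : ZMod p, str (chiL p m⁻¹) ^ i * (1 - z ^ m.val)

theorem eigen_one {A : Type*} [CommRing A] (str : Lambda p →+* A) (z : A) :
    eigen p str 1 z = eigenY p str z := by simp [eigen, eigenY]

theorem map_eigen {A B : Type*} [CommRing A] [CommRing B] (str : Lambda p →+* A) (g : A →+* B)
    (i : ℕ) (z : A) : g (eigen p str i z) = eigen p (g.comp str) i (g z) := by
  simp [eigen]

theorem pow_val_mul {A : Type*} [CommRing A] {z : A} (hz : z ^ p = 1) (k m : ZMod p) :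
    (z ^ k.val) ^ m.val = z ^ (k * m).val := by
  rw [← pow_mul, ZMod.val_mul, ← pow_mod_orderOf, ← pow_mod_orderOf z (_ % p),
    Nat.mod_mod_of_dvd _ (orderOf_dvd_of_pow_eq_one hz)]

theorem pow_val_add {A : Type*} [CommRing A] {z : A} (hz : z ^ p = 1) (k m : ZMod p) :
    z ^ k.val * z ^ m.val = z ^ (k + m).val := by
  rw [← pow_add, ZMod.val_add, ← pow_mod_orderOf, ← pow_mod_orderOf z (_ % p),
    Nat.mod_mod_of_dvd _ (orderOf_dvd_of_pow_eq_one hz)]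

/-- Substitute m ↦ k m in the sum. For k = 0 both sides vanish, which needs i ≠ 0. -/
theorem eigen_pow_val {A : Type*} [CommRing A] (str : Lambda p →+* A) {z : A} (hz : z ^ p = 1)
    {i : ℕ} (hi : i ≠ 0) (k : ZMod p) :
    eigen p str i (z ^ k.val) = str (chiL p k) ^ i * eigen p str i z := by
  by_cases hk : k = 0
  · simp [hk, eigen, chiL_zero, hi]
  · rw [eigen, eigen, Finset.mul_sum]
    refine Fintype.sum_equiv (Equiv.mulLeft₀ k hk) _ _ fun m => ?_
    change _ = _ * (str (chiL p (k * m)⁻¹) ^ i * (1 - z ^ (k * m).val))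
    rw [pow_val_mul p hz, ← mul_assoc, ← mul_pow, ← map_mul, ← chiL_mul,
      mul_inv, mul_inv_cancel_left₀ hk]

/-- The elements `1 - z ^ m` in terms of the eigenvectors `y_i`. -/
theorem sum_chiL_pow_mul_eigen {A : Type*} [CommRing A] (str : Lambda p →+* A) (z : A)
    (k : ZMod p) :
    ∑ i ∈ Finset.Ico 1 p, str (chiL p k) ^ i * eigen p str i z =
      ((p : A) - 1) * (1 - z ^ k.val) := by
  have h2 := hp.out.two_le
  by_cases hk : k = 0
  · rw [hk, chiL_zero, map_zero, ZMod.val_zero, pow_zero, sub_self, mul_zero]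
    exact Finset.sum_eq_zero fun i hi => by
      rw [zero_pow (by have := (Finset.mem_Ico.mp hi).1; omega), zero_mul]
  simp only [eigen, Finset.mul_sum]
  rw [Finset.sum_comm, Finset.sum_eq_single k]
  · have : ∀ i ∈ Finset.Ico 1 p, str (chiL p k) ^ i * (str (chiL p k⁻¹) ^ i * (1 - z ^ k.val)) =
        1 - z ^ k.val := by
      intro i _
      rw [← mul_assoc, ← mul_pow, ← map_mul, mul_comm (chiL p k), chiL_inv_mul p hk, map_one,
        one_pow, one_mul]
    rw [Finset.sum_congr rfl this, Finset.sum_const, Nat.card_Ico, nsmul_eq_mul,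
      Nat.cast_sub (by omega), Nat.cast_one]
  · intro m _ hm
    by_cases hm0 : m = 0
    · simp [hm0]
    have : ∀ i ∈ Finset.Ico 1 p, str (chiL p k) ^ i * (str (chiL p m⁻¹) ^ i * (1 - z ^ m.val)) =
        str (chiL p (k * m⁻¹) ^ i) * (1 - z ^ m.val) := by
      intro i _
      rw [← mul_assoc, ← mul_pow, ← map_mul, ← chiL_mul, map_pow]
    rw [Finset.sum_congr rfl this, ← Finset.sum_mul, ← map_sum]
    have hne : chiL p (k * m⁻¹) - 1 ≠ 0 := by
      rw [sub_ne_zero, ← chiL_one]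
      intro e
      exact hm ((mul_inv_eq_one₀ hm0).mp (chiL_injective p e)).symm
    -- χ(k/m) is a (p-1)-st root of unity different from 1, so its geometric sum over a full period
    -- vanishes.
    have h0 : ∑ i ∈ Finset.Ico 1 p, chiL p (k * m⁻¹) ^ i = 0 := by
      have h := Finset.mul_sum (Finset.range (p - 1)) (fun i => chiL p (k * m⁻¹) ^ i)
        (chiL p (k * m⁻¹))
      have hg := geom_sum_mul (chiL p (k * m⁻¹)) (p - 1)
      rw [chiL_pow_card_sub_one p (mul_ne_zero hk (inv_ne_zero hm0)), sub_self] at hg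
      rw [(mul_eq_zero.mp hg).resolve_right hne, mul_zero] at h
      rw [Finset.sum_Ico_eq_sum_range, h]
      exact Finset.sum_congr rfl fun i _ => by rw [add_comm, pow_succ']
    rw [h0, map_zero, zero_mul]
  · simp

end Eigenvectors

/-! ### Coefficients and eigenspaces in the group algebra Λ[z]/(z^p - 1). -/

section GroupAlgebra

variable (p : ℕ) [hp : Fact p.Prime]

/-- The group algebra `Λ[z] / (z ^ p - 1)`. -/
abbrev GroupAlg : Type := MonoidAlgebra (Lambda p) (Multiplicative (ZMod p))

/-- The generator `z` of the group algebra. -/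
noncomputable def genZ : GroupAlg p := MonoidAlgebra.single (Multiplicative.ofAdd 1) 1

theorem genZ_pow (n : ℕ) : genZ p ^ n = MonoidAlgebra.single (Multiplicative.ofAdd (n : ZMod p)) 1 := by
  rw [genZ, MonoidAlgebra.single_pow, one_pow, ← ofAdd_nsmul, nsmul_one]

theorem genZ_pow_val (m : ZMod p) :
    genZ p ^ m.val = MonoidAlgebra.single (Multiplicative.ofAdd m) 1 := by
  rw [genZ_pow, ZMod.natCast_zmod_val]

theorem genZ_pow_card : genZ p ^ p = 1 := by
  rw [genZ_pow, CharP.cast_eq_zero]; rfl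

/-- The homomorphism from the group algebra given by an element `z` with `z ^ p = 1`. -/
noncomputable def groupAlgLift {A : Type*} [CommRing A] [Algebra (Lambda p) A] (z : A)
    (hz : z ^ p = 1) : GroupAlg p →ₐ[Lambda p] A :=
  MonoidAlgebra.lift (Lambda p) A (Multiplicative (ZMod p))
    { toFun := fun m => z ^ m.toAdd.val
      map_one' := by simp
      map_mul' := fun k m => (pow_val_add p hz k.toAdd m.toAdd).symm }

theorem groupAlgLift_genZ {A : Type*} [CommRing A] [Algebra (Lambda p) A] (z : A)
    (hz : z ^ p = 1) : groupAlgLift p z hz (genZ p) = z := by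
  have : Fact (1 < p) := ⟨hp.out.one_lt⟩
  simp [groupAlgLift, genZ, ZMod.val_one]

/-- The coefficient of `z ^ m`. -/
noncomputable def coeffLin (m : ZMod p) : GroupAlg p →ₗ[Lambda p] Lambda p where
  toFun f := f.coeff (Multiplicative.ofAdd m)
  map_add' f g := by simp
  map_smul' r f := by simp

theorem coeffLin_genZ_pow_val (m k : ZMod p) :
    coeffLin p m (genZ p ^ k.val) = if k = m then 1 else 0 := by
  rw [genZ_pow_val]
  change (Finsupp.single (Multiplicative.ofAdd k) (1 : Lambda p)) (Multiplicative.ofAdd m) = _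
  simp [Finsupp.single_apply]

theorem groupAlg_ext {f g : GroupAlg p} (h : ∀ m, coeffLin p m f = coeffLin p m g) : f = g := by
  apply MonoidAlgebra.ext
  refine Finsupp.ext fun m => ?_
  exact h m.toAdd

theorem coeffLin_one (m : ZMod p) : coeffLin p m 1 = if 0 = m then 1 else 0 := by
  simpa using coeffLin_genZ_pow_val p m 0

theorem groupAlg_hom_ext {M : Type*} [AddCommMonoid M] [Module (Lambda p) M]
    {f g : GroupAlg p →ₗ[Lambda p] M} (h : ∀ m : ZMod p, f (genZ p ^ m.val) = g (genZ p ^ m.val)) :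
    f = g := by
  apply MonoidAlgebra.lhom_ext'
  intro m
  ext
  have := h m.toAdd
  rw [genZ_pow_val] at this
  exact this

theorem coeffLin_eigen (i : ℕ) {m : ZMod p} (hm : m ≠ 0) :
    coeffLin p m (eigen p (algebraMap (Lambda p) (GroupAlg p)) i (genZ p)) =
      -chiL p m⁻¹ ^ i := by
  simp only [eigen, ← map_pow, ← Algebra.smul_def, map_sum, map_smul, map_sub, coeffLin_one,
    coeffLin_genZ_pow_val, if_neg hm.symm]
  simp

/-- An eigenvector of the group of automorphisms `z ↦ z ^ k` that is in the augmentation ideal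
is a multiple of some `y_i`. -/
theorem eq_smul_eigen {i : ℕ} {f : GroupAlg p}
    (h0 : groupAlgLift p (1 : Lambda p) (one_pow p) f = 0)
    (hf : ∀ k : ZMod p, k ≠ 0 →
      groupAlgLift p (genZ p ^ k.val) (by rw [← pow_mul, mul_comm, pow_mul, genZ_pow_card, one_pow]) f
        = chiL p k ^ i • f) :
    f = (-coeffLin p 1 f) • eigen p (algebraMap (Lambda p) (GroupAlg p)) i (genZ p) := by
  have haug : ∀ g : GroupAlg p, groupAlgLift p (1 : Lambda p) (one_pow p) g =
      ∑ m, coeffLin p m g := by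
    intro g
    have : (groupAlgLift p (1 : Lambda p) (one_pow p)).toLinearMap = ∑ m, coeffLin p m := by
      apply groupAlg_hom_ext
      intro k
      simp [coeffLin_genZ_pow_val, groupAlgLift_genZ]
    simpa using congr($this g)
  have hcoeff : ∀ (k : ZMod p) (hk : k ≠ 0) (g : GroupAlg p), coeffLin p k
      (groupAlgLift p (genZ p ^ k.val)
        (by rw [← pow_mul, mul_comm, pow_mul, genZ_pow_card, one_pow]) g) = coeffLin p 1 g := by
    intro k hk g
    have : (coeffLin p k).comp (groupAlgLift p (genZ p ^ k.val)
        (by rw [← pow_mul, mul_comm, pow_mul, genZ_pow_card, one_pow])).toLinearMap =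
          coeffLin p 1 := by
      apply groupAlg_hom_ext
      intro m
      simp only [LinearMap.comp_apply, AlgHom.toLinearMap_apply, map_pow, groupAlgLift_genZ,
        pow_val_mul p (genZ_pow_card p), coeffLin_genZ_pow_val]
      congr 1
      simp [mul_eq_left₀ hk]
    exact congr($this g)
  set g := (-coeffLin p 1 f) • eigen p (algebraMap (Lambda p) (GroupAlg p)) i (genZ p) with hg
  -- The automorphism z ↦ z^m moves the coefficient of z to that of z^m, and it acts on f by χ(m)^i;
  -- hence the coefficient at 1 determines all those at m ≠ 0.
  have hne : ∀ m : ZMod p, m ≠ 0 → coeffLin p m f = coeffLin p m g := by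
    intro m hm
    have h1 := hcoeff m hm f
    rw [hf m hm, map_smul, smul_eq_mul] at h1
    rw [hg, map_smul, coeffLin_eigen p i hm, ← h1, smul_eq_mul]
    linear_combination (-(coeffLin p m f)) * ((mul_pow _ _ i).symm.trans
      ((congrArg (· ^ i) (chiL_inv_mul p hm)).trans (one_pow i)))
  have hgaug : groupAlgLift p (1 : Lambda p) (one_pow p) g = 0 := by
    rw [hg, map_smul]
    have := map_eigen p (algebraMap (Lambda p) (GroupAlg p))
      (groupAlgLift p (1 : Lambda p) (one_pow p)).toRingHom i (genZ p)
    rw [AlgHom.toRingHom_eq_coe, RingHom.coe_coe, groupAlgLift_genZ] at this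
    rw [this]
    simp [eigen]
  apply groupAlg_ext
  intro m
  -- The remaining constant coefficient is fixed by the vanishing of the augmentation.
  by_cases hm : m = 0
  · rw [haug, Fintype.sum_eq_add_sum_subtype_ne _ (0 : ZMod p)] at h0 hgaug
    have : ∑ i : {i : ZMod p // i ≠ 0}, coeffLin p i f = ∑ i : {i : ZMod p // i ≠ 0}, coeffLin p i g :=
      Finset.sum_congr rfl fun i _ => hne i i.2
    rw [this] at h0
    rw [hm]
    exact add_right_cancel (h0.trans hgaug.symm)
  · exact hne m hm

end GroupAlgebra

/-! ### The constants w_i: defining relation, invertibility, and the group law of μ_p. -/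

section Constants

variable (p : ℕ) [hp : Fact p.Prime]

/-- The eigenvector `y_i` in the group algebra. -/
noncomputable def eigenZ (i : ℕ) : GroupAlg p :=
  eigen p (algebraMap (Lambda p) (GroupAlg p)) i (genZ p)

theorem genZ_pow_val_pow_card (k : ZMod p) : (genZ p ^ k.val) ^ p = 1 := by
  rw [← pow_mul, mul_comm, pow_mul, genZ_pow_card, one_pow]

/-- An element of the augmentation ideal on which the automorphism `z ↦ z ^ k` acts by `χ(k) ^ i`,
for all `k`. -/
def IsEigen (i : ℕ) (f : GroupAlg p) : Prop :=
  groupAlgLift p (1 : Lambda p) (one_pow p) f = 0 ∧ ∀ k : ZMod p, k ≠ 0 →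
    groupAlgLift p (genZ p ^ k.val) (genZ_pow_val_pow_card p k) f = chiL p k ^ i • f

variable {p}

theorem IsEigen.mul {i j : ℕ} {f g : GroupAlg p} (hf : IsEigen p i f) (hg : IsEigen p j g) :
    IsEigen p (i + j) (f * g) := by
  refine ⟨by rw [map_mul, hf.1, zero_mul], fun k hk => ?_⟩
  rw [map_mul, hf.2 k hk, hg.2 k hk, smul_mul_smul_comm, pow_add]

theorem IsEigen.pow {i : ℕ} {f : GroupAlg p} (hf : IsEigen p i f) {n : ℕ} (hn : n ≠ 0) :
    IsEigen p (i * n) (f ^ n) := by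
  induction n with
  | zero => exact absurd rfl hn
  | succ n ih =>
    by_cases h : n = 0
    · subst h; simpa using hf
    · rw [pow_succ, mul_add, mul_one]; exact (ih h).mul hf

/-- Each eigenspace in the augmentation ideal has rank one, and y_i has coefficient -1 at z;
relations between eigenvectors thus reduce to comparing one coefficient. -/
theorem IsEigen.eq_smul {i : ℕ} {f : GroupAlg p} (hf : IsEigen p i f) :
    f = (-coeffLin p 1 f) • eigenZ p i := eq_smul_eigen p hf.1 hf.2

theorem map_groupAlgLift_eigenZ {A : Type*} [CommRing A] [Algebra (Lambda p) A] (z : A)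
    (hz : z ^ p = 1) (i : ℕ) :
    groupAlgLift p z hz (eigenZ p i) = eigen p (algebraMap (Lambda p) A) i z := by
  have := map_eigen p (algebraMap (Lambda p) (GroupAlg p)) (groupAlgLift p z hz).toRingHom i (genZ p)
  rw [AlgHom.toRingHom_eq_coe, RingHom.coe_coe, groupAlgLift_genZ, AlgHom.comp_algebraMap] at this
  exact this

variable (p)

theorem isEigen_eigenZ {i : ℕ} (hi : i ≠ 0) : IsEigen p i (eigenZ p i) := by
  constructor
  · rw [map_groupAlgLift_eigenZ]; simp [eigen]
  · intro k _
    rw [map_groupAlgLift_eigenZ, eigen_pow_val p _ (genZ_pow_card p) hi, Algebra.smul_def, map_pow]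
    rfl

theorem coeffLin_one_eigenZ (i : ℕ) : coeffLin p 1 (eigenZ p i) = -1 := by
  rw [eigenZ, coeffLin_eigen p i one_ne_zero, inv_one, chiL_one, one_pow]

theorem smul_eigenZ_injective (i : ℕ) :
    Function.Injective fun r : Lambda p => r • eigenZ p i := by
  intro r s h
  have := congrArg (coeffLin p 1) h
  simpa [coeffLin_one_eigenZ] using this

theorem eigenZ_pow {i : ℕ} (hi : i ≠ 0) : eigenZ p 1 ^ i = w p i • eigenZ p i := by
  have h := ((isEigen_eigenZ p one_ne_zero).pow hi).eq_smul
  rw [one_mul] at h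
  rw [h, w, eigenZ, eigen_one]
  rfl

theorem eigen_add {A : Type*} [CommRing A] (str : Lambda p →+* A) (z : A) (i n : ℕ) :
    eigen p str (i + (p - 1) * n) z = eigen p str i z := by
  refine Finset.sum_congr rfl fun m _ => ?_
  by_cases hm : m = 0
  · simp [hm]
  · rw [pow_add, ← map_pow str _ ((p - 1) * n), pow_mul,
      chiL_pow_card_sub_one p (inv_ne_zero hm), one_pow, map_one, mul_one]

theorem eigen_eq_of_modEq {A : Type*} [CommRing A] (str : Lambda p →+* A) (z : A) {i j : ℕ}
    (h : i ≡ j [MOD p - 1]) : eigen p str i z = eigen p str j z := by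
  wlog hij : i ≤ j generalizing i j
  · exact (this h.symm (le_of_not_ge hij)).symm
  obtain ⟨n, hn⟩ := (Nat.modEq_iff_dvd' hij).mp h
  rw [show j = i + (p - 1) * n by omega, eigen_add]

theorem eigen_card {A : Type*} [CommRing A] (str : Lambda p →+* A) (z : A) :
    eigen p str p z = eigen p str 1 z := by
  have h2 := hp.out.two_le
  have := eigen_add p str z 1 1
  rwa [mul_one, show 1 + (p - 1) = p by omega] at this

/-- The defining property of the constants `w_i`. -/
theorem eigenY_pow {A : Type*} [CommRing A] (str : Lambda p →+* A) {z : A} (hz : z ^ p = 1) {i : ℕ}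
    (hi : i ≠ 0) : eigenY p str z ^ i = str (w p i) * eigen p str i z := by
  let := str.toAlgebra
  have h := congrArg (groupAlgLift p z hz) (eigenZ_pow p hi)
  rwa [map_pow, map_smul, map_groupAlgLift_eigenZ, map_groupAlgLift_eigenZ, eigen_one,
    Algebra.smul_def] at h

theorem w_one : w p 1 = 1 := by
  have h := eigenZ_pow p one_ne_zero
  rw [pow_one] at h
  have := smul_eigenZ_injective p 1 (a₁ := 1) (a₂ := w p 1)
  simp only [one_smul] at this
  exact (this h).symm

/-- With N = ∑ z^m one has y_{p-1} = p - N, and N kills the augmentation ideal. -/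
theorem eigen_sub_one_mul {A : Type*} [CommRing A] (str : Lambda p →+* A) {z : A} (hz : z ^ p = 1)
    (i : ℕ) : eigen p str (p - 1) z * eigen p str i z = p * eigen p str i z := by
  have h1 : eigen p str (p - 1) z = p - ∑ m : ZMod p, z ^ m.val := by
    have : ∀ m : ZMod p, str (chiL p m⁻¹) ^ (p - 1) * (1 - z ^ m.val) = 1 - z ^ m.val := by
      intro m
      by_cases hm : m = 0
      · simp [hm]
      · rw [← map_pow, chiL_pow_card_sub_one p (inv_ne_zero hm), map_one, one_mul]
    simp [eigen, this, ZMod.card]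
  have h2 : ∀ k : ZMod p, (∑ m : ZMod p, z ^ m.val) * (1 - z ^ k.val) = 0 := by
    intro k
    rw [mul_sub, mul_one, Finset.sum_mul, sub_eq_zero]
    exact (Fintype.sum_equiv (Equiv.addRight k) _ _ fun m => pow_val_add p hz m k).symm
  rw [h1, sub_mul, sub_eq_self, eigen, Finset.mul_sum]
  exact Finset.sum_eq_zero fun m _ => by rw [mul_left_comm, h2, mul_zero]

theorem eigenZ_sub_one_pow (n : ℕ) :
    eigenZ p (p - 1) ^ (n + 1) = ((p : Lambda p) ^ n) • eigenZ p (p - 1) := by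
  induction n with
  | zero => simp
  | succ n ih =>
    rw [pow_succ, ih, smul_mul_assoc, eigenZ, eigen_sub_one_mul p _ (genZ_pow_card p), pow_succ,
      mul_smul, Algebra.smul_def (p : Lambda p), map_natCast]

theorem sum_chiL_inv_pow {i : ℕ} (hi : i ≠ 0) (h : ¬ p - 1 ∣ i) :
    ∑ m : ZMod p, chiL p m⁻¹ ^ i = 0 := by
  have := sum_chiL_inv_pow_mul p (i := i) (r := 0) hi
  rw [if_neg (fun h' => h (Nat.modEq_zero_iff_dvd.mp h'))] at this
  simpa using this

/-- The constant contributions cancel by orthogonality, leaving a sum of Gauss type. -/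
theorem eigenZ_eq_neg_sum {i : ℕ} (hi : i ≠ 0) (h : ¬ p - 1 ∣ i) :
    eigenZ p i = -∑ m : ZMod p, (chiL p m⁻¹ ^ i) • genZ p ^ m.val := by
  have : ∑ m : ZMod p, (algebraMap (Lambda p) (GroupAlg p)) (chiL p m⁻¹) ^ i = 0 := by
    rw [← map_zero (algebraMap (Lambda p) (GroupAlg p)), ← sum_chiL_inv_pow p hi h]
    simp only [map_sum, map_pow]
  simp only [eigenZ, eigen, mul_sub, mul_one, Finset.sum_sub_distrib, this, zero_sub,
    Algebra.smul_def, map_pow]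

theorem coeffLin_zero_eigenZ_sub_one : coeffLin p 0 (eigenZ p (p - 1)) = (p : Lambda p) - 1 := by
  have h2 := hp.out.two_le
  simp only [eigenZ, eigen, ← map_pow, ← Algebra.smul_def, map_sum, map_smul, map_sub, coeffLin_one,
    coeffLin_genZ_pow_val]
  rw [← sum_chiL_pow_of_dvd p (show p - 1 ≠ 0 by omega) dvd_rfl]
  refine Finset.sum_congr rfl fun m _ => ?_
  by_cases hm : m = 0
  · simp [hm, chiL_zero, show p - 1 ≠ 0 by omega]
  · simp [hm, chiL_pow_card_sub_one p (inv_ne_zero hm), chiL_pow_card_sub_one p hm]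

/-- The product lies in the rank-one eigenspace of y_{p-1}, so constant coefficients decide. As in
the product of the Gauss sums of χ and its inverse, only the pairs m, -m contribute. The bound 3 ≤ p
keeps p - 1 from dividing 1 and p - 2. -/
theorem eigenZ_one_mul (h3 : 3 ≤ p) :
    eigenZ p 1 * eigenZ p (p - 2) = (chiL p (-1) ^ (p - 2)) • eigenZ p (p - 1) := by
  have hE := ((isEigen_eigenZ p one_ne_zero).mul
    (isEigen_eigenZ p (show p - 2 ≠ 0 by omega))).eq_smul
  rw [show 1 + (p - 2) = p - 1 by omega] at hE
  have h1 : ¬ p - 1 ∣ 1 := fun h => by have := Nat.le_of_dvd one_pos h; omega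
  have h2 : ¬ p - 1 ∣ p - 2 := fun h => by have := Nat.le_of_dvd (by omega) h; omega
  have hc : coeffLin p 0 (eigenZ p 1 * eigenZ p (p - 2)) =
      chiL p (-1) ^ (p - 2) * ((p : Lambda p) - 1) := by
    have hneg : ∀ a b : GroupAlg p, -a * -b = a * b := fun a b => by ring
    rw [eigenZ_eq_neg_sum p one_ne_zero h1, eigenZ_eq_neg_sum p (by omega) h2, hneg,
      Finset.sum_mul_sum]
    simp only [smul_mul_smul_comm, pow_val_add p (genZ_pow_card p), map_sum, map_smul,
      coeffLin_genZ_pow_val, pow_one]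
    have : ∀ m : ZMod p, ∑ n : ZMod p, (chiL p m⁻¹ * chiL p n⁻¹ ^ (p - 2)) •
        (if m + n = 0 then (1 : Lambda p) else 0) = chiL p (-1) ^ (p - 2) * (chiL p m ^ (p - 1)) := by
      intro m
      rw [Finset.sum_eq_single (-m)]
      · by_cases hm : m = 0
        · simp [hm, chiL_zero, show p - 1 ≠ 0 by omega]
        · rw [chiL_pow_card_sub_one p hm, add_neg_cancel, if_pos rfl, smul_eq_mul, mul_one, mul_one,
            inv_neg, ← neg_one_mul m⁻¹, chiL_mul, mul_pow, mul_left_comm, ← pow_succ',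
            show p - 2 + 1 = p - 1 by omega, chiL_pow_card_sub_one p (inv_ne_zero hm), mul_one]
      · intro n _ hn
        rw [if_neg (fun h => hn (eq_neg_of_add_eq_zero_right h)), smul_zero]
      · simp
    rw [Finset.sum_congr rfl fun m _ => this m, ← Finset.mul_sum,
      sum_chiL_pow_of_dvd p (by omega) dvd_rfl]
  rw [hE, map_smul, coeffLin_zero_eigenZ_sub_one, smul_eq_mul] at hc
  rw [hE, (isUnit_prime_sub_one p).mul_right_cancel hc]

open Polynomial in
-- Modulo p, z^p - 1 = (z - 1)^p, and y_1 vanishes at z = 1 to order exactly one, its derivative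
-- there being 1. Hence its (p-1)-st power is not zero in the quotient, as it would be if p divided
-- w_{p-1}.
theorem reduction_w_sub_one_ne_zero : reduction p (w p (p - 1)) ≠ 0 := by
  intro h0
  have h2 := hp.out.two_le
  let q : (ZMod p)[X] := ∑ m : ZMod p, C m⁻¹ * (1 - X ^ m.val)
  let F : Lambda p →+* AdjoinRoot (X ^ p - 1 : (ZMod p)[X]) := (AdjoinRoot.of _).comp (reduction p)
  have hz : (AdjoinRoot.root (X ^ p - 1 : (ZMod p)[X])) ^ p = 1 := by
    have := AdjoinRoot.mk_self (f := (X ^ p - 1 : (ZMod p)[X]))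
    rwa [map_sub, map_pow, AdjoinRoot.mk_X, map_one, sub_eq_zero] at this
  have hq : AdjoinRoot.mk (X ^ p - 1 : (ZMod p)[X]) q = eigenY p F (AdjoinRoot.root _) := by
    simp [q, eigenY, F, reduction_chiL]
  have h := eigenY_pow p F hz (show p - 1 ≠ 0 by omega)
  rw [← hq, RingHom.comp_apply, h0, map_zero, zero_mul, ← map_pow, AdjoinRoot.mk_eq_zero] at h
  -- Frobenius turns X^p - 1 into (X - 1)^p.
  rw [← one_pow p, ← C_1, ← map_pow, one_pow, ← one_pow (M := ZMod p) p, map_pow,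
    ← sub_pow_char] at h
  have hroot : q.IsRoot 1 := by simp [q, IsRoot, eval_finsetSum]
  obtain ⟨r, hr⟩ := dvd_iff_isRoot.mpr hroot
  have hpow : (X - C (1 : ZMod p)) ^ p = (X - C 1) ^ (p - 1) * (X - C 1) := by
    rw [← pow_succ, Nat.sub_add_cancel hp.out.one_le]
  rw [hr, mul_pow, hpow] at h
  have hr0 : (X - C (1 : ZMod p)) ∣ r ^ (p - 1) :=
    (mul_dvd_mul_iff_left (pow_ne_zero _ (X_sub_C_ne_zero 1))).mp h
  have hr1 : r.eval 1 = 0 := dvd_iff_isRoot.mp ((prime_X_sub_C 1).dvd_of_dvd_pow hr0)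
  have hd : (derivative q).eval 1 = 0 := by
    rw [hr]; simp [hr1]
  -- The derivative at 1 is -∑ m⁻¹ m = -(p - 1) = 1 in 𝔽_p.
  have hd' : (derivative q).eval 1 = 1 := by
    have : ∀ m : ZMod p, m⁻¹ * m = 1 - if m = 0 then 1 else 0 := by
      intro m
      by_cases hm : m = 0
      · simp [hm]
      · simp [hm]
    simp [q, derivative_X_pow, eval_finsetSum, this]
  exact one_ne_zero (hd'.symm.trans hd)

/-- Raising y_1 y_{p-2} = ± y_{p-1} to the power p - 1, with y_{p-1}^2 = p y_{p-1}, exhibits w_{p-1}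
as a divisor of p^(p-2). Being nonzero modulo p, it is then a unit of Λ. -/
theorem isUnit_w_sub_one : IsUnit (w p (p - 1)) := by
  rcases hp.out.two_le.eq_or_lt with h2 | h3
  · rw [show p - 1 = 1 by omega, w_one]; exact isUnit_one
  have hE := ((isEigen_eigenZ p (show p - 2 ≠ 0 by omega)).pow (show p - 1 ≠ 0 by omega)).eq_smul
  set c := -coeffLin p 1 (eigenZ p (p - 2) ^ (p - 1)) with hc
  have hmod : eigenZ p ((p - 2) * (p - 1)) = eigenZ p (p - 1) :=
    eigen_eq_of_modEq p _ _ (by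
      rw [Nat.ModEq, Nat.mul_mod_left, Nat.mod_self])
  have h := congrArg (· ^ (p - 1)) (eigenZ_one_mul p h3)
  simp only [mul_pow, smul_pow, ← pow_mul] at h
  rw [mul_comm (p - 2), pow_mul, chiL_pow_card_sub_one p (by simp), one_pow, one_smul, hE, hmod,
    eigenZ_pow p (by omega), smul_mul_smul_comm, ← sq, eigenZ_sub_one_pow p 1, pow_one,
    smul_smul] at h
  have h' := h.trans (by
    rw [show eigenZ p (p - 1) ^ (p - 1) = eigenZ p (p - 1) ^ ((p - 2) + 1) by
      rw [show p - 2 + 1 = p - 1 by omega], eigenZ_sub_one_pow p (p - 2)])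
  have h'' := smul_eigenZ_injective p (p - 1) h'
  exact isUnit_of_mul_eq_pow p (reduction_w_sub_one_ne_zero p) ((mul_assoc _ _ _).symm.trans h'')

/-- w_i divides the unit w_{p-1}: complete y_1^i = w_i y_i to y_1^(p-1) = w_{p-1} y_{p-1} by a power
of y_1. -/
theorem isUnit_w {i : ℕ} (hi : i ≠ 0) (hip : i < p) : IsUnit (w p i) := by
  refine isUnit_of_dvd_unit ?_ (isUnit_w_sub_one p)
  have hE : ∃ d : Lambda p, eigenZ p i * eigenZ p 1 ^ (p - 1 - i) = d • eigenZ p (p - 1) := by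
    by_cases h : p - 1 - i = 0
    · refine ⟨1, ?_⟩
      rw [h, pow_zero, mul_one, one_smul, show i = p - 1 by omega]
    · have := ((isEigen_eigenZ p hi).mul ((isEigen_eigenZ p one_ne_zero).pow h)).eq_smul
      rw [show i + 1 * (p - 1 - i) = p - 1 by omega] at this
      exact ⟨_, this⟩
  obtain ⟨d, hd⟩ := hE
  refine ⟨d, smul_eigenZ_injective p (p - 1) ?_⟩
  change w p (p - 1) • _ = (w p i * d) • _
  rw [mul_smul, ← hd, ← smul_mul_assoc, ← eigenZ_pow p hi, ← eigenZ_pow p (by omega), ← pow_add]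
  congr 1; omega

theorem isUnit_one_sub_prime : IsUnit (1 - (p : Lambda p)) := by
  rw [← neg_sub]; exact (isUnit_prime_sub_one p).neg

theorem mul_lawCoeff {i : ℕ} (hi : i ≠ 0) (hip : i < p) :
    (1 - (p : Lambda p)) * w p i * w p (p - i) * lawCoeff p i = 1 :=
  Ring.mul_inverse_cancel _ (((isUnit_one_sub_prime p).mul (isUnit_w p hi hip)).mul
    (isUnit_w p (by omega) (by omega)))

/-- The addition law for the coordinate `y` of `μ_p`. -/
theorem eigenY_mul {A : Type*} [CommRing A] (str : Lambda p →+* A) {z z' : A} (hz : z ^ p = 1)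
    (hz' : z' ^ p = 1) : eigenY p str (z * z') = eigenY p str z + eigenY p str z' +
      ∑ i ∈ Finset.Ico 1 p, str (lawCoeff p i) * eigenY p str z ^ i * eigenY p str z' ^ (p - i) := by
  have h2 := hp.out.two_le
  -- From 1 - ζζ' = (1 - ζ) + (1 - ζ') - (1 - ζ)(1 - ζ'): D is the deviation of y from additivity.
  set D := ∑ m : ZMod p, str (chiL p m⁻¹) * ((1 - z ^ m.val) * (1 - z' ^ m.val)) with hD
  have h1 : eigenY p str (z * z') = eigenY p str z + eigenY p str z' - D := by
    simp only [eigenY, hD, ← Finset.sum_add_distrib, ← Finset.sum_sub_distrib]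
    exact Finset.sum_congr rfl fun m _ => by rw [mul_pow]; ring
  have hu : IsUnit ((p : A) - 1) := by
    have := (isUnit_prime_sub_one p).map str
    rwa [map_sub, map_natCast, map_one] at this
  have hD2 : ((p : A) - 1) * ((p : A) - 1) * D =
      ((p : A) - 1) * ∑ i ∈ Finset.Ico 1 p, eigen p str i z * eigen p str (p - i) z' := by
    calc ((p : A) - 1) * ((p : A) - 1) * D = ∑ m : ZMod p, str (chiL p m⁻¹) *
          ((((p : A) - 1) * (1 - z ^ m.val)) * (((p : A) - 1) * (1 - z' ^ m.val))) := by
          rw [hD, Finset.mul_sum]; exact Finset.sum_congr rfl fun m _ => by ring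
      _ = ∑ m : ZMod p, ∑ i ∈ Finset.Ico 1 p, ∑ k ∈ Finset.Ico 1 p,
          str (chiL p m⁻¹ ^ 1 * chiL p m ^ (i + k)) * (eigen p str i z * eigen p str k z') := by
          refine Finset.sum_congr rfl fun m _ => ?_
          rw [← sum_chiL_pow_mul_eigen, ← sum_chiL_pow_mul_eigen, Finset.sum_mul_sum, Finset.mul_sum]
          refine Finset.sum_congr rfl fun i _ => ?_
          rw [Finset.mul_sum]
          refine Finset.sum_congr rfl fun k _ => ?_
          simp only [map_mul, map_pow]; ring
      _ = ∑ i ∈ Finset.Ico 1 p, ∑ k ∈ Finset.Ico 1 p, ∑ m : ZMod p,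
          str (chiL p m⁻¹ ^ 1 * chiL p m ^ (i + k)) * (eigen p str i z * eigen p str k z') := by
          rw [Finset.sum_comm]
          exact Finset.sum_congr rfl fun i _ => Finset.sum_comm
      _ = _ := by
          rw [Finset.mul_sum]
          refine Finset.sum_congr rfl fun i hi => ?_
          rw [Finset.mem_Ico] at hi
          simp only [← Finset.sum_mul, ← map_sum, sum_chiL_inv_pow_mul p one_ne_zero]
          -- Summing over m leaves the terms with i + k ≡ 1 modulo p - 1; in the range 2 ≤ i + k ≤
          -- 2p - 2 this forces i + k = p.
          rw [Finset.sum_eq_single (p - i)]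
          · rw [if_pos, map_sub, map_natCast, map_one]
            rw [Nat.add_sub_cancel' hi.2.le]
            exact (Nat.modEq_iff_dvd' (by omega)).mpr dvd_rfl
          · intro k hk hne
            rw [Finset.mem_Ico] at hk
            rw [if_neg, map_zero, zero_mul]
            intro h
            obtain ⟨n, hn⟩ := (Nat.modEq_iff_dvd' (by omega)).mp h
            have hn2 : n < 2 := by
              by_contra hge
              have : (p - 1) * 2 ≤ (p - 1) * n := Nat.mul_le_mul_left _ (by omega)
              omega
            have hn0 : n ≠ 0 := by
              rintro rfl
              rw [mul_zero] at hn; omega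
            have : n = 1 := by omega
            subst this
            omega
          · intro h
            exact absurd (Finset.mem_Ico.mpr ⟨by omega, by omega⟩) h
  rw [h1, sub_eq_add_neg]
  congr 1
  apply hu.mul_left_cancel
  have hD3 := hu.mul_left_cancel ((mul_assoc _ _ _).symm.trans hD2)
  rw [mul_neg, hD3, Finset.mul_sum, ← Finset.sum_neg_distrib]
  refine Finset.sum_congr rfl fun i hi => ?_
  rw [Finset.mem_Ico] at hi
  have hl := congrArg str (mul_lawCoeff p (show i ≠ 0 by omega) hi.2)
  simp only [map_mul, map_sub, map_one, map_natCast] at hl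
  rw [eigenY_pow p str hz (by omega), eigenY_pow p str hz' (by omega)]
  linear_combination (eigen p str i z * eigen p str (p - i) z') * hl

/-- Apply the group law of μ_p to z^k and z. All three values of y are multiples of y(z), and y^p =
w_p y; compare coefficients of y(z). This is what makes the multiples of a point u equal to the χ(k)
u. -/
theorem chiL_add_one (k : ZMod p) : chiL p (k + 1) = chiL p k + 1 +
    w p p * ∑ i ∈ Finset.Ico 1 p, lawCoeff p i * chiL p k ^ i := by
  have : Fact (1 < p) := ⟨hp.out.one_lt⟩
  have h := eigenY_mul p (algebraMap (Lambda p) (GroupAlg p)) (genZ_pow_val_pow_card p k)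
    (genZ_pow_card p)
  have h1 : genZ p ^ k.val * genZ p = genZ p ^ (k + 1).val := by
    rw [← pow_val_add p (genZ_pow_card p), ZMod.val_one, pow_one]
  rw [h1, ← eigen_one, ← eigen_one, ← eigen_one,
    eigen_pow_val p _ (genZ_pow_card p) one_ne_zero, eigen_pow_val p _ (genZ_pow_card p) one_ne_zero,
    ← eigenZ, pow_one, pow_one] at h
  have hp1 := eigenZ_pow p hp.out.ne_zero
  rw [show eigenZ p p = eigenZ p 1 from eigen_card p _ _] at hp1
  have hs : ∀ i ∈ Finset.Ico 1 p, algebraMap (Lambda p) (GroupAlg p) (lawCoeff p i) *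
      (algebraMap (Lambda p) (GroupAlg p) (chiL p k) * eigenZ p 1) ^ i * eigenZ p 1 ^ (p - i) =
        (w p p * (lawCoeff p i * chiL p k ^ i)) • eigenZ p 1 := by
    intro i hi
    rw [Finset.mem_Ico] at hi
    rw [mul_pow, mul_assoc, mul_assoc, ← pow_add, Nat.add_sub_cancel' hi.2.le, hp1]
    simp only [Algebra.smul_def, map_mul, map_pow]
    ring
  rw [Finset.sum_congr rfl hs, ← Finset.sum_smul, ← Algebra.smul_def, ← Algebra.smul_def,
    ← Finset.mul_sum] at h
  apply smul_eigenZ_injective p 1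
  simpa only [add_smul, one_smul] using h

end Constants

/-! ### Powers of the Tate-Oort group law. -/

section ComultiplicationPowers

variable (p : ℕ) [hp : Fact p.Prime]

/-- The structure constants of the algebra `R[X] / (X ^ p - d X)` in the basis `1, X, …, X ^ (p-1)`:
the coefficient of `X ^ k` in `X ^ i * X ^ j`. -/
def structConst {R : Type*} [CommRing R] (d : R) (i j k : ℕ) : R :=
  -- The guard p ≤ i + j matters only for k = 0: X^(p-1) is itself a basis vector and not d times 1.
  if i + j = k then 1 else if i + j = k + (p - 1) ∧ p ≤ i + j then d else 0

theorem map_structConst {R R' : Type*} [CommRing R] [CommRing R'] (g : R →+* R') (d : R)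
    (i j k : ℕ) : g (structConst p d i j k) = structConst p (g d) i j k := by
  unfold structConst
  split_ifs <;> simp

/-- The coordinate function dual to `y ^ r` in the group algebra, up to a constant. -/
noncomputable def charLin (r : ℕ) : GroupAlg p →ₗ[Lambda p] Lambda p :=
  ∑ m : ZMod p, chiL p m ^ r • coeffLin p m

theorem charLin_genZ_pow_val (r : ℕ) (k : ZMod p) :
    charLin p r (genZ p ^ k.val) = chiL p k ^ r := by
  simp [charLin, coeffLin_genZ_pow_val]

/-- The constants `(1 - p) w_i`, for `1 ≤ i`, and `1`, for `i = 0`. -/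
noncomputable def dualConst (i : ℕ) : Lambda p := if i = 0 then 1 else (1 - (p : Lambda p)) * w p i

theorem isUnit_dualConst {i : ℕ} (hi : i < p) : IsUnit (dualConst p i) := by
  unfold dualConst
  split_ifs with h
  · exact isUnit_one
  · exact (isUnit_one_sub_prime p).mul (isUnit_w p h hi)

theorem eq_of_modEq_sub_one {p i r : ℕ} (hi : i ≠ 0) (hr : r ≠ 0) (hip : i < p) (hrp : r < p)
    (h : i ≡ r [MOD p - 1]) : i = r := by
  wlog hir : i ≤ r generalizing i r
  · exact (this hr hi hrp hip h.symm (le_of_not_ge hir)).symm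
  obtain ⟨n, hn⟩ := (Nat.modEq_iff_dvd' hir).mp h
  have : n = 0 := by
    by_contra h0
    have : (p - 1) * 1 ≤ (p - 1) * n := Nat.mul_le_mul_left _ (by omega)
    omega
  subst this
  omega

section Functionals

variable {p} {B : Type*} [CommRing B] [Algebra (Lambda p) B] {z : B} {φ : ℕ → B →ₗ[Lambda p] Lambda p}

/-- The functionals φ_r pick out the eigenvectors by orthogonality of the powers of χ. As r ≠ 0, the
term 1 in 1 - z^m contributes χ(0)^r = 0, whence the sign in 1 - p. -/
theorem functional_eigen (hφ : ∀ r (k : ZMod p), φ r (z ^ k.val) = chiL p k ^ r) {i r : ℕ}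
    (hi : i ≠ 0) (hr : r ≠ 0) : φ r (eigen p (algebraMap (Lambda p) B) i z) =
      if i ≡ r [MOD p - 1] then 1 - (p : Lambda p) else 0 := by
  have h := sum_chiL_inv_pow_mul p (r := r) hi
  have h1 : φ r 1 = chiL p 0 ^ r := by simpa using hφ r 0
  simp only [eigen, ← map_pow, ← Algebra.smul_def, map_sum, map_smul, map_sub, h1,
    hφ, chiL_zero, zero_pow hr, zero_sub, smul_eq_mul, mul_neg, Finset.sum_neg_distrib, h]
  split_ifs <;> simp

theorem functional_zero_eigen (hφ : ∀ r (k : ZMod p), φ r (z ^ k.val) = chiL p k ^ r) (i : ℕ) :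
    φ 0 (eigen p (algebraMap (Lambda p) B) i z) = 0 := by
  have h1 : φ 0 1 = chiL p 0 ^ 0 := by simpa using hφ 0 0
  simp only [eigen, ← map_pow, ← Algebra.smul_def, map_sum, map_smul, map_sub, h1, hφ]
  simp

/-- Up to the constants `dualConst`, the φ_r form the basis dual to the powers of y for exponents
below p; this explains the normalisation (1 - p) w_i. -/
theorem functional_eigenY_pow (hz : z ^ p = 1)
    (hφ : ∀ r (k : ZMod p), φ r (z ^ k.val) = chiL p k ^ r) {i r : ℕ} (hi : i < p) (hr : r < p) :
    φ r (eigenY p (algebraMap (Lambda p) B) z ^ i) = if i = r then dualConst p i else 0 := by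
  have h2 := hp.out.two_le
  have h1 : φ r 1 = chiL p 0 ^ r := by simpa using hφ r 0
  by_cases hi0 : i = 0
  · subst hi0
    rw [pow_zero, h1, chiL_zero]
    by_cases hr0 : r = 0
    · simp [hr0, dualConst]
    · simp [hr0, Ne.symm hr0]
  rw [eigenY_pow p _ hz hi0, ← Algebra.smul_def, map_smul]
  by_cases hr0 : r = 0
  · subst hr0
    rw [functional_zero_eigen hφ, if_neg hi0, smul_zero]
  rw [functional_eigen hφ hi0 hr0]
  by_cases h : i = r
  · subst h
    rw [if_pos (Nat.ModEq.refl i), if_pos rfl, dualConst, if_neg hi0, smul_eq_mul, mul_comm]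
  · rw [if_neg h, if_neg, smul_zero]
    exact fun h' => h (eq_of_modEq_sub_one hi0 hr0 hi hr h')

end Functionals

/-- The group law of `G_{a,b}`. -/
noncomputable def groupLaw {E : Type*} [CommRing E] (str : Lambda p →+* E) (b x x' : E) : E :=
  x + x' + b * ∑ i ∈ Finset.Ico 1 p, str (lawCoeff p i) * x ^ i * x' ^ (p - i)

theorem map_groupLaw {E E' : Type*} [CommRing E] [CommRing E'] (g : E →+* E') (str : Lambda p →+* E)
    (b x x' : E) :
    g (groupLaw p str b x x') = groupLaw p (g.comp str) (g b) (g x) (g x') := by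
  simp [groupLaw]

/-- Give x and x' weight 1 and b weight -(p - 1); the group law is then homogeneous of weight 1. Its
j-th power consists of monomials b^q x^r x'^s of weight j, and b x^p = w_p x lowers q whenever an
exponent reaches p. -/
theorem groupLaw_pow_mem_span {E : Type*} [CommRing E] [Algebra (Lambda p) E] {a b x x' : E}
    (hx : x ^ p = a * x) (hx' : x' ^ p = a * x') (hab : a * b = algebraMap (Lambda p) E (w p p))
    {j : ℕ} (hj : j ≠ 0) (hjp : j < p) :
    groupLaw p (algebraMap (Lambda p) E) b x x' ^ j ∈ Submodule.span (Lambda p)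
      (Set.range fun rs : Fin p × Fin p =>
        structConst p b rs.1 rs.2 j * (x ^ (rs.1 : ℕ) * x' ^ (rs.2 : ℕ))) := by
  have h2 := hp.out.two_le
  -- `M j` is the span of the monomials of weight j, before any reduction of exponents.
  let M : ℕ → Submodule (Lambda p) E := fun j => Submodule.span (Lambda p)
    {e | ∃ q r s : ℕ, r + s = j + q * (p - 1) ∧ e = b ^ q * (x ^ r * x' ^ s)}
  have hM1 : groupLaw p (algebraMap (Lambda p) E) b x x' ∈ M 1 := by
    refine add_mem (add_mem ?_ ?_) ?_
    · exact Submodule.subset_span ⟨0, 1, 0, by simp, by simp⟩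
    · exact Submodule.subset_span ⟨0, 0, 1, by simp, by simp⟩
    · rw [Finset.mul_sum]
      refine Submodule.sum_mem _ fun i hi => ?_
      rw [Finset.mem_Ico] at hi
      rw [mul_assoc, mul_left_comm, ← Algebra.smul_def]
      exact Submodule.smul_mem _ _ (Submodule.subset_span ⟨1, i, p - i, by omega, by rw [pow_one]⟩)
  have hMmul : ∀ i k, M i * M k ≤ M (i + k) := by
    intro i k
    rw [Submodule.span_mul_span, Submodule.span_le]
    rintro _ ⟨_, ⟨q, r, s, h, rfl⟩, _, ⟨q', r', s', h', rfl⟩, rfl⟩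
    refine Submodule.subset_span ⟨q + q', r + r', s + s', ?_, ?_⟩
    · rw [add_mul]; omega
    · simp only [pow_add]; ring
  have hMpow : ∀ n, groupLaw p (algebraMap (Lambda p) E) b x x' ^ (n + 1) ∈ M (n + 1) := by
    intro n
    induction n with
    | zero => simpa using hM1
    | succ n ih => exact hMmul _ _ (by rw [pow_succ]; exact Submodule.mul_mem_mul ih hM1)
  obtain ⟨n, rfl⟩ := Nat.exists_eq_succ_of_ne_zero hj
  refine (Submodule.span_le.mpr ?_ : M (n + 1) ≤ _) (hMpow n)
  rintro _ ⟨q, r, s, h, rfl⟩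
  induction q generalizing r s with
  | zero =>
    refine Submodule.subset_span ⟨(⟨r, by omega⟩, ⟨s, by omega⟩), ?_⟩
    simp [structConst, show r + s = n + 1 by omega]
  | succ q ih =>
    have e : (q + 1) * (p - 1) = q * (p - 1) + (p - 1) := by ring
    by_cases hr : p ≤ r
    · have : b ^ (q + 1) * (x ^ r * x' ^ s) = w p p • (b ^ q * (x ^ (r - (p - 1)) * x' ^ s)) := by
        obtain ⟨r, rfl⟩ := Nat.exists_eq_add_of_le hr
        rw [show p + r - (p - 1) = r + 1 by omega, Algebra.smul_def, ← hab, pow_add x p, hx]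
        ring
      rw [this]
      exact Submodule.smul_mem _ _ (ih _ _ (by omega))
    by_cases hs : p ≤ s
    · have : b ^ (q + 1) * (x ^ r * x' ^ s) = w p p • (b ^ q * (x ^ r * x' ^ (s - (p - 1)))) := by
        obtain ⟨s, rfl⟩ := Nat.exists_eq_add_of_le hs
        rw [show p + s - (p - 1) = s + 1 by omega, Algebra.smul_def, ← hab, pow_add x' p, hx']
        ring
      rw [this]
      exact Submodule.smul_mem _ _ (ih _ _ (by omega))
    -- Both exponents are now below p, so r + s ≤ 2p - 2; as j ≥ 1, only one factor b can remain.
    have hq : q = 0 := by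
      by_contra h0
      have : 1 * (p - 1) ≤ q * (p - 1) := Nat.mul_le_mul_right _ (by omega)
      omega
    subst hq
    refine Submodule.subset_span ⟨(⟨r, by omega⟩, ⟨s, by omega⟩), ?_⟩
    simp only [structConst]
    rw [if_neg (by omega), if_pos (by omega), zero_add, pow_one]

/-- The group law applied to y(z) ⊗ 1 and 1 ⊗ y(z) gives y(z ⊗ z), whose j-th power is w_j y_j(z ⊗
z). Since φ_r ⊗ φ_s sends (z ⊗ z)^m to χ(m)^(r+s), orthogonality evaluates it; r + s ≠ 0 kills the
constant terms. -/
theorem functional_groupLaw_pow {B : Type*} [CommRing B] [Algebra (Lambda p) B] {z : B}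
    {φ : ℕ → B →ₗ[Lambda p] Lambda p} (hz : z ^ p = 1)
    (hφ : ∀ r (k : ZMod p), φ r (z ^ k.val) = chiL p k ^ r) {j r s : ℕ} (hj : j ≠ 0)
    (hrs : j ≡ r + s [MOD p - 1]) (hrs0 : r + s ≠ 0) :
    TensorProduct.lift ((LinearMap.mul (Lambda p) (Lambda p)).compl₁₂ (φ r) (φ s))
      (groupLaw p (algebraMap (Lambda p) (B ⊗[Lambda p] B)) 1
        (eigenY p (algebraMap (Lambda p) B) z ⊗ₜ 1) (1 ⊗ₜ eigenY p (algebraMap (Lambda p) B) z) ^ j) =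
      dualConst p j := by
  set str : Lambda p →+* B ⊗[Lambda p] B := algebraMap (Lambda p) (B ⊗[Lambda p] B) with hstr
  have hφ1 : ∀ r, φ r 1 = chiL p 0 ^ r := fun r => by simpa using hφ r 0
  have hz1 : (z ⊗ₜ[Lambda p] (1 : B)) ^ p = 1 := by
    rw [Algebra.TensorProduct.tmul_pow, hz, one_pow]; rfl
  have hz2 : ((1 : B) ⊗ₜ[Lambda p] z) ^ p = 1 := by
    rw [Algebra.TensorProduct.tmul_pow, hz, one_pow]; rfl
  have e1 : eigenY p (algebraMap (Lambda p) B) z ⊗ₜ[Lambda p] (1 : B) = eigenY p str (z ⊗ₜ 1) := by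
    have := map_eigen p (algebraMap (Lambda p) B)
      (Algebra.TensorProduct.includeLeft : B →ₐ[Lambda p] B ⊗[Lambda p] B).toRingHom 1 z
    rw [AlgHom.toRingHom_eq_coe, AlgHom.comp_algebraMap, eigen_one, eigen_one] at this
    exact this
  have e2 : (1 : B) ⊗ₜ[Lambda p] eigenY p (algebraMap (Lambda p) B) z = eigenY p str (1 ⊗ₜ z) := by
    have := map_eigen p (algebraMap (Lambda p) B)
      (Algebra.TensorProduct.includeRight : B →ₐ[Lambda p] B ⊗[Lambda p] B).toRingHom 1 z
    rw [AlgHom.toRingHom_eq_coe, AlgHom.comp_algebraMap, eigen_one, eigen_one] at this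
    exact this
  have hF : groupLaw p str 1 (eigenY p (algebraMap (Lambda p) B) z ⊗ₜ 1)
      (1 ⊗ₜ eigenY p (algebraMap (Lambda p) B) z) = eigenY p str (z ⊗ₜ z) := by
    rw [e1, e2, groupLaw, one_mul, ← eigenY_mul p str hz1 hz2, Algebra.TensorProduct.tmul_mul_tmul,
      one_mul, mul_one]
  rw [hF, eigenY_pow p str (by rw [Algebra.TensorProduct.tmul_pow, hz]; rfl) hj,
    ← Algebra.smul_def, map_smul]
  simp only [eigen, ← map_pow, hstr, ← Algebra.smul_def, map_sum, map_smul, map_sub,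
    Algebra.TensorProduct.tmul_pow, Algebra.TensorProduct.one_def, TensorProduct.lift.tmul,
    LinearMap.compl₁₂_apply, LinearMap.mul_apply', hφ, hφ1, chiL_zero,
    ← pow_add, zero_pow hrs0, zero_sub, smul_eq_mul, mul_neg, Finset.sum_neg_distrib,
    sum_chiL_inv_pow_mul p hj, if_pos hrs]
  rw [dualConst, if_neg hj]
  ring

theorem inverse_dualConst_smul_groupLaw_pow_of_functional {B : Type*} [CommRing B]
    [Algebra (Lambda p) B] {z : B} {φ : ℕ → B →ₗ[Lambda p] Lambda p} (hz : z ^ p = 1)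
    (hφ : ∀ r (k : ZMod p), φ r (z ^ k.val) = chiL p k ^ r)
    {E : Type*} [CommRing E] [Algebra (Lambda p) E]
    {a b x x' : E} (hx : x ^ p = a * x) (hx' : x' ^ p = a * x')
    (hab : a * b = algebraMap (Lambda p) E (w p p)) {j : ℕ} (hjp : j < p) :
    Ring.inverse (dualConst p j) • groupLaw p (algebraMap (Lambda p) E) b x x' ^ j =
      ∑ r : Fin p, ∑ s : Fin p, structConst p b r s j *
        ((Ring.inverse (dualConst p r) • x ^ (r : ℕ)) *
          (Ring.inverse (dualConst p s) • x' ^ (s : ℕ))) := by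
  have h2 := hp.out.two_le
  have : NeZero p := ⟨by omega⟩
  by_cases hj : j = 0
  · subst hj
    rw [Finset.sum_eq_single 0, Finset.sum_eq_single 0]
    · have h0 : ((0 : Fin p) : ℕ) = 0 := rfl
      rw [h0, structConst, if_pos rfl, dualConst, if_pos rfl, Ring.inverse_one]
      simp only [pow_zero, one_smul, mul_one]
    · intro s _ hs
      have : (s : ℕ) ≠ 0 := fun h => hs (Fin.ext h)
      have := s.2
      have h0 : ((0 : Fin p) : ℕ) = 0 := rfl
      rw [structConst, if_neg, if_neg, zero_mul] <;> omega
    · simp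
    · intro r _ hr
      refine Finset.sum_eq_zero fun s _ => ?_
      have : (r : ℕ) ≠ 0 := fun h => hr (Fin.ext h)
      have := s.2
      have := r.2
      rw [structConst, if_neg, if_neg, zero_mul] <;> omega
    · simp
  let Y : B := eigenY p (algebraMap (Lambda p) B) z
  let T := B ⊗[Lambda p] B
  have hY : Y ^ p = algebraMap (Lambda p) B (w p p) * Y := by
    rw [eigenY_pow p _ hz hp.out.ne_zero, eigen_card, eigen_one]
  let str : Lambda p →+* T := algebraMap (Lambda p) T
  have hY1 : ((Y ⊗ₜ[Lambda p] (1 : B) : T)) ^ p = str (w p p) * (Y ⊗ₜ 1) := by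
    rw [Algebra.TensorProduct.tmul_pow, hY, one_pow, Algebra.TensorProduct.algebraMap_apply,
      Algebra.TensorProduct.tmul_mul_tmul, one_mul]
  have hY2 : (((1 : B) ⊗ₜ[Lambda p] Y : T)) ^ p = str (w p p) * (1 ⊗ₜ Y) := by
    rw [Algebra.TensorProduct.tmul_pow, hY, one_pow, ← Algebra.smul_def, ← Algebra.smul_def,
      TensorProduct.tmul_smul]
  -- Working in the product of `E` with the algebra of μ_p × μ_p gives one family of coefficients in
  -- Λ valid in both factors; it can be determined in the second and used in the first.
  have hmem := groupLaw_pow_mem_span p (E := E × T) (a := (a, str (w p p))) (b := (b, 1))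
    (x := (x, Y ⊗ₜ 1)) (x' := (x', 1 ⊗ₜ Y)) (Prod.ext hx hY1) (Prod.ext hx' hY2)
    (Prod.ext hab (mul_one _)) hj hjp
  rw [Submodule.mem_span_range_iff_exists_fun] at hmem
  obtain ⟨c, hc⟩ := hmem
  have hc1 := congrArg (RingHom.fst E T) hc
  have hc2 := congrArg (RingHom.snd E T) hc
  rw [map_pow (RingHom.fst E T), map_groupLaw] at hc1
  rw [map_pow (RingHom.snd E T), map_groupLaw] at hc2
  have hs1 : (RingHom.fst E T).comp (algebraMap (Lambda p) (E × T)) = algebraMap (Lambda p) E := rfl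
  have hs2 : (RingHom.snd E T).comp (algebraMap (Lambda p) (E × T)) = str := rfl
  rw [hs1] at hc1
  rw [hs2] at hc2
  have hsm1 : ∀ (r : Lambda p) (e : E × T), RingHom.fst E T (r • e) = r • RingHom.fst E T e :=
    fun _ _ => rfl
  have hsm2 : ∀ (r : Lambda p) (e : E × T), RingHom.snd E T (r • e) = r • RingHom.snd E T e :=
    fun _ _ => rfl
  simp only [map_sum, hsm1, hsm2, map_mul, map_pow, map_structConst] at hc1 hc2
  simp only [RingHom.coe_fst, RingHom.coe_snd] at hc1 hc2
  have hφ1 : ∀ r, φ r 1 = chiL p 0 ^ r := fun r => by simpa using hφ r 0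
  -- In the factor of μ_p the structure constants, with d = 1, are 0 or 1. Applying φ_r ⊗ φ_s
  -- isolates the coefficient of each monomial that occurs.
  have key : ∀ rs : Fin p × Fin p, structConst p (1 : T) rs.1 rs.2 j = 1 →
      c rs * (dualConst p rs.1 * dualConst p rs.2) = dualConst p j := by
    rintro ⟨r, s⟩ hrs
    have hcase : (r : ℕ) + s = j ∨ (r : ℕ) + s = j + (p - 1) := by
      have : Nontrivial T := by
        refine ⟨⟨0, 1, fun h => ?_⟩⟩
        have := congrArg (TensorProduct.lift ((LinearMap.mul (Lambda p) (Lambda p)).compl₁₂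
          (φ 0) (φ 0))) h
        rw [map_zero] at this
        change 0 = φ 0 1 * φ 0 1 at this
        rw [hφ1, pow_zero, mul_one] at this
        exact zero_ne_one this
      unfold structConst at hrs
      split_ifs at hrs with h h'
      · exact Or.inl h
      · exact Or.inr h'.1
      · exact absurd hrs zero_ne_one
    rw [← functional_groupLaw_pow p hz hφ (j := j) (r := r) (s := s) hj ?_ (by omega), ← hc2, map_sum,
      Finset.sum_eq_single (r, s)]
    · rw [map_smul]
      simp only at hrs
      rw [hrs, one_mul, Algebra.TensorProduct.tmul_pow, Algebra.TensorProduct.tmul_pow,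
        Algebra.TensorProduct.tmul_mul_tmul, one_pow, one_pow, one_mul, mul_one,
        TensorProduct.lift.tmul, LinearMap.compl₁₂_apply, LinearMap.mul_apply',
        functional_eigenY_pow hz hφ r.2 r.2, functional_eigenY_pow hz hφ s.2 s.2, if_pos rfl, if_pos rfl,
        smul_eq_mul]
    · rintro ⟨r', s'⟩ _ hne
      have h1 : ∃ γ : Lambda p, structConst p (1 : T) r' s' j = algebraMap (Lambda p) T γ :=
        ⟨structConst p 1 r' s' j, by rw [map_structConst, map_one]⟩
      obtain ⟨γ, hγ⟩ := h1
      rw [map_smul, hγ, ← Algebra.smul_def, map_smul, Algebra.TensorProduct.tmul_pow,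
        Algebra.TensorProduct.tmul_pow, Algebra.TensorProduct.tmul_mul_tmul, one_pow, one_pow,
        one_mul, mul_one, TensorProduct.lift.tmul, LinearMap.compl₁₂_apply, LinearMap.mul_apply',
        functional_eigenY_pow hz hφ r'.2 r.2, functional_eigenY_pow hz hφ s'.2 s.2]
      have : ¬ ((r' : ℕ) = r ∧ (s' : ℕ) = s) := fun h =>
        hne (Prod.ext (Fin.ext h.1) (Fin.ext h.2))
      by_cases h : (r' : ℕ) = r
      · rw [if_neg (fun h' => this ⟨h, h'⟩), mul_zero, smul_zero, smul_zero]
      · rw [if_neg h, zero_mul, smul_zero, smul_zero]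
    · simp
    · rcases hcase with h | h
      · rw [h]
      · rw [h]
        exact (Nat.modEq_iff_dvd' (by omega)).mpr (by simp)
  rw [← hc1, Finset.smul_sum, Fintype.sum_prod_type]
  refine Finset.sum_congr rfl fun r _ => Finset.sum_congr rfl fun s _ => ?_
  rw [smul_mul_smul_comm, mul_smul_comm, smul_smul]
  by_cases h : structConst p (1 : T) r s j = 1
  · congr 1
    have hr := Ring.mul_inverse_cancel _ (isUnit_dualConst p r.2)
    have hs := Ring.mul_inverse_cancel _ (isUnit_dualConst p s.2)
    have hjj := Ring.inverse_mul_cancel _ (isUnit_dualConst p hjp)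
    have hk := key (r, s) h
    simp only at hk
    calc _ = Ring.inverse (dualConst p j) * (c (r, s) * (dualConst p r * dualConst p s)) *
          (Ring.inverse (dualConst p r) * Ring.inverse (dualConst p s)) := by
          linear_combination (-(Ring.inverse (dualConst p j) * c (r, s))) * (hr + hs *
            dualConst p r * Ring.inverse (dualConst p r))
      _ = _ := by rw [hk, hjj, one_mul]
  · have : structConst p b r s j = 0 := by
      unfold structConst at h ⊢
      split_ifs at h ⊢ <;> simp_all
    rw [this, zero_mul, smul_zero, smul_zero]

/-- The powers of the group law, in terms of the basis `x ^ r ⊗ x ^ s`: the functions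
`x ^ i / ((1 - p) w_i)` are dual to the powers of a generator of the dual algebra. -/
theorem inverse_dualConst_smul_groupLaw_pow {E : Type*} [CommRing E] [Algebra (Lambda p) E]
    {a b x x' : E} (hx : x ^ p = a * x) (hx' : x' ^ p = a * x')
    (hab : a * b = algebraMap (Lambda p) E (w p p)) {j : ℕ} (hjp : j < p) :
    Ring.inverse (dualConst p j) • groupLaw p (algebraMap (Lambda p) E) b x x' ^ j =
      ∑ r : Fin p, ∑ s : Fin p, structConst p b r s j *
        ((Ring.inverse (dualConst p r) • x ^ (r : ℕ)) *
          (Ring.inverse (dualConst p s) • x' ^ (s : ℕ))) :=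
  inverse_dualConst_smul_groupLaw_pow_of_functional p (genZ_pow_card p)
    (charLin_genZ_pow_val p) hx hx' hab hjp

end ComultiplicationPowers

/-! ### The norm form of R[X]/(X^p - d X). -/

section Norm

variable (p : ℕ) [hp : Fact p.Prime]

/-- The matrix of the multiplication by `∑ c_j X ^ j` on `R[X] / (X ^ p - d X)`. -/
def structMatrix {R : Type*} [CommRing R] (c : Fin p → R) (d : R) : Matrix (Fin p) (Fin p) R :=
  Matrix.of fun i k => ∑ j : Fin p, c j * structConst p d j k i

theorem map_structMatrix {R R' : Type*} [CommRing R] [CommRing R'] (g : R →+* R') (c : Fin p → R)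
    (d : R) : (structMatrix p c d).map g = structMatrix p (fun j => g (c j)) (g d) := by
  ext i k
  simp [structMatrix, map_structConst]

/-- For a root r of X^p = d X, evaluation at r respects the product. Thus the row vector of powers
of r is a left eigenvector of every multiplication matrix. -/
theorem sum_pow_mul_structConst {R : Type*} [CommRing R] {d r : R} (hr : r ^ p = d * r)
    (j k : Fin p) : ∑ i : Fin p, r ^ (i : ℕ) * structConst p d j k i = r ^ ((j : ℕ) + k) := by
  have h2 := hp.out.two_le
  have hj := j.2
  have hk := k.2
  by_cases h : (j : ℕ) + k < p
  · rw [Finset.sum_eq_single ⟨(j : ℕ) + k, h⟩]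
    · simp [structConst]
    · intro i _ hi
      rw [structConst, if_neg (fun h' => hi (Fin.ext h'.symm)), if_neg (by omega), mul_zero]
    · simp
  · rw [Finset.sum_eq_single ⟨(j : ℕ) + k - (p - 1), by omega⟩]
    · have e : structConst p d j k ((j : ℕ) + k - (p - 1)) = d := by
        rw [structConst, if_neg (by omega), if_pos (by omega)]
      rw [e]
      change r ^ ((j : ℕ) + k - (p - 1)) * d = _
      obtain ⟨n, hn⟩ := Nat.exists_eq_add_of_le (not_lt.mp h)
      rw [hn, pow_add r p, hr, show p + n - (p - 1) = n + 1 by omega]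
      ring
    · intro i _ hi
      have : (i : ℕ) ≠ (j : ℕ) + k - (p - 1) := fun h => hi (Fin.ext h)
      rw [structConst, if_neg (by have := i.2; omega), if_neg (by omega), mul_zero]
    · simp

theorem chiL_mul_pow_card {R : Type*} [CommRing R] (str : Lambda p →+* R) (v : R) (m : ZMod p) :
    (str (chiL p m) * v) ^ p = v ^ (p - 1) * (str (chiL p m) * v) := by
  have e : chiL p m ^ p = chiL p m := by rw [← chiL_pow, ZMod.pow_card]
  rw [mul_pow, ← map_pow, e, mul_left_comm, ← pow_succ, Nat.sub_add_cancel hp.out.one_le]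

theorem natCast_bijective : Function.Bijective fun i : Fin p => ((i : ℕ) : ZMod p) := by
  rw [Fintype.bijective_iff_injective_and_card]
  refine ⟨fun i j h => ?_, by simp [ZMod.card]⟩
  have := (ZMod.natCast_eq_natCast_iff' _ _ _).mp h
  rw [Nat.mod_eq_of_lt i.2, Nat.mod_eq_of_lt j.2] at this
  exact Fin.ext this

/-- The p roots χ(m) v are distinct, and their Vandermonde matrix, of nonzero determinant,
diagonalises the multiplication. -/
theorem det_structMatrix_of_isDomain {R : Type*} [CommRing R] [IsDomain R] {str : Lambda p →+* R}
    (hstr : Function.Injective str) {v : R} (hv : v ≠ 0) (c : Fin p → R) :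
    (structMatrix p c (v ^ (p - 1))).det =
      ∏ m : ZMod p, ∑ j : Fin p, c j * (str (chiL p m) * v) ^ (j : ℕ) := by
  let r : Fin p → R := fun i => str (chiL p (i : ℕ)) * v
  have hr : Function.Injective r := by
    intro i j h
    exact (natCast_bijective p).1 (chiL_injective p (hstr (mul_right_cancel₀ hv h)))
  have h : Matrix.vandermonde r * structMatrix p c (v ^ (p - 1)) =
      Matrix.diagonal (fun i => ∑ j : Fin p, c j * r i ^ (j : ℕ)) * Matrix.vandermonde r := by
    ext i k
    rw [Matrix.diagonal_mul, Matrix.mul_apply, Matrix.vandermonde_apply, Finset.sum_mul]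
    simp only [Matrix.vandermonde_apply, structMatrix, Matrix.of_apply, Finset.mul_sum]
    rw [Finset.sum_comm]
    refine Finset.sum_congr rfl fun j _ => ?_
    rw [mul_assoc, ← pow_add, ← sum_pow_mul_structConst p (chiL_mul_pow_card p str v _) j k,
      Finset.mul_sum]
    exact Finset.sum_congr rfl fun l _ => by ring
  have h' := congrArg Matrix.det h
  rw [Matrix.det_mul, Matrix.det_mul, Matrix.det_diagonal, mul_comm] at h'
  rw [mul_right_cancel₀ (Matrix.det_vandermonde_ne_zero_iff.mpr hr) h']
  exact Fintype.prod_bijective _ (natCast_bijective p) _ _ fun i => rfl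

/-- The norm on `R[X] / ∏ (X - χ(m) v)`. -/
theorem det_structMatrix {R : Type*} [CommRing R] (str : Lambda p →+* R) (v : R) (c : Fin p → R) :
    (structMatrix p c (v ^ (p - 1))).det =
      ∏ m : ZMod p, ∑ j : Fin p, c j * (str (chiL p m) * v) ^ (j : ℕ) := by
  -- Universal case: v and the coordinates c_j are indeterminates over Λ, so v ≠ 0 in a domain; the
  -- identity then specialises.
  let U := MvPolynomial (Option (Fin p)) (Lambda p)
  let φ : U →+* R := MvPolynomial.eval₂Hom str (fun o => o.elim v c)
  have h := congrArg φ (det_structMatrix_of_isDomain p (R := U) (MvPolynomial.C_injective _ _)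
    (MvPolynomial.X_ne_zero none) (fun j => MvPolynomial.X (some j)))
  rw [RingHom.map_det, RingHom.mapMatrix_apply, map_structMatrix] at h
  have hX : ∀ o, φ (MvPolynomial.X o) = o.elim v c := fun o => MvPolynomial.eval₂_X _ _ _
  have hC : ∀ x, φ (MvPolynomial.C x) = str x := fun o => MvPolynomial.eval₂_C _ _ _
  simpa only [map_prod, map_sum, map_mul, map_pow, hX, hC, Option.elim] using h

/-- X^p - v^(p-1) X and ∏ (X - χ(m) v) are monic of degree p with the same p distinct roots;
evaluate at X = 1. -/
theorem prod_one_sub_chiL_mul_of_isDomain {R : Type*} [CommRing R] [IsDomain R]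
    {str : Lambda p →+* R} (hstr : Function.Injective str) {v : R} (hv : v ≠ 0) :
    ∏ m : ZMod p, (1 - str (chiL p m) * v) = 1 - v ^ (p - 1) := by
  classical
  have hlt : (Polynomial.C (v ^ (p - 1)) * Polynomial.X : Polynomial R).degree <
      (Polynomial.X ^ p : Polynomial R).degree := by
    rw [Polynomial.degree_X_pow]
    refine (Polynomial.degree_C_mul_X_le _).trans_lt ?_
    exact_mod_cast hp.out.one_lt
  have hdeg : (Polynomial.X ^ p - Polynomial.C (v ^ (p - 1)) * Polynomial.X :
      Polynomial R).degree = p := by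
    rw [Polynomial.degree_sub_eq_left_of_degree_lt hlt, Polynomial.degree_X_pow]
  have hmonic : (∏ m : ZMod p, (Polynomial.X - Polynomial.C (str (chiL p m) * v))).Monic :=
    Polynomial.monic_prod_of_monic _ _ fun m _ => Polynomial.monic_X_sub_C _
  have hdeg' : (∏ m : ZMod p, (Polynomial.X - Polynomial.C (str (chiL p m) * v))).degree =
      ((p : ℕ) : WithBot ℕ) := by
    simp only [Polynomial.degree_prod, Polynomial.degree_X_sub_C]; simp [ZMod.card]
  have hinj : Function.Injective fun m : ZMod p => str (chiL p m) * v := fun m n h =>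
    chiL_injective p (hstr (mul_right_cancel₀ hv h))
  have key : ∏ m : ZMod p, (Polynomial.X - Polynomial.C (str (chiL p m) * v)) =
      Polynomial.X ^ p - Polynomial.C (v ^ (p - 1)) * Polynomial.X := by
    refine Polynomial.eq_of_degree_sub_lt_of_eval_finset_eq
      (Finset.univ.image fun m : ZMod p => str (chiL p m) * v) ?_ ?_
    · rw [Finset.card_image_of_injective _ hinj, Finset.card_univ, ZMod.card, ← hdeg']
      refine Polynomial.degree_sub_lt_left (hdeg'.trans hdeg.symm) hmonic.ne_zero ?_
      rw [Polynomial.leadingCoeff_sub_of_degree_lt hlt, Polynomial.leadingCoeff_X_pow,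
        hmonic.leadingCoeff]
    · intro x hx
      obtain ⟨m, _, rfl⟩ := Finset.mem_image.mp hx
      rw [Polynomial.eval_prod, Finset.prod_eq_zero (Finset.mem_univ m) (by simp)]
      simp [chiL_mul_pow_card]
  simpa [Polynomial.eval_prod] using congrArg (Polynomial.eval 1) key

theorem prod_one_sub_chiL_mul {R : Type*} [CommRing R] (str : Lambda p →+* R) (v : R) :
    ∏ m : ZMod p, (1 - str (chiL p m) * v) = 1 - v ^ (p - 1) := by
  have h := congrArg (Polynomial.eval₂RingHom str v) (prod_one_sub_chiL_mul_of_isDomain p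
    (R := Polynomial (Lambda p)) Polynomial.C_injective Polynomial.X_ne_zero)
  simpa [map_prod] using h

/-- The coordinates of `1 - X`. -/
def oneSubCoord (R : Type*) [CommRing R] (j : Fin p) : R :=
  if (j : ℕ) = 0 then 1 else if (j : ℕ) = 1 then -1 else 0

theorem sum_oneSubCoord {R : Type*} [CommRing R] (r : R) :
    ∑ j : Fin p, oneSubCoord p R j * r ^ (j : ℕ) = 1 - r := by
  have h2 := hp.out.two_le
  have : ∀ j : Fin p, oneSubCoord p R j * r ^ (j : ℕ) =
      (if j = ⟨0, by omega⟩ then 1 else 0) - if j = ⟨1, by omega⟩ then r else 0 := by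
    intro j
    simp only [oneSubCoord, Fin.ext_iff]
    split_ifs with h h' h'
    · omega
    · simp [h]
    · simp [h']
    · simp
  simp only [this, Finset.sum_sub_distrib, Finset.sum_ite_eq', Finset.mem_univ, if_true]

theorem map_det_structMatrix_oneSubCoord {R R' : Type*} [CommRing R] [CommRing R'] (g : R →+* R')
    (d : R) : g (structMatrix p (oneSubCoord p R) d).det =
      (structMatrix p (oneSubCoord p R') (g d)).det := by
  rw [RingHom.map_det, RingHom.mapMatrix_apply, map_structMatrix]
  congr 2
  funext j
  unfold oneSubCoord
  split_ifs <;> simp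

/-- The norm of `1 - X` on `R[X] / (X ^ p - d X)`. -/
theorem det_structMatrix_oneSubCoord {R : Type*} [CommRing R] (str : Lambda p →+* R) (d : R) :
    (structMatrix p (oneSubCoord p R) d).det = 1 - d := by
  have h2 := hp.out.two_le
  have hX : (structMatrix p (oneSubCoord p (Polynomial (Lambda p))) Polynomial.X).det =
      1 - Polynomial.X := by
    -- The universal d has no (p-1)-st root; the injection T ↦ T^(p-1) of Λ[T] supplies one and
    -- makes the product formula available.
    apply Polynomial.expand_injective (R := Lambda p) (show 0 < p - 1 by omega)
    have h := map_det_structMatrix_oneSubCoord p (Polynomial.expand (Lambda p) (p - 1)).toRingHom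
      Polynomial.X
    rw [AlgHom.toRingHom_eq_coe, RingHom.coe_coe, Polynomial.expand_X,
      det_structMatrix p Polynomial.C] at h
    simp only [sum_oneSubCoord, prod_one_sub_chiL_mul] at h
    rw [h]
    simp
  have h := congrArg (Polynomial.eval₂RingHom str d) hX
  rw [map_det_structMatrix_oneSubCoord] at h
  simpa using h

end Norm

/-! ### The norm criterion for a bilinear product with these structure constants. -/

section StructuredAlgebra

variable {p : ℕ} [hp : Fact p.Prime] {R : Type*} [CommRing R] {M : Type*} [AddCommGroup M] [Module R M]

/-- The determinant of a multiplication with the structure constants of `R[X] / (X ^ p - d X)`. -/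
theorem det_eq_det_structMatrix (B : Module.Basis (Fin p) R M) (mul : M →ₗ[R] M →ₗ[R] M) (d : R)
    (hB : ∀ j k : Fin p, mul (B j) (B k) = ∑ i : Fin p, structConst p d j k i • B i) (f : M) :
    LinearMap.det (mul f) = (structMatrix p (B.repr f) d).det := by
  rw [← LinearMap.det_toMatrix B]
  congr 1
  ext i k
  rw [LinearMap.toMatrix_apply]
  nth_rw 1 [← B.sum_repr f]
  simp only [map_sum, map_smul, LinearMap.sum_apply, LinearMap.smul_apply, hB, Finsupp.coe_finsetSum,
    Finset.sum_apply, Finsupp.smul_apply, smul_eq_mul, Module.Basis.repr_self, structMatrix,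
    Matrix.of_apply]
  refine Finset.sum_congr rfl fun j _ => ?_
  congr 1
  rw [Finset.sum_eq_single i]
  · simp
  · intro l _ hl
    simp [hl]
  · simp

/-- The norm is the product of the values at the points `χ(m) v`, if `v ^ (p - 1) = d`. -/
theorem det_eq_prod (str : Lambda p →+* R) (B : Module.Basis (Fin p) R M)
    (mul : M →ₗ[R] M →ₗ[R] M) {d v : R}
    (hB : ∀ j k : Fin p, mul (B j) (B k) = ∑ i : Fin p, structConst p d j k i • B i)
    (hv : v ^ (p - 1) = d) (s : ZMod p → M →ₗ[R] R)
    (hs : ∀ m (j : Fin p), s m (B j) = (str (chiL p m) * v) ^ (j : ℕ)) (f : M) :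
    LinearMap.det (mul f) = ∏ m, s m f := by
  rw [det_eq_det_structMatrix B mul d hB, ← hv, det_structMatrix p str]
  refine Finset.prod_congr rfl fun m _ => ?_
  conv_rhs => rw [← B.sum_repr f]
  simp only [map_sum, map_smul, hs, smul_eq_mul]

/-- If the norm is the product of the values at the points `χ(m) v`, then `v ^ (p - 1) = d`. -/
theorem pow_eq_of_det_eq_prod (str : Lambda p →+* R) (B : Module.Basis (Fin p) R M)
    (mul : M →ₗ[R] M →ₗ[R] M) {d v : R}
    (hB : ∀ j k : Fin p, mul (B j) (B k) = ∑ i : Fin p, structConst p d j k i • B i)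
    (s : ZMod p → M →ₗ[R] R)
    (hs : ∀ m (j : Fin p), s m (B j) = (str (chiL p m) * v) ^ (j : ℕ))
    (h : ∀ f, LinearMap.det (mul f) = ∏ m, s m f) : v ^ (p - 1) = d := by
  -- The test element is 1 - X. The element X would give nothing: its norm is 0, and so is its value
  -- at χ(0) v = 0.
  have h1 := h (∑ j, oneSubCoord p R j • B j)
  have hr : (B.repr (∑ j, oneSubCoord p R j • B j) : Fin p → R) = oneSubCoord p R := by
    rw [B.repr_sum_self]
  rw [det_eq_det_structMatrix B mul d hB, hr, det_structMatrix_oneSubCoord p str] at h1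
  simp only [map_sum, map_smul, hs, smul_eq_mul, sum_oneSubCoord, prod_one_sub_chiL_mul] at h1
  exact (sub_right_injective h1).symm

end StructuredAlgebra

/-! ### The algebra of functions, its dual, and the values of characters. -/

section PowerBasis

variable {p : ℕ} [hp : Fact p.Prime] {R : Type*} [CommRing R] {M : Type*} [CommRing M] [Algebra R M]

theorem pow_mul_pow_eq_sum_structConst {x : M} {a : R} (hx : x ^ p = algebraMap R M a * x)
    (j k : Fin p) :
    x ^ (j : ℕ) * x ^ (k : ℕ) = ∑ i : Fin p, structConst p a j k i • x ^ (i : ℕ) := by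
  rw [← pow_add, ← sum_pow_mul_structConst p hx j k]
  refine Finset.sum_congr rfl fun i _ => ?_
  rw [Algebra.smul_def, map_structConst, mul_comm]

/-- The multiplication on the dual of an algebra `M` given by a homomorphism `M → M ⊗ M`. -/
noncomputable def convMul (Δ : M →ₐ[R] M ⊗[R] M) :
    Module.Dual R M →ₗ[R] Module.Dual R M →ₗ[R] Module.Dual R M :=
  LinearMap.mk₂ R (fun φ ψ => LinearMap.mul' R R ∘ₗ TensorProduct.map φ ψ ∘ₗ Δ.toLinearMap)
    (fun φ φ' ψ => by rw [TensorProduct.map_add_left, LinearMap.add_comp, LinearMap.comp_add])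
    (fun r φ ψ => by rw [TensorProduct.map_smul_left, LinearMap.smul_comp, LinearMap.comp_smul])
    (fun φ ψ ψ' => by rw [TensorProduct.map_add_right, LinearMap.add_comp, LinearMap.comp_add])
    (fun r φ ψ => by rw [TensorProduct.map_smul_right, LinearMap.smul_comp, LinearMap.comp_smul])

theorem convMul_apply (Δ : M →ₐ[R] M ⊗[R] M) (φ ψ : Module.Dual R M) (x : M) :
    convMul Δ φ ψ x = LinearMap.mul' R R (TensorProduct.map φ ψ (Δ x)) := rfl

variable (str : Lambda p →+* R)

/-- The basis `x ^ i / ((1 - p) w_i)`. -/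
noncomputable def dividedBasis (B : Module.Basis (Fin p) R M) : Module.Basis (Fin p) R M :=
  B.unitsSMul fun i => ((isUnit_dualConst p i.2).map str).unit⁻¹

theorem dividedBasis_apply (B : Module.Basis (Fin p) R M) (i : Fin p) :
    dividedBasis str B i = str (Ring.inverse (dualConst p i)) • B i := by
  rw [dividedBasis, Module.Basis.unitsSMul_apply]
  have h : (((isUnit_dualConst p i.2).map str).unit⁻¹ : Rˣ) =
      str (Ring.inverse (dualConst p i)) := by
    apply ((isUnit_dualConst p i.2).map str).mul_left_cancel
    rw [IsUnit.mul_val_inv, ← map_mul,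
      Ring.mul_inverse_cancel _ (isUnit_dualConst p i.2), map_one]
  rw [Units.smul_def, h]

/-- Transpose the formula for the comultiplication: the coefficients of `Δ` on the divided basis are
the structure constants of the convolution product on the dual basis. -/
theorem convMul_dualBasis {x : M} {a b : R} {B : Module.Basis (Fin p) R M}
    (hB : ∀ i, B i = x ^ (i : ℕ)) (hx : x ^ p = algebraMap R M a * x) (hab : a * b = str (w p p))
    {Δ : M →ₐ[R] M ⊗[R] M} (hΔ : Δ x = groupLaw p ((algebraMap R (M ⊗[R] M)).comp str)
      (algebraMap R (M ⊗[R] M) b) (x ⊗ₜ 1) (1 ⊗ₜ x)) (j k : Fin p) :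
    convMul Δ ((dividedBasis str B).dualBasis j) ((dividedBasis str B).dualBasis k) =
      ∑ i : Fin p, structConst p b j k i • (dividedBasis str B).dualBasis i := by
  let : Algebra (Lambda p) (M ⊗[R] M) := ((algebraMap R (M ⊗[R] M)).comp str).toAlgebra
  have halg : algebraMap (Lambda p) (M ⊗[R] M) = (algebraMap R (M ⊗[R] M)).comp str := rfl
  refine (dividedBasis str B).ext fun i => ?_
  have hx1 : (x ⊗ₜ[R] (1 : M)) ^ p = algebraMap R (M ⊗[R] M) a * (x ⊗ₜ[R] (1 : M)) := by
    rw [Algebra.TensorProduct.tmul_pow, hx, one_pow, Algebra.TensorProduct.algebraMap_apply,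
      Algebra.TensorProduct.tmul_mul_tmul, one_mul]
  have hx2 : ((1 : M) ⊗ₜ[R] x) ^ p = algebraMap R (M ⊗[R] M) a * ((1 : M) ⊗ₜ[R] x) := by
    rw [Algebra.TensorProduct.tmul_pow, hx, one_pow, ← Algebra.smul_def, ← Algebra.smul_def,
      TensorProduct.tmul_smul]
  have hsm : ∀ (r : Lambda p) (e : M ⊗[R] M), r • e = str r • e := fun r e => by
    rw [Algebra.smul_def, Algebra.smul_def, halg, RingHom.comp_apply]
  have h := inverse_dualConst_smul_groupLaw_pow p hx1 hx2
    (b := algebraMap R (M ⊗[R] M) b) (by rw [← map_mul, hab]; rfl) i.2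
  rw [halg, ← hΔ, ← map_pow, hsm, ← map_smul, ← hB, ← dividedBasis_apply] at h
  rw [convMul_apply, h]
  have e : ∀ r s : Fin p, Ring.inverse (dualConst p r) • ((x ⊗ₜ[R] (1 : M)) ^ (r : ℕ)) *
      Ring.inverse (dualConst p s) • (((1 : M) ⊗ₜ[R] x) ^ (s : ℕ)) =
        dividedBasis str B r ⊗ₜ[R] dividedBasis str B s := by
    intro r s
    rw [hsm, hsm, Algebra.TensorProduct.tmul_pow, Algebra.TensorProduct.tmul_pow, one_pow, one_pow,
      ← hB, ← hB, TensorProduct.smul_tmul', ← TensorProduct.tmul_smul,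
      Algebra.TensorProduct.tmul_mul_tmul, one_mul, mul_one, ← dividedBasis_apply,
      ← dividedBasis_apply]
  simp only [e, ← map_structConst, ← Algebra.smul_def, map_sum, map_smul, TensorProduct.map_tmul,
    LinearMap.mul'_apply, Module.Basis.dualBasis_apply_self, LinearMap.sum_apply,
    LinearMap.smul_apply, smul_eq_mul]
  simp

/-- A character of order p is a truncated exponential in its eigencomponent: ψ^m = 1 + ∑ (χ(m) v
x)^i / ((1-p) w_i), from the expansion of 1 - ψ^m in the y_i(ψ) and w_i y_i(ψ) = (v x)^i. -/
theorem dualBasis_pow {x ψ : M} {v : R} {B : Module.Basis (Fin p) R M}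
    (hB : ∀ i, B i = x ^ (i : ℕ)) (hψ : ψ ^ p = 1)
    (hv : eigenY p ((algebraMap R M).comp str) ψ = algebraMap R M v * x) (m : ZMod p) (i : Fin p) :
    (dividedBasis str B).dualBasis i (ψ ^ m.val) = (str (chiL p m) * v) ^ (i : ℕ) := by
  have h2 := hp.out.two_le
  have key : ψ ^ m.val = ∑ i : Fin p, (str (chiL p m) * v) ^ (i : ℕ) • dividedBasis str B i := by
    have h := sum_chiL_pow_mul_eigen p ((algebraMap R M).comp str) ψ m
    have hu : IsUnit ((1 : M) - p) := by
      have := ((isUnit_one_sub_prime p).map str).map (algebraMap R M)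
      simpa using this
    have h0 : ∀ i : ℕ, i < p → i ≠ 0 → (1 - (p : M)) * (algebraMap R M ((str (chiL p m) * v) ^ i) *
        (algebraMap R M (str (Ring.inverse (dualConst p i))) * x ^ i)) =
          ((algebraMap R M).comp str) (chiL p m) ^ i * eigen p ((algebraMap R M).comp str) i ψ := by
      intro i hi hi0
      have hw := eigenY_pow p ((algebraMap R M).comp str) hψ hi0
      rw [hv] at hw
      have hd := congrArg ((algebraMap R M).comp str)
        (Ring.mul_inverse_cancel _ (isUnit_dualConst p hi))
      have hdc : dualConst p i = (1 - (p : Lambda p)) * w p i := if_neg hi0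
      rw [map_mul, map_one] at hd
      nth_rw 1 [hdc] at hd
      rw [map_mul, map_sub, map_one, map_natCast] at hd
      rw [mul_pow] at hw
      simp only [RingHom.comp_apply, map_mul, map_pow, mul_pow] at hw hd ⊢
      calc _ = (1 - (p : M)) * algebraMap R M (str (Ring.inverse (dualConst p i))) *
              (algebraMap R M (str (chiL p m)) ^ i * ((algebraMap R M v) ^ i * x ^ i)) := by ring
        _ = ((1 - (p : M)) * (algebraMap R M) (str (w p i)) *
            algebraMap R M (str (Ring.inverse (dualConst p i)))) *
              (algebraMap R M (str (chiL p m)) ^ i * eigen p ((algebraMap R M).comp str) i ψ) := by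
            rw [hw]; ring
        _ = _ := by rw [hd, one_mul]
    apply hu.mul_left_cancel
    have hsum : ∑ i : Fin p, (str (chiL p m) * v) ^ (i : ℕ) • dividedBasis str B i =
        ∑ i ∈ Finset.range p, algebraMap R M ((str (chiL p m) * v) ^ i) *
          (algebraMap R M (str (Ring.inverse (dualConst p i))) * x ^ i) := by
      rw [← Fin.sum_univ_eq_sum_range (fun i => algebraMap R M ((str (chiL p m) * v) ^ i) *
          (algebraMap R M (str (Ring.inverse (dualConst p i))) * x ^ i))]
      exact Finset.sum_congr rfl fun i _ => by
        rw [dividedBasis_apply, hB, Algebra.smul_def, Algebra.smul_def]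
    rw [hsum, Finset.range_eq_Ico, Finset.sum_eq_sum_Ico_succ_bot (by omega), mul_add,
      Finset.mul_sum, Finset.sum_congr rfl fun i hi => h0 i (Finset.mem_Ico.mp hi).2
        (by have := (Finset.mem_Ico.mp hi).1; omega), h]
    simp only [dualConst, if_true, Ring.inverse_one, map_one, pow_zero]
    ring
  rw [key, map_sum, Finset.sum_eq_single i]
  · simp
  · intro j _ hj
    simp [hj]
  · simp

end PowerBasis

/-! ### Base change of the algebra of functions on Z_R. -/

section FunctionsBaseChange

variable {S : Scheme.{u}} (Z : Over S) {R R' : CommRingCat.{u}} (f : Spec R ⟶ S) (ρ : R ⟶ R')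

/-- The projection `Z_{R'} → Z_R`. -/
noncomputable def pullbackProj : pullback Z.hom (Spec.map ρ ≫ f) ⟶ pullback Z.hom f :=
  pullback.lift (pullback.fst _ _) (pullback.snd _ _ ≫ Spec.map ρ)
    (by rw [Category.assoc]; exact pullback.condition)

theorem pullbackProj_fst : pullbackProj Z f ρ ≫ pullback.fst _ _ = pullback.fst _ _ :=
  pullback.lift_fst _ _ _

theorem pullbackProj_snd : pullbackProj Z f ρ ≫ pullback.snd _ _ =
    pullback.snd _ _ ≫ Spec.map ρ :=
  pullback.lift_snd _ _ _

theorem isPullback_pullbackProj : IsPullback (pullbackProj Z f ρ) (pullback.snd Z.hom (Spec.map ρ ≫ f))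
    (pullback.snd Z.hom f) (Spec.map ρ) := by
  refine (IsPullback.of_right (h₁₂ := pullback.fst Z.hom f) (h₂₂ := f) (v₁₃ := Z.hom)
    ?_ (pullbackProj_snd Z f ρ) (IsPullback.of_hasPullback Z.hom f).flip.flip)
  rw [pullbackProj_fst]
  exact IsPullback.of_hasPullback _ _

/-- The pullback of functions along `Z_{R'} → Z_R`. -/
noncomputable def fnMap : Fn Z f →+* Fn Z (Spec.map ρ ≫ f) :=
  (pullbackProj Z f ρ).appTop.hom

theorem fnMap_algebraMap (r : R) :
    fnMap Z f ρ (algebraMap R (Fn Z f) r) = algebraMap R' (Fn Z (Spec.map ρ ≫ f)) (ρ r) := by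
  have h : (Scheme.ΓSpecIso R).inv ≫ (pullback.snd Z.hom f).appTop ≫ (pullbackProj Z f ρ).appTop =
      ρ ≫ (Scheme.ΓSpecIso R').inv ≫ (pullback.snd Z.hom (Spec.map ρ ≫ f)).appTop := by
    rw [← Scheme.Hom.comp_appTop, pullbackProj_snd, Scheme.Hom.comp_appTop,
      Scheme.ΓSpecIso_inv_naturality_assoc]
  exact congr($h r)

/-- Z_{R'} is the fibre product of the affine schemes Z_R and Spec R' over Spec R, and global
sections turn it into a pushout of rings. -/
theorem isPushout_fnMap [IsAffineHom Z.hom] :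
    IsPushout (CommRingCat.ofHom (algebraMap R (Fn Z f))) ρ
      (CommRingCat.ofHom (fnMap Z f ρ)) (CommRingCat.ofHom (algebraMap R' (Fn Z (Spec.map ρ ≫ f)))) := by
  have : IsAffine (pullback Z.hom f) := isAffine_of_isAffineHom (pullback.snd Z.hom f)
  have h := isPushout_appTop_of_isPullback (isPullback_pullbackProj Z f ρ)
  refine h.of_iso (Scheme.ΓSpecIso R) (Iso.refl _) (Scheme.ΓSpecIso R') (Iso.refl _) ?_ ?_ ?_ ?_
  · rw [Iso.refl_hom, Category.comp_id]
    exact (Iso.hom_inv_id_assoc (Scheme.ΓSpecIso R) _).symm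
  · exact (Scheme.ΓSpecIso_naturality ρ)
  · rw [Iso.refl_hom, Category.comp_id, Iso.refl_hom, Category.id_comp]
    rfl
  · rw [Iso.refl_hom, Category.comp_id]
    exact (Iso.hom_inv_id_assoc (Scheme.ΓSpecIso R') _).symm

end FunctionsBaseChange

section FunctionsBaseChange

variable {S : Scheme.{u}} (Z : Over S) [IsAffineHom Z.hom] {R R' : CommRingCat.{u}}
  (f : Spec R ⟶ S) (ρ : R ⟶ R') [Algebra R R']

theorem exists_fnBaseChange (hρ : algebraMap R R' = ρ.hom) :
    ∃ e : R' ⊗[R] Fn Z f ≃ₐ[R'] Fn Z (Spec.map ρ ≫ f), ∀ x, e (1 ⊗ₜ x) = fnMap Z f ρ x := by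
  obtain rfl : ρ = CommRingCat.ofHom (algebraMap R R') := by rw [hρ]; rfl
  have h1 := CommRingCat.isPushout_tensorProduct R R' (Fn Z f)
  have h2 := (isPushout_fnMap Z f (CommRingCat.ofHom (algebraMap R R'))).flip
  let e0 : R' ⊗[R] Fn Z f ≃+* Fn Z (Spec.map (CommRingCat.ofHom (algebraMap R R')) ≫ f) :=
    (h1.isoIsPushout _ _ h2).commRingCatIsoToRingEquiv
  have hl : ∀ r : R', e0 (r ⊗ₜ 1) = algebraMap R' _ r := fun r =>
    congr($(h1.inl_isoIsPushout_hom _ _ h2) r)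
  have hr : ∀ x, e0 (1 ⊗ₜ x) = fnMap Z f _ x := fun r =>
    congr($(h1.inr_isoIsPushout_hom _ _ h2) r)
  exact ⟨AlgEquiv.ofRingEquiv (f := e0) hl, hr⟩

end FunctionsBaseChange

/-! ### Compatibility of points, products and comultiplication with base change. -/

section Points

variable {S : Scheme.{u}} {Z : Over S} {R R' : CommRingCat.{u}} {f : Spec R ⟶ S} (ρ : R ⟶ R')

theorem evalSection_algebraMap (x : Over.mk (𝟙 S) ⟶ Z) (f : Spec R ⟶ S) (r : R) :
    evalSection x f (algebraMap R (Fn Z f) r) = r := by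
  have h : (Scheme.ΓSpecIso R).inv ≫ (pullback.snd Z.hom f).appTop ≫
      (pullback.lift (f ≫ x.left) (𝟙 (Spec R)) (by simp) : Spec R ⟶ pullback Z.hom f).appTop ≫
        (Scheme.ΓSpecIso R).hom = 𝟙 R := by
    rw [← Scheme.Hom.comp_appTop_assoc, pullback.lift_snd, Scheme.Hom.id_appTop, Category.id_comp,
      Iso.inv_hom_id]
  exact congr($h r)

theorem evalSection_fnMap (x : Over.mk (𝟙 S) ⟶ Z) (f : Spec R ⟶ S) (h : Fn Z f) :
    evalSection x (Spec.map ρ ≫ f) (fnMap Z f ρ h) = ρ (evalSection x f h) := by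
  have e : (pullback.lift ((Spec.map ρ ≫ f) ≫ x.left) (𝟙 (Spec R')) (by simp) :
      Spec R' ⟶ pullback Z.hom (Spec.map ρ ≫ f)) ≫ pullbackProj Z f ρ =
      Spec.map ρ ≫ (pullback.lift (f ≫ x.left) (𝟙 (Spec R)) (by simp) : Spec R ⟶ pullback Z.hom f) := by
    apply pullback.hom_ext
    · rw [Category.assoc, pullbackProj_fst, pullback.lift_fst, Category.assoc, Category.assoc,
        pullback.lift_fst]
    · rw [Category.assoc, pullbackProj_snd, pullback.lift_snd_assoc, Category.assoc,
        pullback.lift_snd, Category.id_comp, Category.comp_id]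
  have h' : (pullbackProj Z f ρ).appTop ≫ (pullback.lift ((Spec.map ρ ≫ f) ≫ x.left) (𝟙 (Spec R'))
      (by simp) : Spec R' ⟶ pullback Z.hom (Spec.map ρ ≫ f)).appTop ≫ (Scheme.ΓSpecIso R').hom =
      (pullback.lift (f ≫ x.left) (𝟙 (Spec R)) (by simp) : Spec R ⟶ pullback Z.hom f).appTop ≫
        (Scheme.ΓSpecIso R).hom ≫ ρ := by
    rw [← Scheme.Hom.comp_appTop_assoc, e, Scheme.Hom.comp_appTop, Category.assoc,
      Scheme.ΓSpecIso_naturality]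
  exact congr($h' h)

section

variable {B B' : Type u} [CommRing B] [CommRing B'] [Algebra R B] [Algebra R' B'] (β : B →+* B')
  (hβ : ∀ r, β (algebraMap R B r) = algebraMap R' B' (ρ r))

/-- The morphism of `S`-schemes `Spec B' → Spec B` over `Spec R' → Spec R`. -/
noncomputable def specOver (f : Spec R ⟶ S) (hβ : ∀ r, β (algebraMap R B r) = algebraMap R' B' (ρ r)) :
    Over.mk (Spec.map (CommRingCat.ofHom (algebraMap R' B')) ≫ Spec.map ρ ≫ f) ⟶
      Over.mk (Spec.map (CommRingCat.ofHom (algebraMap R B)) ≫ f) :=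
  Over.homMk (Spec.map (CommRingCat.ofHom β)) (by
    have h : CommRingCat.ofHom (algebraMap R B) ≫ CommRingCat.ofHom β =
        ρ ≫ CommRingCat.ofHom (algebraMap R' B') := by
      ext r; exact hβ r
    have h' := congrArg Spec.map h
    rw [Spec.map_comp, Spec.map_comp] at h'
    change Spec.map _ ≫ Spec.map _ ≫ f = Spec.map _ ≫ Spec.map ρ ≫ f
    rw [← Category.assoc, h', Category.assoc])

theorem evalPoint_specOver (hβ : ∀ r, β (algebraMap R B r) = algebraMap R' B' (ρ r))
    (g : Over.mk (Spec.map (CommRingCat.ofHom (algebraMap R B)) ≫ f) ⟶ Z) (h : Fn Z f) :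
    evalPoint B' (specOver ρ β f hβ ≫ g) (fnMap Z f ρ h) = β (evalPoint B g h) := by
  have e : (pullback.lift (specOver ρ β f hβ ≫ g).left (Spec.map (CommRingCat.ofHom (algebraMap R' B')))
      (Over.w (specOver ρ β f hβ ≫ g)) : Spec (.of B') ⟶ pullback Z.hom (Spec.map ρ ≫ f)) ≫
        pullbackProj Z f ρ = Spec.map (CommRingCat.ofHom β) ≫
      (pullback.lift g.left (Spec.map (CommRingCat.ofHom (algebraMap R B))) (Over.w g) :
        Spec (.of B) ⟶ pullback Z.hom f) := by
    apply pullback.hom_ext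
    · rw [Category.assoc, pullbackProj_fst, pullback.lift_fst, Category.assoc, pullback.lift_fst]
      rfl
    · rw [Category.assoc, pullbackProj_snd, pullback.lift_snd_assoc, Category.assoc,
        pullback.lift_snd, ← Spec.map_comp]
      refine Eq.trans ?_ (Spec.map_comp _ _)
      congr 1
      ext r
      exact (hβ r).symm
  have h' : (pullbackProj Z f ρ).appTop ≫ (pullback.lift (specOver ρ β f hβ ≫ g).left
      (Spec.map (CommRingCat.ofHom (algebraMap R' B')))
      (Over.w (specOver ρ β f hβ ≫ g)) : Spec (.of B') ⟶ pullback Z.hom (Spec.map ρ ≫ f)).appTop ≫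
        (Scheme.ΓSpecIso (.of B')).hom =
      (pullback.lift g.left (Spec.map (CommRingCat.ofHom (algebraMap R B))) (Over.w g) :
        Spec (.of B) ⟶ pullback Z.hom f).appTop ≫ (Scheme.ΓSpecIso (.of B)).hom ≫ CommRingCat.ofHom β := by
    rw [← Scheme.Hom.comp_appTop_assoc, e, Scheme.Hom.comp_appTop, Category.assoc,
      Scheme.ΓSpecIso_naturality]
  exact congr($h' h)

theorem specOver_pointOf [IsAffineHom Z.hom] (hβ : ∀ r, β (algebraMap R B r) = algebraMap R' B' (ρ r))
    (θ : Fn Z f →ₐ[R] B) (θ' : Fn Z (Spec.map ρ ≫ f) →ₐ[R'] B')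
    (h : ∀ x, θ' (fnMap Z f ρ x) = β (θ x)) : specOver ρ β f hβ ≫ pointOf θ = pointOf θ' := by
  have h1 : IsAffine (pullback Z.hom f) := isAffine_of_isAffineHom (pullback.snd Z.hom f)
  have h2 : IsAffine (pullback Z.hom (Spec.map ρ ≫ f)) :=
    isAffine_of_isAffineHom (pullback.snd Z.hom (Spec.map ρ ≫ f))
  apply Over.OverMorphism.ext
  have e : (CommRingCat.ofHom (θ : Fn Z f →+* B) : Γ(pullback Z.hom f, ⊤) ⟶ CommRingCat.of B) ≫
      CommRingCat.ofHom β = (pullbackProj Z f ρ).appTop ≫ (CommRingCat.ofHom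
        (θ' : Fn Z (Spec.map ρ ≫ f) →+* B') : Γ(pullback Z.hom (Spec.map ρ ≫ f), ⊤) ⟶ CommRingCat.of B') := by
    ext x
    exact (h x).symm
  change Spec.map (CommRingCat.ofHom β) ≫ Spec.map _ ≫ (pullback Z.hom f).isoSpec.inv ≫ pullback.fst Z.hom f =
    Spec.map _ ≫ (pullback Z.hom (Spec.map ρ ≫ f)).isoSpec.inv ≫ pullback.fst Z.hom (Spec.map ρ ≫ f)
  rw [← Category.assoc, ← Spec.map_comp, e, Spec.map_comp, Category.assoc,
    Scheme.isoSpec_inv_naturality_assoc, pullbackProj_fst]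

open scoped MonObj in
-- The product of points is natural in the test scheme: pull both factors back along Spec B' → Spec
-- B.
theorem evalPoint_mul_fnMap {G : Over S} [GrpObj G] [IsAffineHom G.hom] (f : Spec R ⟶ S)
    (hβ : ∀ r, β (algebraMap R B r) = algebraMap R' B' (ρ r))
    {θ₁ θ₂ : Fn G f →ₐ[R] B} {θ₁' θ₂' : Fn G (Spec.map ρ ≫ f) →ₐ[R'] B'}
    (h₁ : ∀ x, θ₁' (fnMap G f ρ x) = β (θ₁ x)) (h₂ : ∀ x, θ₂' (fnMap G f ρ x) = β (θ₂ x))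
    (h : Fn G f) :
    evalPoint B' (pointOf θ₁' * pointOf θ₂') (fnMap G f ρ h) =
      β (evalPoint B (pointOf θ₁ * pointOf θ₂) h) := by
  rw [← evalPoint_specOver ρ β hβ, MonObj.comp_mul, specOver_pointOf ρ β hβ _ _ h₁,
    specOver_pointOf ρ β hβ _ _ h₂]

end

/-- The comultiplication commutes with base change. -/
theorem comul_fnMap {G : Over S} [GrpObj G] [IsAffineHom G.hom] (f : Spec R ⟶ S)
    (β : Fn G f ⊗[R] Fn G f →+* Fn G (Spec.map ρ ≫ f) ⊗[R'] Fn G (Spec.map ρ ≫ f))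
    (hβ : ∀ x y, β (x ⊗ₜ y) = fnMap G f ρ x ⊗ₜ fnMap G f ρ y) (h : Fn G f) :
    comul G (Spec.map ρ ≫ f) (fnMap G f ρ h) = β (comul G f h) := by
  have hβ' : ∀ r, β (algebraMap R _ r) = algebraMap R' _ (ρ r) := by
    intro r
    rw [Algebra.TensorProduct.algebraMap_apply, hβ, fnMap_algebraMap, map_one,
      Algebra.TensorProduct.algebraMap_apply]
  refine evalPoint_mul_fnMap ρ β f hβ' (fun x => ?_) (fun x => ?_) h
  · rw [Algebra.TensorProduct.includeLeft_apply, Algebra.TensorProduct.includeLeft_apply, hβ, map_one]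
  · rw [Algebra.TensorProduct.includeRight_apply, Algebra.TensorProduct.includeRight_apply, hβ, map_one]

end Points

/-! ### Functions on opens of `S` and `Z` pulled back to charts Spec R → S. -/

section AppLE

variable {X Y Z : Scheme.{u}}

theorem appLE_comp_appTop (g : X ⟶ Y) (f : Y ⟶ Z) {U : Z.Opens} (h : ⊤ ≤ f ⁻¹ᵁ U)
    {k : X ⟶ Z} (hk : g ≫ f = k) (h' : ⊤ ≤ k ⁻¹ᵁ U) :
    f.appLE U ⊤ h ≫ g.appTop = k.appLE U ⊤ h' := by
  subst hk
  have e : g.appTop = g.appLE ⊤ ⊤ (by exact le_top) := g.app_eq_appLE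
  rw [e]
  exact Scheme.Hom.appLE_comp_appLE ..

theorem app_comp_appLE (g : X ⟶ Y) (f : Y ⟶ Z) (U : Z.Opens) {W : X.Opens} (h : W ≤ g ⁻¹ᵁ (f ⁻¹ᵁ U))
    {k : X ⟶ Z} (hk : g ≫ f = k) (h' : W ≤ k ⁻¹ᵁ U) :
    f.app U ≫ g.appLE (f ⁻¹ᵁ U) W h = k.appLE U W h' := by
  subst hk
  rw [f.app_eq_appLE]
  exact Scheme.Hom.appLE_comp_appLE ..

theorem appLE_comp_appLE' (g : X ⟶ Y) (f : Y ⟶ Z) {U : Z.Opens} {V : Y.Opens} {W : X.Opens}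
    (h : V ≤ f ⁻¹ᵁ U) (hW : W ≤ g ⁻¹ᵁ V) {k : X ⟶ Z} (hk : g ≫ f = k) (h' : W ≤ k ⁻¹ᵁ U) :
    f.appLE U V h ≫ g.appLE V W hW = k.appLE U W h' := by
  subst hk
  exact Scheme.Hom.appLE_comp_appLE ..

end AppLE

section Chart

variable {S : Scheme.{u}} {Z : Over S} {R R' : CommRingCat.{u}}

/-- The pullback of functions on `U` along `f : Spec R → S`, for `f` with image in `U`. -/
noncomputable def chartMap (f : Spec R ⟶ S) {U : S.Opens} (hf : ⊤ ≤ f ⁻¹ᵁ U) : Γ(S, U) →+* R :=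
  (Scheme.ΓSpecIso R).hom.hom.comp (f.appLE U ⊤ hf).hom

variable (f : Spec R ⟶ S) (ρ : R ⟶ R') {U : S.Opens} (hf : ⊤ ≤ f ⁻¹ᵁ U)

theorem le_preimage_specMap_comp (hf : ⊤ ≤ f ⁻¹ᵁ U) : ⊤ ≤ (Spec.map ρ ≫ f) ⁻¹ᵁ U := by
  rw [Scheme.Hom.comp_preimage]
  exact (Spec.map ρ).preimage_mono hf

theorem le_preimage_fst (Z : Over S) (hf : ⊤ ≤ f ⁻¹ᵁ U) : ⊤ ≤ pullback.fst Z.hom f ⁻¹ᵁ (Z.hom ⁻¹ᵁ U) := by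
  rw [← Scheme.Hom.comp_preimage, pullback.condition, Scheme.Hom.comp_preimage]
  exact (pullback.snd Z.hom f).preimage_mono hf

/-- The pullback to `Z_R` of functions on the part of `Z` over `U`, for `f : Spec R → S` with image
in `U`. -/
noncomputable def fnRestrict (Z : Over S) (f : Spec R ⟶ S) {U : S.Opens} (hf : ⊤ ≤ f ⁻¹ᵁ U) :
    Γ(Z.left, Z.hom ⁻¹ᵁ U) →+* Fn Z f :=
  ((pullback.fst Z.hom f).appLE (Z.hom ⁻¹ᵁ U) ⊤ (le_preimage_fst f Z hf)).hom

theorem chartMap_specMap_comp (c : Γ(S, U)) :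
    chartMap (Spec.map ρ ≫ f) (le_preimage_specMap_comp f ρ hf) c = ρ (chartMap f hf c) := by
  have h : (Spec.map ρ ≫ f).appLE U ⊤ (le_preimage_specMap_comp f ρ hf) ≫ (Scheme.ΓSpecIso R').hom =
      f.appLE U ⊤ hf ≫ (Scheme.ΓSpecIso R).hom ≫ ρ := by
    rw [← appLE_comp_appTop (Spec.map ρ) f hf rfl, Category.assoc, Scheme.ΓSpecIso_naturality]
  exact congr($h c)

theorem chartMap_res {V : S.Opens} (h : V ≤ U) (hV : ⊤ ≤ f ⁻¹ᵁ V) (c : Γ(S, U)) :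
    chartMap f hV (res h c) = chartMap f (hV.trans (f.preimage_mono h)) c := by
  have e : S.presheaf.map (homOfLE h).op ≫ f.appLE V ⊤ hV =
    f.appLE U ⊤ (hV.trans (f.preimage_mono h)) := Scheme.Hom.map_appLE ..
  exact congrArg (Scheme.ΓSpecIso R).hom congr($e c)

theorem fnRestrict_pull (c : Γ(S, U)) :
    fnRestrict Z f hf (pull Z U c) = algebraMap R (Fn Z f) (chartMap f hf c) := by
  have hk : ⊤ ≤ (pullback.fst Z.hom f ≫ Z.hom) ⁻¹ᵁ U := le_preimage_fst f Z hf
  have h : Z.hom.app U ≫ (pullback.fst Z.hom f).appLE (Z.hom ⁻¹ᵁ U) ⊤ (le_preimage_fst f Z hf) =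
      (f.appLE U ⊤ hf ≫ (Scheme.ΓSpecIso R).hom) ≫
      (Scheme.ΓSpecIso R).inv ≫ (pullback.snd Z.hom f).appTop := by
    rw [app_comp_appLE _ _ _ _ rfl hk, Category.assoc, Iso.hom_inv_id_assoc,
      appLE_comp_appTop _ _ _ pullback.condition.symm hk]
  exact congr($h c)

theorem fnMap_fnRestrict (x : Γ(Z.left, Z.hom ⁻¹ᵁ U)) :
    fnMap Z f ρ (fnRestrict Z f hf x) =
      fnRestrict Z (Spec.map ρ ≫ f) (le_preimage_specMap_comp f ρ hf) x :=
  congr($(appLE_comp_appTop (pullbackProj Z f ρ) (pullback.fst Z.hom f) (le_preimage_fst f Z hf)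
    (pullbackProj_fst Z f ρ) (le_preimage_fst _ Z (le_preimage_specMap_comp f ρ hf))) x)

theorem evalSection_fnRestrict (s : Over.mk (𝟙 S) ⟶ Z) (x : Γ(Z.left, Z.hom ⁻¹ᵁ U)) :
    evalSection s f (fnRestrict Z f hf x) = chartMap f (U := (Over.mk (𝟙 S)).hom ⁻¹ᵁ U) hf (eval s U x) := by
  have hk : (Over.mk (𝟙 S)).hom ⁻¹ᵁ U ≤ s.left ⁻¹ᵁ Z.hom ⁻¹ᵁ U := by
    rw [← Scheme.Hom.comp_preimage, Over.w]
  have hk' : ⊤ ≤ (f ≫ s.left) ⁻¹ᵁ Z.hom ⁻¹ᵁ U := by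
    rw [Scheme.Hom.comp_preimage]
    exact le_trans hf (f.preimage_mono hk)
  have h : (pullback.fst Z.hom f).appLE (Z.hom ⁻¹ᵁ U) ⊤ (le_preimage_fst f Z hf) ≫
      (pullback.lift (f ≫ s.left) (𝟙 (Spec R)) (by simp) : Spec R ⟶ pullback Z.hom f).appTop =
      s.left.appLE (Z.hom ⁻¹ᵁ U) ((Over.mk (𝟙 S)).hom ⁻¹ᵁ U) hk ≫
        f.appLE ((Over.mk (𝟙 S)).hom ⁻¹ᵁ U) ⊤ hf := by
    rw [appLE_comp_appTop _ _ _ (pullback.lift_fst _ _ _) hk']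
    exact (appLE_comp_appLE' f s.left hk hf rfl hk').symm
  exact congrArg (Scheme.ΓSpecIso R).hom congr($h x)

theorem evalPoint_fnRestrict {B : Type u} [CommRing B] [Algebra R B]
    (g : Over.mk (Spec.map (CommRingCat.ofHom (algebraMap R B)) ≫ f) ⟶ Z)
    (x : Γ(Z.left, Z.hom ⁻¹ᵁ U)) :
    evalPoint B g (fnRestrict Z f hf x) = (Scheme.ΓSpecIso (.of B)).hom
      (res (X := Spec (.of B)) (le_preimage_specMap_comp f (CommRingCat.ofHom (algebraMap R B)) hf)
        (eval g U x)) := by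
  have hk : (Over.mk (Spec.map (CommRingCat.ofHom (algebraMap R B)) ≫ f)).hom ⁻¹ᵁ U ≤
      g.left ⁻¹ᵁ Z.hom ⁻¹ᵁ U := by
    rw [← Scheme.Hom.comp_preimage, Over.w]
  have hk' := (le_preimage_specMap_comp f (CommRingCat.ofHom (algebraMap R B)) hf).trans hk
  have h : (pullback.fst Z.hom f).appLE (Z.hom ⁻¹ᵁ U) ⊤ (le_preimage_fst f Z hf) ≫
      (pullback.lift g.left (Spec.map (CommRingCat.ofHom (algebraMap R B)))
      (Over.w g) : Spec (.of B) ⟶ pullback Z.hom f).appTop =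
      g.left.appLE (Z.hom ⁻¹ᵁ U) _ hk ≫ (Spec (.of B)).presheaf.map (homOfLE
          (le_preimage_specMap_comp f (CommRingCat.ofHom (algebraMap R B)) hf)).op := by
    rw [appLE_comp_appTop _ _ _ (pullback.lift_fst _ _ _) hk']
    exact (Scheme.Hom.appLE_map ..).symm
  exact congrArg (Scheme.ΓSpecIso (.of B)).hom congr($h x)

theorem specIso_res_pull {B : Type u} [CommRing B] [Algebra R B] (c : Γ(S, U)) :
    (Scheme.ΓSpecIso (.of B)).hom
      (res (X := Spec (.of B)) (le_preimage_specMap_comp f (CommRingCat.ofHom (algebraMap R B)) hf)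
        (pull (Over.mk (Spec.map (CommRingCat.ofHom (algebraMap R B)) ≫ f)) U c)) =
      algebraMap R B (chartMap f hf c) :=
  chartMap_specMap_comp f (CommRingCat.ofHom (algebraMap R B)) hf c

theorem exists_eq_specMap_comp_fromSpec (hU : IsAffineOpen U) (hf : ⊤ ≤ f ⁻¹ᵁ U) :
    ∃ ρ : Γ(S, U) ⟶ R, f = Spec.map ρ ≫ hU.fromSpec := by
  have hr : Set.range f ⊆ Set.range hU.fromSpec := by
    rw [hU.range_fromSpec]
    rintro _ ⟨x, rfl⟩
    exact hf (Set.mem_univ x)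
  refine ⟨Spec.preimage (IsOpenImmersion.lift hU.fromSpec f hr), ?_⟩
  rw [Spec.map_preimage, IsOpenImmersion.lift_fac]

theorem le_preimage_fromSpec (hU : IsAffineOpen U) : ⊤ ≤ hU.fromSpec ⁻¹ᵁ U := by
  rw [hU.fromSpec_preimage_self]

theorem chartMap_fromSpec (hU : IsAffineOpen U) (c : Γ(S, U)) :
    chartMap hU.fromSpec (le_preimage_fromSpec hU) c = c := by
  have h : hU.fromSpec.appLE U ⊤ (le_preimage_fromSpec hU) ≫ (Scheme.ΓSpecIso Γ(S, U)).hom = 𝟙 _ := by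
    rw [Scheme.Hom.appLE, hU.fromSpec_app_self, Category.assoc, Category.assoc,
      ← Functor.map_comp_assoc]
    exact (congrArg (_ ≫ · ≫ _) (CategoryTheory.Functor.map_id _ _)).trans (by simp)
  exact congr($h c)

/-- The projection from the pullback along U → S is an open immersion with image the preimage of U.
-/
theorem bijective_fnRestrict_fromSpec (hU : IsAffineOpen U) :
    Function.Bijective (fnRestrict Z hU.fromSpec (le_preimage_fromSpec hU)) := by
  have hr : Z.hom ⁻¹ᵁ U = (pullback.fst Z.hom hU.fromSpec).opensRange := by
    rw [Scheme.Hom.opensRange_pullbackFst, hU.opensRange_fromSpec]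
  have : IsIso ((pullback.fst Z.hom hU.fromSpec).appLE (Z.hom ⁻¹ᵁ U) ⊤
      (le_preimage_fst _ Z (le_preimage_fromSpec hU))) := by
    rw [Scheme.Hom.appLE]
    have h1 : IsIso ((pullback.fst Z.hom hU.fromSpec).app (Z.hom ⁻¹ᵁ U)) :=
      Scheme.Hom.isIso_app _ _ hr.le
    have h2 : pullback.fst Z.hom hU.fromSpec ⁻¹ᵁ (Z.hom ⁻¹ᵁ U) = ⊤ :=
      top_le_iff.mp (le_preimage_fst _ Z (le_preimage_fromSpec hU))
    have h3 : IsIso (homOfLE (le_preimage_fst hU.fromSpec Z (le_preimage_fromSpec hU))) :=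
      ⟨homOfLE h2.le, rfl, rfl⟩
    infer_instance
  exact ConcreteCategory.bijective_of_isIso _

end Chart

/-! ### The Tate-Oort coordinate over a chart. -/

section ChartCoordinate

variable {p : ℕ} [Fact p.Prime] {S : Scheme.{u}} {str : Lambda p →+* Γ(S, ⊤)} {L : S.Modules}
  {a : TensorSection L (p - 1)} {b : TensorSection L (1 - p)} {G : Over S} [GrpObj G]
  {R R' : CommRingCat.{u}} (f : Spec R ⟶ S) (ρ : R ⟶ R')

/-- The structure of `Λ`-algebra on `R` given by `f : Spec R → S`. -/
noncomputable def strMap (str : Lambda p →+* Γ(S, ⊤)) (f : Spec R ⟶ S) : Lambda p →+* R :=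
  (chartMap f (U := ⊤) le_rfl).comp str

theorem chartMap_res_str {U : S.Opens} (hf : ⊤ ≤ f ⁻¹ᵁ U) (c : Lambda p) :
    chartMap f hf (res le_top (str c)) = strMap str f c :=
  chartMap_res f le_top hf (str c)

variable {U : S.Opens} {t : Γ(L, U)} (ht : IsFrame L t) (hf : ⊤ ≤ f ⁻¹ᵁ U) (e : IsoTateOort str a b G)

/-- The coordinate function on `G_R`. -/
noncomputable def IsoTateOort.coordFn (e : IsoTateOort str a b G) (f : Spec R ⟶ S) (hf : ⊤ ≤ f ⁻¹ᵁ U)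
    (ht : IsFrame L t) : Fn G f :=
  fnRestrict G f hf (e.coord U t ht)

theorem IsoTateOort.coordFn_pow : e.coordFn f hf ht ^ p =
    algebraMap R (Fn G f) (chartMap f hf (a.coeff U t ht)) * e.coordFn f hf ht := by
  rw [coordFn, ← map_pow, e.coord_pow, map_mul, fnRestrict_pull]

theorem IsoTateOort.fnMap_coordFn : fnMap G f ρ (e.coordFn f hf ht) =
    e.coordFn (Spec.map ρ ≫ f) (le_preimage_specMap_comp f ρ hf) ht :=
  fnMap_fnRestrict f ρ hf _

theorem IsoTateOort.exists_basis_fromSpec (hU : IsAffineOpen U) :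
    ∃ B : Module.Basis (Fin p) Γ(S, U) (Fn G hU.fromSpec),
      ∀ i, B i = e.coordFn hU.fromSpec (le_preimage_fromSpec hU) ht ^ (i : ℕ) := by
  set x := e.coordFn hU.fromSpec (le_preimage_fromSpec hU) ht with hx
  have key : ∀ c : Fin p → Γ(S, U), ∑ i, c i • x ^ (i : ℕ) =
      fnRestrict G hU.fromSpec (le_preimage_fromSpec hU)
        (∑ i : Fin p, pull G U (c i) * e.coord U t ht ^ (i : ℕ)) := by
    intro c
    rw [map_sum]
    refine Finset.sum_congr rfl fun i _ => ?_
    rw [map_mul, map_pow, fnRestrict_pull, chartMap_fromSpec, Algebra.smul_def]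
    rfl
  have hb := bijective_fnRestrict_fromSpec (Z := G) hU
  have hli : LinearIndependent Γ(S, U) (fun i : Fin p => x ^ (i : ℕ)) := by
    rw [Fintype.linearIndependent_iff]
    intro c hc i
    rw [key] at hc
    -- Uniqueness of the expansion of the zero function gives linear independence.
    obtain ⟨c', -, h'⟩ := e.basis U t ht hU 0
    have h1 := h' c (hb.1 (by rw [hc, map_zero])).symm
    have h2 := h' 0 (by simp)
    rw [h1, ← h2]; rfl
  have hsp : ⊤ ≤ Submodule.span Γ(S, U) (Set.range fun i : Fin p => x ^ (i : ℕ)) := by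
    rintro y -
    obtain ⟨y, rfl⟩ := hb.2 y
    obtain ⟨c, h, -⟩ := e.basis U t ht hU y
    rw [h]
    rw [← key]
    exact Submodule.sum_mem _ fun i _ => Submodule.smul_mem _ _ (Submodule.subset_span ⟨i, rfl⟩)
  exact ⟨Module.Basis.mk hli hsp, fun i => Module.Basis.mk_apply hli hsp i⟩

/-- A morphism from Spec R into the affine open U factors through Spec Γ(S, U), so every chart is
reached from the tautological one by this base change. -/
theorem IsoTateOort.exists_basis_specMap [IsAffineHom G.hom] (B : Module.Basis (Fin p) R (Fn G f))
    (hB : ∀ i, B i = e.coordFn f hf ht ^ (i : ℕ)) :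
    ∃ B : Module.Basis (Fin p) R' (Fn G (Spec.map ρ ≫ f)), ∀ i, B i =
      e.coordFn (Spec.map ρ ≫ f) (le_preimage_specMap_comp f ρ hf) ht ^ (i : ℕ) := by
  let := ρ.hom.toAlgebra
  obtain ⟨ε, hε⟩ := exists_fnBaseChange G f ρ rfl
  refine ⟨(B.baseChange R').map ε.toLinearEquiv, fun i => ?_⟩
  rw [Module.Basis.map_apply, Module.Basis.baseChange_apply]
  exact (hε _).trans (by rw [hB, map_pow, fnMap_coordFn])

/-- Over a chart the functions on `G_R` are free on the powers of the coordinate. -/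
theorem IsoTateOort.exists_basis [IsAffineHom G.hom] (hU : IsAffineOpen U) :
    ∃ B : Module.Basis (Fin p) R (Fn G f), ∀ i, B i = e.coordFn f hf ht ^ (i : ℕ) := by
  obtain ⟨ρ, rfl⟩ := exists_eq_specMap_comp_fromSpec f hU hf
  obtain ⟨B, hB⟩ := e.exists_basis_fromSpec ht hU
  exact e.exists_basis_specMap _ ρ ht _ B hB

open scoped MonObj in
theorem IsoTateOort.evalPoint_mul_coordFn {B : Type u} [CommRing B] [Algebra R B]
    (g h : Over.mk (Spec.map (CommRingCat.ofHom (algebraMap R B)) ≫ f) ⟶ G) :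
    evalPoint B (g * h) (e.coordFn f hf ht) = groupLaw p ((algebraMap R B).comp (strMap str f))
      (algebraMap R B (chartMap f hf (b.coeff U t ht)))
      (evalPoint B g (e.coordFn f hf ht)) (evalPoint B h (e.coordFn f hf ht)) := by
  let T := Over.mk (Spec.map (CommRingCat.ofHom (algebraMap R B)) ≫ f)
  let Φ : Γ(T.left, T.hom ⁻¹ᵁ U) →+* B := (Scheme.ΓSpecIso (.of B)).hom.hom.comp
    ((Spec (.of B)).presheaf.map (homOfLE (le_preimage_specMap_comp f
      (CommRingCat.ofHom (algebraMap R B)) hf)).op).hom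
  have hΦ : ∀ k : T ⟶ G, evalPoint B k (e.coordFn f hf ht) = Φ (eval k U (e.coord U t ht)) := fun k =>
    evalPoint_fnRestrict f hf k _
  have hΦ' : ∀ c, Φ (pull T U c) = algebraMap R B (chartMap f hf c) := specIso_res_pull f hf
  have hm : eval (T := T) (g * h) U (e.coord U t ht) = _ := e.coord_mul T g h U t ht
  rw [hΦ, hΦ, hΦ, hm]
  simp only [map_add, map_mul, map_sum, map_pow, hΦ', chartMap_res_str]
  rfl

/-- The group law in terms of the coordinate. -/
theorem IsoTateOort.comul_coordFn [IsAffineHom G.hom] : comul G f (e.coordFn f hf ht) =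
    groupLaw p ((algebraMap R (Fn G f ⊗[R] Fn G f)).comp (strMap str f))
      (algebraMap R (Fn G f ⊗[R] Fn G f) (chartMap f hf (b.coeff U t ht)))
      (e.coordFn f hf ht ⊗ₜ 1) (1 ⊗ₜ e.coordFn f hf ht) := by
  rw [comul, evalPoint_mul_coordFn, evalPoint_pointOf, evalPoint_pointOf]
  rfl

end ChartCoordinate

/-! ### The sections of the constant group and the multiples of a point. -/

section ConstantGroup

/-- Evaluation at `i`, as a homomorphism of algebras. -/
noncomputable def FunAlg.evAlgHom (R : Type u) [CommRing R] (p : ℕ) (i : ZMod p) : FunAlg R p →ₐ[R] R where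
  toRingHom := FunAlg.ev R p i
  commutes' _ := rfl

theorem FunAlg.toConv_evAlgHom_add (R : Type u) [CommRing R] (p : ℕ) [NeZero p] (i j : ZMod p) :
    WithConv.toConv (FunAlg.evAlgHom R p (i + j)) =
      WithConv.toConv (FunAlg.evAlgHom R p i) * WithConv.toConv (FunAlg.evAlgHom R p j) := by
  rw [AlgHom.convMul_def]
  congr 1
  apply AlgHom.toLinearMap_injective
  refine FunAlg.hom_ext fun k => ?_
  have h1 : ∀ i k : ZMod p, FunAlg.evAlgHom R p i (delta R p k) = if i = k then 1 else 0 := fun i k =>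
    delta_apply R p k i
  simp only [AlgHom.toLinearMap_apply, AlgHom.comp_apply, Bialgebra.comulAlgHom_apply, comul_delta,
    map_sum, Algebra.TensorProduct.map_tmul, Algebra.TensorProduct.lmul'_apply_tmul, h1]
  rw [Finset.sum_eq_single i]
  · simp only [if_true, one_mul]
    congr 1
    grind
  · intro l _ hl
    rw [if_neg hl.symm, zero_mul]
  · simp

/-- The point `i` of the constant group `ℤ/p` over `ℤ`. -/
noncomputable def constPoint (p : ℕ) [Fact p.Prime] (i : ZMod p) :
    (Spec (.of (ULift.{u} ℤ))).asOver (Spec (.of (ULift.{u} ℤ))) ⟶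
      (Spec (.of (FunAlg (ULift.{u} ℤ) p))).asOver (Spec (.of (ULift.{u} ℤ))) :=
  Spec.mapMulEquiv (WithConv.toConv (FunAlg.evAlgHom (ULift.{u} ℤ) p i))

open scoped MonObj in
theorem constPoint_add (p : ℕ) [Fact p.Prime] (i j : ZMod p) :
    constPoint.{u} p (i + j) = constPoint p i * constPoint p j := by
  rw [constPoint, FunAlg.toConv_evAlgHom_add, map_mul]
  rfl

/-- The section over `S` of the base change of the final object. -/
noncomputable def unitSection (S : Scheme.{u}) : Over.mk (𝟙 S) ⟶
    (Over.pullback (specULiftZIsTerminal.from S)).obj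
      ((Spec (.of (ULift.{u} ℤ))).asOver (Spec (.of (ULift.{u} ℤ)))) :=
  Over.homMk (pullback.lift (specULiftZIsTerminal.from S) (𝟙 S) (specULiftZIsTerminal.hom_ext _ _))
    (pullback.lift_snd _ _ _)

theorem lift_comp_lift_fst_comp {X Y A B T : Scheme.{u}} {a : A ⟶ X} {b : B ⟶ X} {g : Y ⟶ X}
    (q : A ⟶ B) (s : T ⟶ A) (k : T ⟶ Y) (h : s ≫ a = k ≫ g)
    (h' : (pullback.fst a g ≫ q) ≫ b = pullback.snd a g ≫ g) (h'' : (s ≫ q) ≫ b = k ≫ g) :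
    pullback.lift s k h ≫ pullback.lift (pullback.fst a g ≫ q) (pullback.snd a g) h' =
      pullback.lift (s ≫ q) k h'' := by
  apply pullback.hom_ext
  · rw [Category.assoc, pullback.lift_fst, pullback.lift_fst_assoc, pullback.lift_fst]
  · rw [Category.assoc, pullback.lift_snd, pullback.lift_snd, pullback.lift_snd]

theorem constSection_eq (S : Scheme.{u}) (p : ℕ) [Fact p.Prime] (i : ZMod p) :
    constSection S p i =
      unitSection S ≫ (Over.pullback (specULiftZIsTerminal.from S)).map (constPoint p i) := by
  apply Over.OverMorphism.ext
  exact (lift_comp_lift_fst_comp (constPoint p i).left _ _ _ _ _).symm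

open scoped MonObj Obj in
-- Over ℤ, evaluation at i + j is the convolution of the evaluations at i and j; the base change
-- functor preserves products of points.
theorem constSection_add (S : Scheme.{u}) (p : ℕ) [Fact p.Prime] (i j : ZMod p) :
    constSection S p (i + j) = constSection S p i * constSection S p j := by
  rw [constSection_eq, constSection_eq, constSection_eq, constPoint_add, Functor.map_mul,
    MonObj.comp_mul]
  rfl

end ConstantGroup

/-- The multiples `u, 2 u, …` for the group law of Tate and Oort are the `χ(i) u`. -/
theorem eq_chiL_mul_of_groupLaw {p : ℕ} [Fact p.Prime] {E : Type*} [CommRing E] (str : Lambda p →+* E)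
    {b u : E} (hu : b * u ^ p = str (w p p) * u) (y : ZMod p → E) (h1 : y 1 = u)
    (hy : ∀ i, y (i + 1) = groupLaw p str b (y i) (y 1)) (i : ZMod p) : y i = str (chiL p i) * u := by
  have key : ∀ n : ℕ, y (n + 1 : ℕ) = str (chiL p (n + 1 : ℕ)) * u := by
    intro n
    induction n with
    | zero => simp [h1, chiL_one]
    | succ n ih =>
      rw [Nat.cast_succ (n + 1), hy, ih, h1, groupLaw, chiL_add_one]
      have h2 : ∑ i ∈ Finset.Ico 1 p, str (lawCoeff p i) * (str (chiL p (n + 1 : ℕ)) * u) ^ i * u ^ (p - i) =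
          u ^ p * ∑ i ∈ Finset.Ico 1 p, str (lawCoeff p i) * str (chiL p (n + 1 : ℕ)) ^ i := by
        rw [Finset.mul_sum]
        refine Finset.sum_congr rfl fun i hi => ?_
        have h3 : u ^ p = u ^ i * u ^ (p - i) := by
          rw [← pow_add, Nat.add_sub_cancel' (Finset.mem_Ico.mp hi).2.le]
        rw [mul_pow, h3]
        ring
      rw [h2, ← mul_assoc, hu]
      simp only [map_add, map_mul, map_one, map_sum, map_pow]
      ring
  obtain ⟨n, hn⟩ : ∃ n : ℕ, ((n + 1 : ℕ) : ZMod p) = i := by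
    refine ⟨(i - 1).val, ?_⟩
    rw [Nat.cast_add, ZMod.natCast_zmod_val]
    simp
  rw [← hn]
  exact key n

/-! ### Coordinates of γ(i), and the eigencomponent of κ^*(z). -/

section Values

variable {p : ℕ} [Fact p.Prime] {S : Scheme.{u}} {str : Lambda p →+* Γ(S, ⊤)} {L : S.Modules}
  {a : TensorSection L (p - 1)} {b : TensorSection L (1 - p)} {G : Over S} [GrpObj G]
  {R : CommRingCat.{u}} (f : Spec R ⟶ S)
  {U : S.Opens} {t : Γ(L, U)} (ht : IsFrame L t) (hf : ⊤ ≤ f ⁻¹ᵁ U) (e : IsoTateOort str a b G)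

/-- The section `γ(i)` has the coordinate `χ(i) u`. -/
theorem GivenBySection.evalSection_coordFn {e : IsoTateOort str a b G} {γ : constGroup S p ⟶ G}
    [IsMonHom γ] {u : Γ(L, ⊤)} (h : GivenBySection e γ u)
    (hu : ((TensorSection.ofSection u).pow p).Same ((TensorSection.ofSection u).tmul a))
    (hab : (a.tmul b).Same (TensorSection.const L (str (w p p)))) (i : ZMod p) :
    evalSection (constSection S p i ≫ γ) f (e.coordFn f hf ht) =
      strMap str f (chiL p i) * chartMap f hf ((TensorSection.ofSection u).coeff U t ht) := by
  have hu' : (TensorSection.ofSection u).coeff U t ht ^ p =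
    (TensorSection.ofSection u).coeff U t ht * a.coeff U t ht := hu U t ht
  have hab' : a.coeff U t ht * b.coeff U t ht = res le_top (str (w p p)) := hab U t ht
  set T := Over.mk (𝟙 S)
  set c := (TensorSection.ofSection u).coeff U t ht
  -- The hypothesis on u enters as b u^p = ab u = w_p u.
  have key := eq_chiL_mul_of_groupLaw (((pull T U).comp (S.presheaf.map (homOfLE le_top).op).hom).comp str)
    (b := pull T U (b.coeff U t ht)) (u := pull T U c) (by
      change _ = pull T U (res le_top (str (w p p))) * _
      rw [← map_pow, hu', ← hab', ← map_mul, ← map_mul]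
      congr 1
      ring) (fun i => eval (constSection S p i ≫ γ) U (e.coord U t ht)) (h U t ht) (by
      intro i
      rw [constSection_add, MonObj.mul_comp]
      exact e.coord_mul T _ _ U t ht) i
  rw [IsoTateOort.coordFn, evalSection_fnRestrict]
  refine (congrArg _ key).trans ((map_mul _ _ _).trans ?_)
  have hp : ∀ c, chartMap f (U := T.hom ⁻¹ᵁ U) hf (pull T U c) = chartMap f hf c := fun c => rfl
  congr 1
  refine (hp _).trans ?_
  exact chartMap_res_str f hf _

/-- `κ^*(z)` as a function on `G_R`. -/
noncomputable def muFn (κ : G ⟶ muGroup S p) (f : Spec R ⟶ S) : Fn G f :=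
  (pullback.fst G.hom f).appTop (muPull κ)

theorem muFn_pow_card (κ : G ⟶ muGroup S p) : muFn κ f ^ p = 1 := by
  have hm : ∀ {A A' : CommRingCat.{u}} (g : A ⟶ A') {z : A}, z ^ p = 1 → g z ^ p = 1 :=
    fun g z hz => by rw [← map_pow, hz, map_one]
  have hz : (MonoidAlgebra.single (Multiplicative.ofAdd 1) 1 :
      MonoidAlgebra (ULift.{u} ℤ) (Multiplicative (ZMod p))) ^ p = 1 := by
    rw [MonoidAlgebra.single_pow, one_pow, ← ofAdd_nsmul, nsmul_one, CharP.cast_eq_zero, ofAdd_zero]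
    rfl
  exact hm _ (hm _ (hm _ (hm (A := .of (MonoidAlgebra (ULift.{u} ℤ) (Multiplicative (ZMod p)))) _ hz)))

theorem map_eigenY {A A' : Type*} [CommRing A] [CommRing A'] (g : A →+* A') (str : Lambda p →+* A) (z : A) :
    g (eigenY p str z) = eigenY p (g.comp str) (g z) := by
  simp [eigenY]

/-- The eigencomponent of `κ^*(z)` is the function `v` of `L^{-1}`. -/
theorem GivenByCosection.eigenY_muFn {e : IsoTateOort str a b G} {κ : G ⟶ muGroup S p}
    {v : TensorSection L (-1)} (h : GivenByCosection e κ v) :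
    eigenY p ((algebraMap R (Fn G f)).comp (strMap str f)) (muFn κ f) =
      algebraMap R (Fn G f) (chartMap f hf (v.coeff U t ht)) * e.coordFn f hf ht := by
  have h' := congrArg (fnRestrict G f hf) (h U t ht)
  rw [map_mul, fnRestrict_pull] at h'
  refine Eq.trans ?_ h'
  have hr : ∀ g : Γ(G.left, ⊤), fnRestrict G f hf (res le_top g) = (pullback.fst G.hom f).appTop g := by
    intro g
    have e : G.left.presheaf.map (homOfLE le_top).op ≫
      (pullback.fst G.hom f).appLE (G.hom ⁻¹ᵁ U) ⊤ (le_preimage_fst f G hf) =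
        (pullback.fst G.hom f).appTop := (Scheme.Hom.map_appLE ..).trans
          (Scheme.Hom.app_eq_appLE _).symm
    exact congr($e g)
  rw [hr]
  refine Eq.trans ?_ (map_eigenY (pullback.fst G.hom f).appTop.hom _ _).symm
  congr 1
  ext c
  exact (fnRestrict_pull f (Z := G) (U := ⊤) le_rfl (str c)).symm.trans
    (congr($((Scheme.Hom.app_eq_appLE (pullback.fst G.hom f)).symm) (G.hom.appTop (str c))))

end Values

/-- An element of R is determined by its images in the localisations at all primes, and determinants
on free modules commute with base change. -/
theorem isDet_iff {R : Type*} {M : Type*} [CommRing R] [AddCommGroup M] [Module R M]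
    [Module.Free R M] [Module.Finite R M] (l : M →ₗ[R] M) (n : R) :
    IsDet R l n ↔ LinearMap.det l = n := by
  constructor
  · intro h
    apply PrimeSpectrum.toPiLocalization_injective
    ext q
    have := h q.asIdeal
    rw [LinearMap.det_baseChange] at this
    exact this.symm
  · rintro rfl q hq
    rw [LinearMap.det_baseChange]

/-! ### Both criteria over a chart. -/

section Chart

variable {p : ℕ} [Fact p.Prime] {S : Scheme.{u}} {str : Lambda p →+* Γ(S, ⊤)} {L : S.Modules}
  {a : TensorSection L (p - 1)} {b : TensorSection L (1 - p)} {G : Over S} [GrpObj G]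
  [IsAffineHom G.hom] {R : CommRingCat.{u}} (f : Spec R ⟶ S)
  {U : S.Opens} {t : Γ(L, U)} (ht : IsFrame L t) (hf : ⊤ ≤ f ⁻¹ᵁ U) {e : IsoTateOort str a b G}

theorem GivenBySection.det_mulLeft_iff (hU : IsAffineOpen U) {γ : constGroup S p ⟶ G}
    [IsMonHom γ] {u : Γ(L, ⊤)} (h : GivenBySection e γ u)
    (hu : ((TensorSection.ofSection u).pow p).Same ((TensorSection.ofSection u).tmul a))
    (hab : (a.tmul b).Same (TensorSection.const L (str (w p p)))) :
    (∀ x : Fn G f, LinearMap.det (LinearMap.mulLeft R x) =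
      ∏ i : ZMod p, evalSection (constSection S p i ≫ γ) f x) ↔
    chartMap f hf ((TensorSection.ofSection u).coeff U t ht) ^ (p - 1) =
      chartMap f hf (a.coeff U t ht) := by
  obtain ⟨B, hB⟩ := e.exists_basis f ht hf hU
  have hmul : ∀ j k : Fin p, LinearMap.mul R (Fn G f) (B j) (B k) =
      ∑ i : Fin p, structConst p (chartMap f hf (a.coeff U t ht)) j k i • B i := by
    intro j k
    simp only [hB, LinearMap.mul_apply_apply]
    exact pow_mul_pow_eq_sum_structConst (e.coordFn_pow f ht hf) j k
  let s : ZMod p → Fn G f →ₗ[R] R := fun i =>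
    (AlgHom.mk (evalSection (constSection S p i ≫ γ) f)
      (evalSection_algebraMap (constSection S p i ≫ γ) f) : Fn G f →ₐ[R] R).toLinearMap
  have hs : ∀ m (j : Fin p), s m (B j) = (strMap str f (chiL p m) *
      chartMap f hf ((TensorSection.ofSection u).coeff U t ht)) ^ (j : ℕ) := by
    intro m j
    rw [hB, ← h.evalSection_coordFn f ht hf hu hab]
    exact map_pow (evalSection (constSection S p m ≫ γ) f) _ _
  exact ⟨fun hdet => pow_eq_of_det_eq_prod (strMap str f) B (LinearMap.mul R (Fn G f)) hmul s hs hdet,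
    fun hv => det_eq_prod (strMap str f) B (LinearMap.mul R (Fn G f)) hmul hv s hs⟩

/-- The same norm criterion as for generators, applied to the dual algebra: b replaces a, and
evaluation at the character κ^*(z)^i replaces evaluation at the point γ(i). -/
theorem GivenByCosection.det_dualMulLeft_iff (hU : IsAffineOpen U) {κ : G ⟶ muGroup S p}
    {v : TensorSection L (-1)} (h : GivenByCosection e κ v)
    (hab : (a.tmul b).Same (TensorSection.const L (str (w p p)))) :
    (∀ φ : Module.Dual R (Fn G f), LinearMap.det (dualMulLeft G f φ) =
      ∏ i : ZMod p, φ (muFn κ f ^ i.val)) ↔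
    chartMap f hf (v.coeff U t ht) ^ (p - 1) = chartMap f hf (b.coeff U t ht) := by
  obtain ⟨B, hB⟩ := e.exists_basis f ht hf hU
  have hab' : chartMap f hf (a.coeff U t ht) * chartMap f hf (b.coeff U t ht) =
      strMap str f (w p p) := by
    rw [← map_mul, ← chartMap_res_str f hf]
    exact congrArg _ (hab U t ht)
  have hmul := convMul_dualBasis (strMap str f) hB (e.coordFn_pow f ht hf) hab'
    (e.comul_coordFn f ht hf)
  have hs := dualBasis_pow (strMap str f) hB (muFn_pow_card f κ) (h.eigenY_muFn f ht hf)
  let s : ZMod p → Module.Dual R (Fn G f) →ₗ[R] R := fun i => Module.Dual.eval R _ (muFn κ f ^ i.val)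
  exact ⟨fun hdet => pow_eq_of_det_eq_prod (strMap str f) _ (convMul (comul G f)) hmul s hs hdet,
    fun hv => det_eq_prod (strMap str f) _ (convMul (comul G f)) hmul hv s hs⟩

end Chart

/-- The dual of a finitely presented module commutes with flat base change. -/
theorem exists_dualBaseChange {R A M M' : Type*} [CommRing R] [CommRing A] [Algebra R A]
    [Module.Flat R A] [AddCommGroup M] [Module R M] [Module.FinitePresentation R M]
    [AddCommGroup M'] [Module A M'] (e : A ⊗[R] M ≃ₗ[A] M') :
    ∃ E : A ⊗[R] Module.Dual R M ≃ₗ[A] Module.Dual A M',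
      ∀ φ x, E (1 ⊗ₜ φ) (e (1 ⊗ₜ x)) = algebraMap R A (φ x) := by
  have h : IsBaseChange A (LinearMap.baseChangeHom R A M R) :=
    Module.FinitePresentation.isBaseChange_map R M R A
  refine ⟨h.equiv.trans (e.arrowCongr (AlgebraTensorModule.rid R A A)), fun φ x => ?_⟩
  simp [Algebra.algebraMap_eq_smul_one]

/-! ### Frames near a prime, and localisation of functions and norms. -/

section Localization

variable {S : Scheme.{u}} {L : S.Modules} {R : CommRingCat.{u}} (f : Spec R ⟶ S)

/-- One r serves both for R[1/r], used for finite presentation, and for the local ring at the prime,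
used for determinants. -/
theorem exists_frame_away (hL : IsInvertibleSheaf L) (x : PrimeSpectrum R) : ∃ r ∉ x.asIdeal,
    ∃ (U : S.Opens) (t : Γ(L, U)), IsAffineOpen U ∧ IsFrame L t ∧
      ∀ {R' : CommRingCat.{u}} (ρ : R ⟶ R'), IsUnit (ρ r) → ⊤ ≤ (Spec.map ρ ≫ f) ⁻¹ᵁ U := by
  obtain ⟨U, hxU, t, ht⟩ := hL (f x)
  obtain ⟨W, hW, hxW, hWU⟩ := exists_isAffineOpen_mem_and_subset hxU
  obtain ⟨_, ⟨r, rfl⟩, hr, hrW⟩ :=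
    PrimeSpectrum.isTopologicalBasis_basic_opens.exists_subset_of_mem_open
      (show x ∈ ((f ⁻¹ᵁ W : (Spec R).Opens) : Set (Spec R)) from hxW) (f ⁻¹ᵁ W).2
  refine ⟨r, hr, W, resM L hWU t, hW, ht.res hWU, fun ρ hρ y _ => hrW ?_⟩
  intro hy
  exact y.2.ne_top (Ideal.eq_top_of_isUnit_mem _ hy hρ)

variable {p : ℕ} [Fact p.Prime] {str : Lambda p →+* Γ(S, ⊤)}
  {a : TensorSection L (p - 1)} {b : TensorSection L (1 - p)} {G : Over S} [GrpObj G]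
  [IsAffineHom G.hom]

theorem IsoTateOort.finitePresentation_tensor_fn (e : IsoTateOort str a b G) {R' : CommRingCat.{u}}
    [Algebra R R'] (ρ : R ⟶ R') (hρ : algebraMap R R' = ρ.hom) {U : S.Opens} {t : Γ(L, U)}
    (hU : IsAffineOpen U) (ht : IsFrame L t) (hf : ⊤ ≤ (Spec.map ρ ≫ f) ⁻¹ᵁ U) :
    Module.FinitePresentation R' (R' ⊗[R] Fn G f) := by
  obtain ⟨B, -⟩ := e.exists_basis (Spec.map ρ ≫ f) ht hf hU
  obtain ⟨ε, -⟩ := exists_fnBaseChange G f ρ hρ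
  exact Module.FinitePresentation.of_equiv (B.equivFun.symm.trans ε.toLinearEquiv.symm)

/-- Over an arbitrary Spec R the functions need not be free, but they are so after inverting
suitable elements generating the unit ideal. Finite presentation is what lets the dual commute with
flat base change. -/
theorem IsoTateOort.finitePresentation_fn (e : IsoTateOort str a b G) (hL : IsInvertibleSheaf L) :
    Module.FinitePresentation R (Fn G f) := by
  have hs : Ideal.span {r : R | Module.FinitePresentation (Localization.Away r)
      (LocalizedModule.Away r (Fn G f))} = ⊤ := by
    by_contra hne
    obtain ⟨m, hm, hle⟩ := Ideal.exists_le_maximal _ hne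
    obtain ⟨r, hr, U, t, hU, ht, h⟩ := exists_frame_away f hL ⟨m, hm.isPrime⟩
    refine hr (hle (Ideal.subset_span ?_))
    let ρ : R ⟶ .of (Localization.Away r) := CommRingCat.ofHom (algebraMap R (Localization.Away r))
    have hf := h ρ (IsLocalization.Away.algebraMap_isUnit r)
    have : Module.FinitePresentation (Localization.Away r) (Localization.Away r ⊗[R] Fn G f) :=
      e.finitePresentation_tensor_fn (R' := .of (Localization.Away r)) f ρ rfl hU ht hf
    exact Module.FinitePresentation.of_equiv
      (LocalizedModule.equivTensorProduct (Submonoid.powers r) (Fn G f)).symm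
  exact Module.FinitePresentation.of_localizationSpan _ hs fun g => g.2

/-- The determinant of multiplication commutes with base change. -/
theorem det_mulLeft_fnMap {R' : CommRingCat.{u}} [Algebra R R'] (ρ : R ⟶ R') (hρ : algebraMap R R' = ρ.hom)
    (x : Fn G f) : LinearMap.det ((LinearMap.mulLeft R x).baseChange R') =
      LinearMap.det (LinearMap.mulLeft R' (fnMap G f ρ x)) := by
  obtain ⟨ε, hε⟩ := exists_fnBaseChange G f ρ hρ
  rw [← LinearMap.det_conj _ ε.toLinearEquiv]
  congr 1
  ext y
  obtain ⟨y, rfl⟩ := ε.surjective y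
  induction y with
  | zero => simp
  | add y z hy hz => rw [map_add, map_add, hy, hz, map_add]
  | tmul r y =>
    have h1 : r ⊗ₜ[R] y = r • ((1 : R') ⊗ₜ[R] y) := by rw [TensorProduct.smul_tmul', smul_eq_mul, mul_one]
    rw [h1, map_smul, map_smul, map_smul]
    congr 1
    change ε ((LinearMap.mulLeft R x).baseChange R' (ε.symm (ε (1 ⊗ₜ y)))) = fnMap G f ρ x * ε (1 ⊗ₜ y)
    rw [ε.symm_apply_apply, LinearMap.baseChange_tmul, hε, hε, ← map_mul]
    rfl

end Localization

/-- The homomorphism of tensor squares induced by a homomorphism over a change of the base. -/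
theorem exists_tensorSquareMap {R R' M M' : Type*} [CommRing R] [CommRing R'] [CommRing M] [CommRing M']
    [Algebra R M] [Algebra R' M'] (ρ : R →+* R') (g : M →+* M')
    (hg : ∀ r, g (algebraMap R M r) = algebraMap R' M' (ρ r)) :
    ∃ β : M ⊗[R] M →+* M' ⊗[R'] M', ∀ x y, β (x ⊗ₜ y) = g x ⊗ₜ g y := by
  let : Algebra R (M' ⊗[R'] M') := ((algebraMap R' (M' ⊗[R'] M')).comp ρ).toAlgebra
  let i₁ : M →ₐ[R] M' ⊗[R'] M' :=
    { (Algebra.TensorProduct.includeLeftRingHom : M' →+* M' ⊗[R'] M').comp g with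
      commutes' := fun r => by
        change g (algebraMap R M r) ⊗ₜ[R'] (1 : M') = algebraMap R' (M' ⊗[R'] M') (ρ r)
        rw [hg, Algebra.TensorProduct.algebraMap_apply] }
  let i₂ : M →ₐ[R] M' ⊗[R'] M' :=
    { ((Algebra.TensorProduct.includeRight : M' →ₐ[R'] M' ⊗[R'] M') : M' →+* M' ⊗[R'] M').comp g with
      commutes' := fun r => by
        change (1 : M') ⊗ₜ[R'] g (algebraMap R M r) = algebraMap R' (M' ⊗[R'] M') (ρ r)
        rw [hg, Algebra.TensorProduct.algebraMap_apply'] }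
  refine ⟨(Algebra.TensorProduct.productMap i₁ i₂ : M ⊗[R] M →+* M' ⊗[R'] M'), fun x y => ?_⟩
  change i₁ x * i₂ y = _
  change (g x ⊗ₜ[R'] (1 : M')) * ((1 : M') ⊗ₜ[R'] g y) = _
  rw [Algebra.TensorProduct.tmul_mul_tmul, mul_one, one_mul]

theorem mul'_map_tensorSquareMap {R R' M M' : Type*} [CommRing R] [CommRing R'] [CommRing M] [CommRing M']
    [Algebra R M] [Algebra R' M'] {ρ : R →+* R'} {g : M →+* M'}
    {β : M ⊗[R] M →+* M' ⊗[R'] M'} (hβ : ∀ x y, β (x ⊗ₜ y) = g x ⊗ₜ g y)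
    {φ ψ : Module.Dual R M} {φ' ψ' : Module.Dual R' M'} (hφ : ∀ x, φ' (g x) = ρ (φ x))
    (hψ : ∀ x, ψ' (g x) = ρ (ψ x)) (z : M ⊗[R] M) :
    LinearMap.mul' R' R' (TensorProduct.map φ' ψ' (β z)) =
      ρ (LinearMap.mul' R R (TensorProduct.map φ ψ z)) := by
  induction z with
  | zero => simp
  | add y z hy hz => simp only [map_add, hy, hz]
  | tmul x y =>
    rw [hβ, TensorProduct.map_tmul, TensorProduct.map_tmul, LinearMap.mul'_apply, LinearMap.mul'_apply,
      hφ, hψ, map_mul]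

/-! ### Localisation of the dual algebra. -/

section Dual

variable {S : Scheme.{u}} {R R' : CommRingCat.{u}} [Algebra R R'] (f : Spec R ⟶ S) (ρ : R ⟶ R')
  {G : Over S} [GrpObj G] [IsAffineHom G.hom]

/-- The determinant of multiplication in the dual algebra commutes with flat base change. -/
theorem exists_det_dualMulLeft_eq (hρ : algebraMap R R' = ρ.hom) [Module.Flat R R']
    [Module.FinitePresentation R (Fn G f)] (φ : Module.Dual R (Fn G f)) :
    ∃ φ' : Module.Dual R' (Fn G (Spec.map ρ ≫ f)), (∀ x, φ' (fnMap G f ρ x) = ρ (φ x)) ∧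
      LinearMap.det ((dualMulLeft G f φ).baseChange R') =
        LinearMap.det (dualMulLeft G (Spec.map ρ ≫ f) φ') := by
  obtain ⟨ε, hε⟩ := exists_fnBaseChange G f ρ hρ
  obtain ⟨E, hE⟩ := exists_dualBaseChange ε.toLinearEquiv
  have hE' : ∀ φ x, E (1 ⊗ₜ φ) (fnMap G f ρ x) = ρ (φ x) := by
    intro φ x
    have := hE φ x
    rw [hρ] at this
    rw [← hε]
    exact this
  obtain ⟨β, hβ⟩ := exists_tensorSquareMap ρ.hom (fnMap G f ρ) (fnMap_algebraMap G f ρ)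
  refine ⟨E (1 ⊗ₜ φ), hE' φ, ?_⟩
  rw [← LinearMap.det_conj _ E]
  congr 1
  -- The isomorphism `E` respects convolution because the comultiplication commutes with base
  -- change; it suffices to test on functions coming from G_R.
  have key : ∀ ψ : Module.Dual R (Fn G f), E (1 ⊗ₜ dualMulLeft G f φ ψ) =
      dualMulLeft G (Spec.map ρ ≫ f) (E (1 ⊗ₜ φ)) (E (1 ⊗ₜ ψ)) := by
    intro ψ
    refine LinearMap.ext fun y => ?_
    obtain ⟨y, rfl⟩ := ε.surjective y
    induction y with
    | zero => rw [map_zero, map_zero, map_zero]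
    | add y z hy hz => rw [map_add, map_add, map_add, hy, hz]
    | tmul r y =>
      have h1 : r ⊗ₜ[R] y = r • ((1 : R') ⊗ₜ[R] y) := by
        rw [TensorProduct.smul_tmul', smul_eq_mul, mul_one]
      rw [h1, map_smul, map_smul, map_smul]
      congr 1
      rw [hε, hE']
      have h2 := mul'_map_tensorSquareMap hβ (hE' φ) (hE' ψ) (comul G f y)
      rw [← comul_fnMap ρ f β hβ] at h2
      exact h2.symm
  refine LinearMap.ext fun y => ?_
  obtain ⟨y, rfl⟩ := E.surjective y
  rw [LinearMap.comp_apply, LinearMap.comp_apply, LinearEquiv.coe_coe, LinearEquiv.coe_coe,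
    E.symm_apply_apply]
  induction y with
  | zero => rw [map_zero, map_zero, map_zero]
  | add y z hy hz => rw [map_add, map_add, map_add, map_add, hy, hz]
  | tmul r y =>
    have h1 : r ⊗ₜ[R] y = r • ((1 : R') ⊗ₜ[R] y) := by
      rw [TensorProduct.smul_tmul', smul_eq_mul, mul_one]
    rw [h1, map_smul, map_smul, map_smul, map_smul, LinearMap.baseChange_tmul, key]

end Dual

/-! ### From charts to `S`. -/

section Main

variable {p : ℕ} [Fact p.Prime] {S : Scheme.{u}} {str : Lambda p →+* Γ(S, ⊤)} {L : S.Modules}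
  {a : TensorSection L (p - 1)} {b : TensorSection L (1 - p)} {G : Over S} [GrpObj G]
  [IsAffineHom G.hom] {e : IsoTateOort str a b G}

/-- Two sections of tensor powers of `L` coincide if their coordinates do over affine opens. -/
theorem TensorSection.same_of_isAffineOpen {m n : ℤ} {x : TensorSection L m} {y : TensorSection L n}
    (h : ∀ (U : S.Opens) (t : Γ(L, U)) (ht : IsFrame L t), IsAffineOpen U →
      x.coeff U t ht = y.coeff U t ht) : x.Same y := by
  intro U t ht
  refine S.sheaf.eq_of_locally_eq' (fun V : {V : S.affineOpens // V.1 ≤ U} => V.1.1) U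
    (fun V => homOfLE V.2) (fun s hs => ?_) _ _ fun V => ?_
  · obtain ⟨W, hW, hsW, hWU⟩ := exists_isAffineOpen_mem_and_subset hs
    exact TopologicalSpace.Opens.mem_iSup.mpr ⟨⟨⟨W, hW⟩, hWU⟩, hsW⟩
  · have := h V.1.1 _ (ht.res V.2) V.1.2
    rwa [x.coeff_res, y.coeff_res] at this

/-- Necessity is tested on U → S for affine U with a frame, where the functions are free and the
base ring is Γ(S, U) itself. For sufficiency, each prime of R has a local ring whose spectrum maps
into such a U. -/
theorem GivenBySection.isGenerator_iff {γ : constGroup S p ⟶ G} [IsMonHom γ] {u : Γ(L, ⊤)}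
    (h : GivenBySection e γ u) (hL : IsInvertibleSheaf L)
    (hu : ((TensorSection.ofSection u).pow p).Same ((TensorSection.ofSection u).tmul a))
    (hab : (a.tmul b).Same (TensorSection.const L (str (w p p)))) :
    IsGenerator γ ↔ ((TensorSection.ofSection u).pow (p - 1)).Same a := by
  constructor
  · intro hγ
    refine TensorSection.same_of_isAffineOpen fun U t ht hU => ?_
    have hf := le_preimage_fromSpec hU
    obtain ⟨B, -⟩ := e.exists_basis hU.fromSpec ht hf hU
    have := Module.Free.of_basis B
    have := Module.Finite.of_basis B
    have key := (h.det_mulLeft_iff hU.fromSpec ht hf hU hu hab).mp fun x =>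
      (isDet_iff _ _).mp (hγ _ hU.fromSpec x)
    rwa [chartMap_fromSpec, chartMap_fromSpec] at key
  · intro hs R f x q hq
    obtain ⟨r, hr, U, t, hU, ht, hf⟩ := exists_frame_away f hL ⟨q, hq⟩
    let ρ : R ⟶ .of (Localization.AtPrime q) :=
      CommRingCat.ofHom (algebraMap R (Localization.AtPrime q))
    have hf := hf ρ (IsLocalization.map_units (M := q.primeCompl) _ ⟨r, hr⟩)
    have key := (h.det_mulLeft_iff (Spec.map ρ ≫ f) ht hf hU hu hab).mpr (by
      rw [← map_pow]
      exact congrArg _ (hs U t ht)) (fnMap G f ρ x)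
    rw [← det_mulLeft_fnMap f ρ rfl x] at key
    exact ((map_prod ρ.hom _ _).trans
      (Finset.prod_congr rfl fun i _ => (evalSection_fnMap ρ _ f x).symm)).trans key.symm

theorem fnMap_muFn {R R' : CommRingCat.{u}} (f : Spec R ⟶ S) (ρ : R ⟶ R') (κ : G ⟶ muGroup S p) :
    fnMap G f ρ (muFn κ f) = muFn κ (Spec.map ρ ≫ f) :=
  congr($((pullbackProj G f ρ).comp_appTop (pullback.fst G.hom f)) (muPull κ)).symm.trans
    congr(($(pullbackProj_fst G f ρ)).appTop (muPull κ))

theorem GivenByCosection.isCogenerator_iff {κ : G ⟶ muGroup S p} {v : TensorSection L (-1)}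
    (h : GivenByCosection e κ v) (hL : IsInvertibleSheaf L)
    (hab : (a.tmul b).Same (TensorSection.const L (str (w p p)))) :
    IsCogenerator κ ↔ (v.pow (p - 1)).Same b := by
  constructor
  · intro hκ
    refine TensorSection.same_of_isAffineOpen fun U t ht hU => ?_
    have hf := le_preimage_fromSpec hU
    obtain ⟨B, -⟩ := e.exists_basis hU.fromSpec ht hf hU
    have := Module.Free.of_basis B
    have := Module.Finite.of_basis B
    have key := (h.det_dualMulLeft_iff hU.fromSpec ht hf hU hab).mp fun φ =>
      (isDet_iff _ _).mp (hκ _ hU.fromSpec φ)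
    rwa [chartMap_fromSpec, chartMap_fromSpec] at key
  · intro hs R f φ q hq
    obtain ⟨r, hr, U, t, hU, ht, hf⟩ := exists_frame_away f hL ⟨q, hq⟩
    let ρ : R ⟶ .of (Localization.AtPrime q) :=
      CommRingCat.ofHom (algebraMap R (Localization.AtPrime q))
    have hf := hf ρ (IsLocalization.map_units (M := q.primeCompl) _ ⟨r, hr⟩)
    have := e.finitePresentation_fn f hL
    -- Flatness of the localisation is needed because the linear forms, and not only the functions,
    -- are base changed.
    have : Module.Flat R (CommRingCat.of (Localization.AtPrime q)) :=
      IsLocalization.flat (Localization.AtPrime q) q.primeCompl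
    obtain ⟨φ', hφ', hdet⟩ := exists_det_dualMulLeft_eq f ρ (G := G) rfl φ
    have key := (h.det_dualMulLeft_iff (Spec.map ρ ≫ f) ht hf hU hab).mpr (by
      rw [← map_pow]
      exact congrArg _ (hs U t ht)) φ'
    rw [← hdet] at key
    refine ((map_prod ρ.hom _ _).trans (Finset.prod_congr rfl fun i _ => ?_)).trans key.symm
    rw [← fnMap_muFn]
    exact ((congrArg φ' (map_pow (fnMap G f ρ) (muFn κ f) i.val).symm).trans (hφ' _)).symm

end Main

end TateOort


theorem lemmaA4 (p : ℕ) [Fact p.Prime] {S : Scheme.{u}} (str : TateOort.Lambda p →+* Γ(S, ⊤))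
    (L : S.Modules) (hL : TateOort.IsInvertibleSheaf L)
    (a : TateOort.TensorSection L (p - 1)) (b : TateOort.TensorSection L (1 - p))
    (hab : (a.tmul b).Same (TateOort.TensorSection.const L (str (TateOort.w p p))))
    (G : Over S) [GrpObj G] [IsAffineHom G.hom] (e : TateOort.IsoTateOort str a b G) :
    (∀ (γ : TateOort.constGroup S p ⟶ G) [IsMonHom γ] (u : Γ(L, ⊤)),
      ((TateOort.TensorSection.ofSection u).pow p).Same
          ((TateOort.TensorSection.ofSection u).tmul a) →
        TateOort.GivenBySection e γ u →
          (TateOort.IsGenerator γ ↔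
            ((TateOort.TensorSection.ofSection u).pow (p - 1)).Same a)) ∧
    (∀ (κ : G ⟶ TateOort.muGroup S p) [IsMonHom κ] (v : TateOort.TensorSection L (-1)),
      (v.pow p).Same (v.tmul b) → TateOort.GivenByCosection e κ v →
        (TateOort.IsCogenerator κ ↔ (v.pow (p - 1)).Same b)) :=
  ⟨fun _ _ _ hu h => h.isGenerator_iff hL hu hab, fun _ _ _ _ h => h.isCogenerator_iff hL hab⟩
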